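/- **Setting.** Fix $w\ge 1$, $E\ge 0$ and a prime $p$. A *float* is a positive decimal $s\cdot 2^{e}$ with $2^{w-1}\le s<2^w$ and $|e|\le E$, represented over $\mathbb F_p$ by the pair $(s,e)$; put $\delta=2^{-(w-1)}$. There are $m$ workers and $n$ tasks. $V=(V_1,\dots,V_m)$ with $V_j$ a vector of $n$ floats are the answers, $V^*$ ($n$ floats) is the inferred truth, $Q$ ($m$ floats) are the qualities, $\eta$ ($h$ floats) are public prior factors. One iteration $f$ of a truth inference algorithm is a straight-line program, started on $(V,\eta)$ and returning $(V^*,Q)$, over the operations: public constant, $+$, $\cdot$, $/$, equality and $\le$ indicators, negation of a bit, selection by a bit, and counting set bits (giving a float). * *Honest execution* $f(V,\eta)=(V^*,Q)$: every result is normalized and rounded down. It is defined if all operations stay in range: the exponents of the two summands of an addition differ by at most $w$ (so that the aligned sum is a $2w$-bit integer), every count lies in $[1,2^w)$, and the outputs are floats. * *Correctness in the relative error model*, written $(V^*,Q)\in f_\delta(V,\eta)$: there is an execution in which each arithmetic result $(s_c,e_c)$ is any pair with $2^{w-1}\le s_c<2^w$ that satisfies $x-y\le\delta x$ and $y-x<\delta(2^{2w}-x)$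 over the integers, where for $a\cdot b$: $x=s_as_b$, $y=s_c2^\theta$, $e_c-\theta=e_a+e_b$, $\theta\in\{w-1,w\}$; for $a/b$: $x=s_a2^\theta$, $y=s_cs_b$, $e_c+\theta=e_a-e_b$, $\theta\in\{w-1,w\}$; for $a+b$ with $e_a\ge e_b$ (up to exchange): $x=s_a2^\lambda+s_b$, $y=s_c2^\theta$, $\lambda=e_a-e_b\le w$, $e_c-\theta=e_b$, $\theta\in\{\lambda,\lambda+1\}$. All other operations are exact. **Protocol 1.** Let $\mathsf{Commit}$ be an efficient, computationally hiding and binding commitment scheme for vectors over $\mathbb F_p$ that is computed by arithmetic circuits over $\mathbb F_p$. Let $C_\kappa$ ($\kappa$ the security parameter) be the circuit over $\mathbb F_p$ that consists of $f$, with each $\cdot$, $/$, $+$ replaced by the circuits $\mathsf{FloatMul}_w$, $\mathsf{FloatDiv}_w$, $\mathsf{FloatAdd}_w$ and each other operation by its circuit, and of the openings of the $m+1$ commitments. Its public input is $x=(\mathsf{com}_{V_1},\dots,\mathsf{com}_{V_m},\mathsf{com}_{V^*},Q,\eta)$, its witness is $V$, $V^*$, the commitment randomness and auxiliary values. Let $\mathsf{ZKP}$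 be any proof system that is a zero-knowledge argument of knowledge for the family $(C_\kappa)$: all algorithms PPT, perfectly complete, knowledge sound, zero-knowledge with a simulator that generates public parameters together with a trapdoor. $\mathsf{Setup}$ runs $\mathsf{ZKP.Setup}$ and adds $\eta$; $\mathsf{Commit}$ commits to each $V_j$ and to $V^*$ with independent randomness; $\mathsf{Prove}$ and $\mathsf{Verify}$ run $\mathsf{ZKP.Prove}$ and $\mathsf{ZKP.Verify}$ for $C_\kappa$ and $x$. **Theorem.** Suppose that $p>2^{3w+1}$ and $p>2^{w+k+1}$, where $k$ is the bit length of $2M$, and $M$ is the bound for all exponents and counters of $f$ that results from propagating, operation by operation, the bounds $E$ for inputs and constants, $\max(a,b)+1$ for sums, $a+b+w$ for products and quotients, $\max(a,b)$ for selections, and $w$ (and the number of bits counted) for counts. Then Protocol 1 is a zero-knowledge truth inference protocol for $f$ and $\eta$. That is, its algorithms are PPT (also the computation of the auxiliary inputs), and: 1. *Completeness.* If $f(V,\eta)=(V^*,Q)$, then the honestly generated proof is accepted with probability $1$. 2. *Soundness.* For every PPT adversary that on input $\kappa$ and the public parameters outputs commitments together with openings to answers $V$ and a truth $V^*$, and $Q$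 and a proof, the probability that the openings are valid, the proof is accepted, and $(V^*,Q)\notin f_\delta(V,\eta)$ is negligible in $\kappa$. 3. *Zero knowledge.* There are PPT simulators $S_1,S_2$ such that, whenever $f(V,\eta)=(V^*,Q)$, no PPT distinguisher that is also given $Q$ tells (public parameters, commitments, proof) of the honest execution from (public parameters, commitments) output by $S_1$ and the proof output by $S_2$ from these, the state of $S_1$ and $Q$, except with negligible advantage. In particular this holds for the following two algorithms. *CRH*: $\eta=(q_j)$, $v_i^*=\sum_j q_jv_i^j/\sum_jq_j$, and the new quality of worker $j$ is $\sum_{j',i}d(v_i^{j'},v_i^*)/\sum_id(v_i^j,v_i^*)$ (the logarithm of which is public), for every way to compute the total distances by the above operations, for example for the sum of a float-valued distance, or for the number of differing pairs. *ZenCrowd* with choices $c_1,\dots,c_l$: $\eta=(q_j,1-q_j)$, $\Pr(v_i^*=c_k)$ is $\prod_jq_j^{\mathbb 1(v_i^j,c_k)}(1-q_j)^{1-\mathbb 1(v_i^j,c_k)}$ normalized over $k$, $v_i^*$ is a choice of the highest probability, and the new quality of worker $j$ is the mean over $i$ of $\Pr(v_i^*=v_i^j)$. -/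

import Mathlib

noncomputable section

namespace ZkTI

/-! ### Probabilistic polynomial time -/

/-- Binary trees: the data on which programs work. They also serve as the type of arbitrary
strings (public parameters, proofs, trapdoors). -/
inductive Data : Type
  | leaf : Data
  | node : Data → Data → Data

/-- The number of nodes of a tree. -/
def Data.size : Data → ℕ
  | .leaf => 1
  | .node l r => 1 + l.size + r.size

/-- Programs over binary trees with coin flips. -/
inductive Prog : Type
  /-- the constant `leaf` -/
  | leaf : Prog
  /-- the identity -/
  | id : Prog
  /-- `comp g f`: first `f`, then `g` -/
  | comp : Prog → Prog → Prog
  /-- `pair f g` maps `x` to `node (f x) (g x)` -/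
  | pair : Prog → Prog → Prog
  /-- left subtree (`leaf` has left subtree `leaf`) -/
  | fst : Prog
  /-- right subtree (`leaf` has right subtree `leaf`) -/
  | snd : Prog
  /-- `cond f g` runs `f` on the right subtree if the left one is `leaf`, and `g` otherwise -/
  | cond : Prog → Prog → Prog
  /-- `loop f`: while the left subtree is not `leaf`, replace the current tree `x` by `f x` -/
  | loop : Prog → Prog
  /-- a fair coin: `leaf` or `node leaf leaf` -/
  | flip : Prog

/-- Left subtree. -/
def Data.left : Data → Data
  | .leaf => .leaf
  | .node l _ => l

/-- Right subtree. -/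
def Data.right : Data → Data
  | .leaf => .leaf
  | .node _ r => r

/-- Result of a run: `none` if the time budget was exceeded, otherwise the output together with
the time that is left. -/
abbrev Outcome : Type := PMF (Option (Data × ℕ))

/-- Pay `c` time units out of the budget `t`, and go on with what is left. -/
def charge (c t : ℕ) (k : ℕ → Outcome) : Outcome :=
  if c ≤ t then k (t - c) else PMF.pure none

/-- Sequential composition of runs. -/
def andThen (d : Outcome) (k : Data → ℕ → Outcome) : Outcome :=
  d.bind fun o => match o with
    | none => PMF.pure none
    | some (y, t) => k y t

/-- A while loop with the given body. Each round costs time, so a number of rounds that exceeds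
the time budget is never used up. -/
def loopRun (body : ℕ → Data → Outcome) : ℕ → ℕ → Data → Outcome
  | 0, _, _ => PMF.pure none
  | rounds + 1, t, x => charge (x.size + 3) t fun t' =>
      match x.left with
      | .leaf => PMF.pure (some (x, t'))
      | .node _ _ => andThen (body t' x) fun y t'' => loopRun body rounds t'' y

/-- `P.run t x` runs `P` on `x` with time budget `t`. Every elementary step costs the size of the
tree it works on plus three, so that time also bounds the size of everything that is built. -/
def Prog.run : Prog → ℕ → Data → Outcome
  | .leaf, t, x => charge (x.size + 3) t fun t' => PMF.pure (some (.leaf, t'))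
  | .id, t, x => charge (x.size + 3) t fun t' => PMF.pure (some (x, t'))
  | .comp g f, t, x => charge (x.size + 3) t fun t' => andThen (f.run t' x) fun y t'' => g.run t'' y
  | .pair f g, t, x => charge (x.size + 3) t fun t' =>
      andThen (f.run t' x) fun y t₁ => andThen (g.run t₁ x) fun z t₂ =>
        PMF.pure (some (.node y z, t₂))
  | .fst, t, x => charge (x.size + 3) t fun t' => PMF.pure (some (x.left, t'))
  | .snd, t, x => charge (x.size + 3) t fun t' => PMF.pure (some (x.right, t'))
  | .cond f g, t, x => charge (x.size + 3) t fun t' =>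
      match x.left with
      | .leaf => f.run t' x.right
      | .node _ _ => g.run t' x.right
  | .loop f, t, x => loopRun (fun t' y => f.run t' y) (t + 1) t x
  | .flip, t, x => charge (x.size + 3) t fun t' =>
      (PMF.uniformOfFintype Bool).bind fun b =>
        PMF.pure (some (if b then .node .leaf .leaf else .leaf, t'))

/-- Encoding of the values of a type as trees. -/
class Enc (α : Type) where
  enc : α → Data

instance : Enc Data := ⟨fun d => d⟩

instance : Enc Bool := ⟨fun b => if b then .node .leaf .leaf else .leaf⟩

/-- Natural numbers are only used for the security parameter and for lengths of messages, and are
written in unary. -/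
instance : Enc ℕ := ⟨fun n => n.rec .leaf fun _ d => .node .leaf d⟩

/-- Encoding of lists. -/
def encList {α : Type} [Enc α] : List α → Data
  | [] => .leaf
  | a :: l => .node (Enc.enc a) (encList l)

instance {α : Type} [Enc α] : Enc (List α) := ⟨encList⟩

instance {α β : Type} [Enc α] [Enc β] : Enc (α × β) :=
  ⟨fun x => .node (Enc.enc x.1) (Enc.enc x.2)⟩

instance {α : Type} [Enc α] {n : ℕ} : Enc (Fin n → α) := ⟨fun v => Enc.enc (List.ofFn v)⟩

/-- Residues modulo `p` are written in binary. -/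
instance {p : ℕ} : Enc (ZMod p) := ⟨fun a => Enc.enc (Nat.bits a.val)⟩

/-- `A` is a probabilistic polynomial time algorithm: some program halts on every input within a
number of steps polynomial in the length of the input, whatever the coins, and its output is
distributed as `A` says. -/
def IsPPT {α β : Type} [Enc α] [Enc β] (A : α → PMF β) : Prop :=
  ∃ (P : Prog) (q : Polynomial ℕ), ∀ a : α,
    (P.run (q.eval (Enc.enc a).size) (Enc.enc a)).map (Option.map Prod.fst) =
      (A a).map fun b => some (Enc.enc b)

/-- Probability of an event. -/
def prob {α : Type} (d : PMF α) (S : Set α) : ℝ := (d.toOuterMeasure S).toReal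

/-- A function of the security parameter is negligible if it decays faster than every inverse
polynomial. -/
def Negligible (ν : ℕ → ℝ) : Prop :=
  Asymptotics.SuperpolynomialDecay Filter.atTop (fun n : ℕ => (n : ℝ)) ν

/-- `n` independent samples. -/
def samples {α : Type} (d : PMF α) : (n : ℕ) → PMF (Fin n → α)
  | 0 => PMF.pure Fin.elim0
  | n + 1 => d.bind fun a => (samples d n).bind fun v => PMF.pure (Fin.cons a v)

/-! ### Arithmetic circuits -/

/-- Arithmetic expressions over the ring `F` in wires `ι`. -/
inductive Expr (F ι : Type) : Type
  | const : F → Expr F ι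
  | wire : ι → Expr F ι
  | add : Expr F ι → Expr F ι → Expr F ι
  | sub : Expr F ι → Expr F ι → Expr F ι
  | mul : Expr F ι → Expr F ι → Expr F ι

namespace Expr

instance {F ι : Type} : Add (Expr F ι) := ⟨Expr.add⟩
instance {F ι : Type} : Sub (Expr F ι) := ⟨Expr.sub⟩
instance {F ι : Type} : Mul (Expr F ι) := ⟨Expr.mul⟩

/-- Value of an expression under an assignment of the wires. -/
def eval {F ι : Type} [CommRing F] (v : ι → F) : Expr F ι → F
  | const c => c
  | wire i => v i
  | add a b => a.eval v + b.eval v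
  | sub a b => a.eval v - b.eval v
  | mul a b => a.eval v * b.eval v

/-- Renaming of wires. -/
def rename {F ι κ : Type} (f : ι → κ) : Expr F ι → Expr F κ
  | const c => const c
  | wire i => wire (f i)
  | add a b => add (a.rename f) (b.rename f)
  | sub a b => sub (a.rename f) (b.rename f)
  | mul a b => mul (a.rename f) (b.rename f)

/-- Sum of a list of expressions. -/
def sum {F ι : Type} [CommRing F] (l : List (Expr F ι)) : Expr F ι := l.foldr Expr.add (const 0)

/-- Product of a list of expressions. -/
def prod {F ι : Type} [CommRing F] (l : List (Expr F ι)) : Expr F ι := l.foldr Expr.mul (const 1)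

end Expr

/-- Input wires of a circuit. Public inputs and witnesses are given in blocks: `pub i j` is the
`j`-th entry of the `i`-th public block. -/
inductive Wire : Type
  | pub : ℕ → ℕ → Wire
  | wit : ℕ → ℕ → Wire

/-- A list of blocks of field elements. -/
abbrev Blocks (F : Type) : Type := List (List F)

/-- An arithmetic circuit with public and private inputs: the lengths of the input blocks, and the
expressions that have to vanish. -/
structure Circuit (F : Type) where
  pubShape : List ℕ
  witShape : List ℕ
  constraints : List (Expr F Wire)

/-- The values that a public input `x` and a witness `y` put on the wires. -/
def assign {F : Type} [CommRing F] (x y : Blocks F) : Wire → F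
  | .pub i j => (x.getD i []).getD j 0
  | .wit i j => (y.getD i []).getD j 0

/-- The circuit accepts the public input `x` with the witness `y`. -/
def Circuit.Sat {F : Type} [CommRing F] (C : Circuit F) (x y : Blocks F) : Prop :=
  x.map List.length = C.pubShape ∧ y.map List.length = C.witShape ∧
    ∀ g ∈ C.constraints, g.eval (assign x y) = 0

/-! ### Generic zero-knowledge proofs for circuits -/

/-- A ZKP system for arithmetic circuits, as three randomized algorithms. The first argument is the
security parameter; public parameters and proofs are arbitrary strings. -/
structure ZKP (F : Type) where
  setup : ℕ → PMF Data
  prove : ℕ → Circuit F → Data → Blocks F → Blocks F → PMF Data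
  verify : ℕ → Circuit F → Data → Blocks F → Data → PMF Bool

/-- For the family `C` of circuits, indexed by the security parameter, the system is a
zero-knowledge argument of knowledge: its algorithms are efficient, and it is complete, knowledge
sound and zero-knowledge. -/
structure ZKP.IsZKAoK {F : Type} [CommRing F] [Enc F] (Z : ZKP F) (C : ℕ → Circuit F) : Prop where
  ppt_setup : IsPPT Z.setup
  ppt_prove : IsPPT fun i : ℕ × Data × Blocks F × Blocks F =>
    Z.prove i.1 (C i.1) i.2.1 i.2.2.1 i.2.2.2
  ppt_verify : IsPPT fun i : ℕ × Data × Blocks F × Data =>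
    Z.verify i.1 (C i.1) i.2.1 i.2.2.1 i.2.2.2
  complete : ∀ (κ : ℕ) (x y : Blocks F), (C κ).Sat x y →
    ((Z.setup κ).bind fun pp => (Z.prove κ (C κ) pp x y).bind fun π =>
      Z.verify κ (C κ) pp x π) = PMF.pure true
  /-- For every prover `A` that outputs a statement, a proof and some state, there is an efficient
  `E` that outputs the same together with a witness, which is valid whenever the proof is accepted,
  except with negligible probability. -/
  sound : ∀ A : ℕ × Data → PMF (Blocks F × Data × Data), IsPPT A →
    ∃ E : ℕ × Data → PMF ((Blocks F × Data × Data) × Blocks F), IsPPT E ∧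
      (∀ i, (E i).map Prod.fst = A i) ∧
      Negligible fun κ => prob
        ((Z.setup κ).bind fun pp => (E (κ, pp)).bind fun o =>
          (Z.verify κ (C κ) pp o.1.1 o.1.2.1).bind fun b => PMF.pure (o, b))
        {r | r.2 = true ∧ ¬ (C κ).Sat r.1.1.1 r.1.2}
  /-- There is a simulator, which generates public parameters with a trapdoor, and then proofs
  without witnesses. -/
  zk : ∃ (S₁ : ℕ → PMF (Data × Data)) (S₂ : ℕ × Data × Data × Blocks F → PMF Data),
    IsPPT S₁ ∧ IsPPT S₂ ∧
    ∀ D : ℕ × Data × Blocks F × Data → PMF Bool, IsPPT D →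
      ∃ ν : ℕ → ℝ, Negligible ν ∧ ∀ (κ : ℕ) (x y : Blocks F), (C κ).Sat x y →
        |prob ((Z.setup κ).bind fun pp => (Z.prove κ (C κ) pp x y).bind fun π =>
            D (κ, pp, x, π)) {true} -
          prob ((S₁ κ).bind fun s => (S₂ (κ, s.1, s.2, x)).bind fun π =>
            D (κ, s.1, x, π)) {true}| ≤ ν κ

/-! ### Commitments -/

/-- Wires of the circuit that opens a commitment. -/
inductive ComWire : Type
  | com : ℕ → ComWire
  | msg : ℕ → ComWire
  | rnd : ℕ → ComWire
  | aux : ℕ → ComWire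

/-- A commitment scheme that comes with arithmetic circuits. A message is a vector over `F`, and
`com κ msg r` is the commitment to `msg` with randomness `r`. For messages of length `ℓ`, the
randomness is distributed as `rnd κ ℓ`, and the expressions `gates κ ℓ` are the circuit that computes
commitments, with auxiliary wires whose honest values are `aux κ msg r`. -/
structure CommitScheme (F : Type) where
  rnd : ℕ → ℕ → PMF (List F)
  com : ℕ → List F → List F → List F
  rndLen : ℕ → ℕ → ℕ
  comLen : ℕ → ℕ → ℕ
  auxLen : ℕ → ℕ → ℕ
  gates : ℕ → ℕ → List (Expr F ComWire)
  aux : ℕ → List F → List F → List F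

/-- Values on the wires of the opening circuit. -/
def comAssign {F : Type} [CommRing F] (c msg r a : List F) : ComWire → F
  | .com i => c.getD i 0
  | .msg i => msg.getD i 0
  | .rnd i => r.getD i 0
  | .aux i => a.getD i 0

/-- The scheme is efficient, the circuits compute it, and it is hiding and binding. -/
structure CommitScheme.IsSecure {F : Type} [CommRing F] [Enc F] (K : CommitScheme F) : Prop where
  ppt_rnd : IsPPT fun i : ℕ × ℕ => K.rnd i.1 i.2
  ppt_com : IsPPT fun i : ℕ × List F × List F => PMF.pure (K.com i.1 i.2.1 i.2.2)
  ppt_aux : IsPPT fun i : ℕ × List F × List F => PMF.pure (K.aux i.1 i.2.1 i.2.2)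
  rnd_length : ∀ κ ℓ, ∀ r ∈ (K.rnd κ ℓ).support, r.length = K.rndLen κ ℓ
  com_length : ∀ κ msg r, r.length = K.rndLen κ msg.length →
    (K.com κ msg r).length = K.comLen κ msg.length
  /-- The circuit accepts an honest opening ... -/
  gates_complete : ∀ κ msg r, r.length = K.rndLen κ msg.length →
    (K.aux κ msg r).length = K.auxLen κ msg.length ∧
    ∀ g ∈ K.gates κ msg.length, g.eval (comAssign (K.com κ msg r) msg r (K.aux κ msg r)) = 0
  /-- ... and nothing but an opening. -/
  gates_sound : ∀ κ c msg r a, r.length = K.rndLen κ msg.length →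
    c.length = K.comLen κ msg.length → a.length = K.auxLen κ msg.length →
    (∀ g ∈ K.gates κ msg.length, g.eval (comAssign c msg r a) = 0) → c = K.com κ msg r
  isHiding : ∀ msg₀ msg₁ : List F, msg₀.length = msg₁.length →
    ∀ D : ℕ × List F → PMF Bool, IsPPT D →
      Negligible fun κ =>
        |prob ((K.rnd κ msg₀.length).bind fun r => D (κ, K.com κ msg₀ r)) {true} -
          prob ((K.rnd κ msg₁.length).bind fun r => D (κ, K.com κ msg₁ r)) {true}|
  isBinding : ∀ A : ℕ → PMF ((List F × List F) × (List F × List F)), IsPPT A →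
    Negligible fun κ => prob (A κ)
      {o | o.1.1 ≠ o.2.1 ∧ o.1.1.length = o.2.1.length ∧
        K.com κ o.1.1 o.1.2 = K.com κ o.2.1 o.2.2}

/-! ### Floating-point numbers -/

/-- A pair `(s, e)`, which stands for the positive decimal `s * 2 ^ e`. -/
structure Dec where
  s : ℕ
  e : ℤ

/-- The significand has exactly `w` bits. -/
def Dec.Normal (w : ℕ) (a : Dec) : Prop := 2 ^ (w - 1) ≤ a.s ∧ a.s < 2 ^ w

/-- Floating-point numbers with `w`-bit significand and exponent in `[-E, E]`: the format of all
inputs and outputs. -/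
structure Flt (w E : ℕ) where
  val : Dec
  normal : val.Normal w
  range : |val.e| ≤ E

/-- The precision (relative error). -/
def δ (w : ℕ) : ℚ := (2 ^ (w - 1))⁻¹

/-- `y` is an admissible rounding of the `2 w`-bit number `x`: the relative error of rounding down
is at most `δ`, and that of rounding up is below `δ * (2 ^ (2 w) / x - 1)`. -/
def Rounds (w : ℕ) (x y : ℚ) : Prop := x - y ≤ δ w * x ∧ y - x < δ w * (2 ^ (2 * w) - x)

/-- `c` is an admissible result of `a * b`. -/
def MulRel (w : ℕ) (a b c : Dec) : Prop :=
  c.Normal w ∧ ∃ θ : ℕ, (θ = w - 1 ∨ θ = w) ∧ c.e - θ = a.e + b.e ∧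
    Rounds w (a.s * b.s) (c.s * 2 ^ θ)

/-- `c` is an admissible result of `a / b`. -/
def DivRel (w : ℕ) (a b c : Dec) : Prop :=
  c.Normal w ∧ ∃ θ : ℕ, (θ = w - 1 ∨ θ = w) ∧ c.e + θ = a.e - b.e ∧
    Rounds w (a.s * 2 ^ θ) (c.s * b.s)

/-- `c` is an admissible result of `a + b`, where `a` has the larger exponent. The gap `l` of
the exponents is at most `w`, so that the aligned sum has at most `2 w` bits. -/
def AddCore (w : ℕ) (a b c : Dec) : Prop :=
  c.Normal w ∧ ∃ l θ : ℕ, l ≤ w ∧ (θ = l ∨ θ = l + 1) ∧ b.e + l = a.e ∧ c.e - θ = b.e ∧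
    Rounds w (a.s * 2 ^ l + b.s) (c.s * 2 ^ θ)

/-- `c` is an admissible result of `a + b`. -/
def AddRel (w : ℕ) (a b c : Dec) : Prop := AddCore w a b c ∨ AddCore w b a c

/-- The product, rounded down. -/
def Dec.mul (w : ℕ) (a b : Dec) : Dec :=
  let θ := if a.s * b.s < 2 ^ (2 * w - 1) then w - 1 else w
  ⟨a.s * b.s / 2 ^ θ, a.e + b.e + θ⟩

/-- The quotient, rounded down. -/
def Dec.div (w : ℕ) (a b : Dec) : Dec :=
  let θ := if b.s ≤ a.s then w - 1 else w
  ⟨a.s * 2 ^ θ / b.s, a.e - b.e - θ⟩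

/-- The sum, rounded down, where `a` has the larger exponent. -/
def Dec.addCore (w : ℕ) (a b : Dec) : Dec :=
  let l := (a.e - b.e).toNat
  let x := a.s * 2 ^ l + b.s
  let θ := if x < 2 ^ (w + l) then l else l + 1
  ⟨x / 2 ^ θ, b.e + θ⟩

/-- The sum, rounded down. It is out of range if the exponents differ by more than `w`, that is, if
the aligned sum has more than `2 w` bits. -/
def Dec.add (w : ℕ) (a b : Dec) : Option Dec :=
  if |a.e - b.e| ≤ w then some (if b.e ≤ a.e then Dec.addCore w a b else Dec.addCore w b a)
  else none

/-- The integer `t` as a floating-point number, for `0 < t < 2 ^ w`. -/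
def Dec.ofNat (w t : ℕ) : Option Dec :=
  if 0 < t ∧ t < 2 ^ w then some ⟨t * 2 ^ (w - Nat.size t), -((w - Nat.size t : ℕ) : ℤ)⟩ else none

/-- Equality of floating-point numbers. -/
def Dec.beq (a b : Dec) : Bool := decide (a.s = b.s ∧ a.e = b.e)

/-- Order of floating-point numbers. -/
def Dec.ble (a b : Dec) : Bool := decide (a.e < b.e ∨ (a.e = b.e ∧ a.s ≤ b.s))

/-! ### Truth inference algorithms -/

/-- The operations out of which an iteration of a truth inference algorithm is composed. Operands
are positions in the list of the decimals, or of the bits, computed so far. -/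
inductive Instr (w E : ℕ) : Type
  /-- a public constant -/
  | const : Flt w E → Instr w E
  | add : ℕ → ℕ → Instr w E
  | mul : ℕ → ℕ → Instr w E
  | div : ℕ → ℕ → Instr w E
  /-- selector: `sel b i j` is decimal `i` if bit `b` is set, and decimal `j` otherwise -/
  | sel : ℕ → ℕ → ℕ → Instr w E
  /-- the number of bits that are set among those listed, as a decimal -/
  | count : List ℕ → Instr w E
  /-- indicator of equality of two decimals -/
  | eq : ℕ → ℕ → Instr w E
  /-- indicator of `≤` between two decimals -/
  | le : ℕ → ℕ → Instr w E
  /-- negation of a bit -/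
  | not : ℕ → Instr w E

/-- The values computed so far. -/
structure State where
  decs : List Dec
  bits : List Bool

/-- The `i`-th decimal, or a default value. -/
def State.dec (w : ℕ) (st : State) (i : ℕ) : Dec := st.decs.getD i ⟨2 ^ (w - 1), 0⟩

/-- The `i`-th bit, or a default value. -/
def State.bit (st : State) (i : ℕ) : Bool := st.bits.getD i false

/-- The number of bits set among those listed. -/
def State.count (st : State) (l : List ℕ) : ℕ := l.countP fun i => st.bit i

/-- Append a decimal. -/
def State.pushDec (st : State) (c : Dec) : State := ⟨st.decs ++ [c], st.bits⟩

/-- Append a bit. -/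
def State.pushBit (st : State) (b : Bool) : State := ⟨st.decs, st.bits ++ [b]⟩

/-- Honest execution of an operation, all rounding being downwards; `none` if a result is out of
range. -/
def Instr.exec {w E : ℕ} (st : State) : Instr w E → Option State
  | .const c => some (st.pushDec c.val)
  | .add i j => (Dec.add w (st.dec w i) (st.dec w j)).map st.pushDec
  | .mul i j => some (st.pushDec (Dec.mul w (st.dec w i) (st.dec w j)))
  | .div i j => some (st.pushDec (Dec.div w (st.dec w i) (st.dec w j)))
  | .sel b i j => some (st.pushDec (if st.bit b then st.dec w i else st.dec w j))
  | .count l => (Dec.ofNat w (st.count l)).map st.pushDec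
  | .eq i j => some (st.pushBit ((st.dec w i).beq (st.dec w j)))
  | .le i j => some (st.pushBit ((st.dec w i).ble (st.dec w j)))
  | .not b => some (st.pushBit (!st.bit b))

/-- `st'` is an admissible result of the operation: arithmetic is correct up to the relative error,
everything else is exact. -/
def Instr.Step {w E : ℕ} (st st' : State) : Instr w E → Prop
  | .add i j => ∃ c, AddRel w (st.dec w i) (st.dec w j) c ∧ st' = st.pushDec c
  | .mul i j => ∃ c, MulRel w (st.dec w i) (st.dec w j) c ∧ st' = st.pushDec c
  | .div i j => ∃ c, DivRel w (st.dec w i) (st.dec w j) c ∧ st' = st.pushDec c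
  | ins => ins.exec st = some st'

/-- Honest execution of a list of operations. -/
def exec {w E : ℕ} : List (Instr w E) → State → Option State
  | [], st => some st
  | ins :: code, st => (ins.exec st).bind (exec code)

/-- Execution of a list of operations up to the relative error. -/
def Steps {w E : ℕ} : List (Instr w E) → State → State → Prop
  | [], st, st' => st' = st
  | ins :: code, st, st' => ∃ st₁, ins.Step st st₁ ∧ Steps code st₁ st'

/-- Vectors of floating-point numbers; over the field with `p` elements each number is represented
by its significand and its exponent. -/
def FVec (_p w E n : ℕ) : Type := Fin n → Flt w E

/-- The field elements that represent a vector. -/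
def FVec.toField {p w E n : ℕ} (v : FVec p w E n) : List (ZMod p) :=
  (List.ofFn fun i : Fin n => v i).flatMap fun x => [(x.val.s : ZMod p), (x.val.e : ZMod p)]

instance {p w E n : ℕ} : Enc (FVec p w E n) := ⟨fun v => Enc.enc v.toField⟩

/-- One iteration of a truth inference algorithm for `m` workers, `n` tasks and `h` prior factors:
a straight-line program, which starts with the answers (worker by worker) followed by the
prior factors, and the positions of the inferred truth and of the qualities among its decimals. -/
structure TIAlg (w E m n h : ℕ) where
  code : List (Instr w E)
  truth : Fin n → ℕ
  qual : Fin m → ℕ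

namespace TIAlg

variable {p w E m n h : ℕ}

/-- The values at the beginning. -/
def init (V : Fin m → FVec p w E n) (η : FVec p w E h) : State :=
  ⟨((List.ofFn fun j : Fin m => List.ofFn fun i : Fin n => (V j i).val).flatten) ++
    (List.ofFn fun i : Fin h => (η i).val), []⟩

/-- The outputs at the end. -/
def Outputs (f : TIAlg w E m n h) (st : State) (Vs : FVec p w E n) (Q : FVec p w E m) : Prop :=
  (∀ i, (Vs i).val = st.dec w (f.truth i)) ∧ ∀ j, (Q j).val = st.dec w (f.qual j)

/-- The honest execution on answers `V` and prior factors `η` stays in range and returns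
the inferred truth `Vs` and the qualities `Q`. -/
def Runs (f : TIAlg w E m n h) (V : Fin m → FVec p w E n) (η : FVec p w E h)
    (Vs : FVec p w E n) (Q : FVec p w E m) : Prop :=
  ∃ st, exec f.code (init V η) = some st ∧ f.Outputs st Vs Q

/-- `Vs` and `Q` are correct results of the algorithm on `V` and `η`, in the relative error model. -/
def Valid (f : TIAlg w E m n h) (V : Fin m → FVec p w E n) (η : FVec p w E h)
    (Vs : FVec p w E n) (Q : FVec p w E m) : Prop :=
  ∃ st, Steps f.code (init V η) st ∧ f.Outputs st Vs Q

/-- From bounds for the absolute values of the exponents so far, and a bound for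
everything so far, those after one more operation. -/
def bound (acc : List ℕ × ℕ) (ins : Instr w E) : List ℕ × ℕ :=
  let push (b : ℕ) : List ℕ × ℕ := (acc.1 ++ [b], max acc.2 b)
  match ins with
  | .const _ => push E
  | .add i j => push (max (acc.1.getD i 0) (acc.1.getD j 0) + 1)
  | .mul i j => push (acc.1.getD i 0 + acc.1.getD j 0 + w)
  | .div i j => push (acc.1.getD i 0 + acc.1.getD j 0 + w)
  | .sel _ i j => push (max (acc.1.getD i 0) (acc.1.getD j 0))
  | .count l => (acc.1 ++ [w], max acc.2 (max w l.length))
  | .eq _ _ => acc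
  | .le _ _ => acc
  | .not _ => acc

/-- A bound for the absolute values of all exponents, and for all counters, during the execution. -/
def magnitude (f : TIAlg w E m n h) : ℕ :=
  (f.code.foldl bound (List.replicate (m * n + h) E, E)).2

/-- The number of bits in which exponents are compared. -/
def width (f : TIAlg w E m n h) : ℕ := Nat.size (2 * f.magnitude)

end TIAlg

/-! ### Circuits for decimal arithmetic

Every gadget is the list of the expressions that have to vanish. -/

namespace Gadget

variable {p : ℕ} {ι : Type}

/-- A natural number as a constant expression. -/
def num (p : ℕ) {ι : Type} (t : ℕ) : Expr (ZMod p) ι := .const (t : ZMod p)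

/-- The expression vanishes or equals one. -/
def isBit (b : Expr (ZMod p) ι) : Expr (ZMod p) ι := b * (b - num p 1)

/-- `b 0, …, b (k - 1)` are the binary digits of `v`, the least significant first. -/
def bitDecompose (k : ℕ) (v : Expr (ZMod p) ι) (b : ℕ → Expr (ZMod p) ι) :
    List (Expr (ZMod p) ι) :=
  (List.range k).map (fun i => isBit (b i)) ++
    [v - Expr.sum ((List.range k).map fun i => num p (2 ^ i) * b i)]

/-- Comparison of `x` and `y`: `b` are the `k + 1` digits of `y - x + 2 ^ k`; the digit `b k` tells
whether `x ≤ y`. -/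
def compareBits (k : ℕ) (x y : Expr (ZMod p) ι) (b : ℕ → Expr (ZMod p) ι) :
    List (Expr (ZMod p) ι) :=
  bitDecompose (k + 1) (y - x + num p (2 ^ k)) b

/-- The comparison says `x ≤ y`. -/
def compare (k : ℕ) (x y : Expr (ZMod p) ι) (b : ℕ → Expr (ZMod p) ι) : List (Expr (ZMod p) ι) :=
  compareBits k x y b ++ [b k - num p 1]

/-- `s` is an integer of exactly `w` bits, with digits `b`. -/
def normalized (w : ℕ) (s : Expr (ZMod p) ι) (b : ℕ → Expr (ZMod p) ι) : List (Expr (ZMod p) ι) :=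
  bitDecompose w s b ++ [b (w - 1) - num p 1]

/-- `l ≤ w` and `r = 2 ^ l`, by repeated squaring along the binary digits of `l`.
It uses `2 * Nat.size w + 1` auxiliary wires `b`. -/
def exponentialCheck (w : ℕ) (l r : Expr (ZMod p) ι) (b : ℕ → Expr (ZMod p) ι) :
    List (Expr (ZMod p) ι) :=
  bitDecompose (Nat.size w) l b ++
    compare (Nat.size w) l (num p w) (fun i => b (Nat.size w + i)) ++
    [r - Expr.prod ((List.range (Nat.size w)).map fun i =>
      num p 1 + b i * (num p (2 ^ 2 ^ i) - num p 1))]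

/-- The pairs `A', B'` are `A, B`, or exchanged if the bit `t` is set. -/
def permutationCheck (A B A' B' : Expr (ZMod p) ι × Expr (ZMod p) ι) (t : Expr (ZMod p) ι) :
    List (Expr (ZMod p) ι) :=
  [isBit t,
    A'.1 - (A.1 + t * (B.1 - A.1)), A'.2 - (A.2 + t * (B.2 - A.2)),
    B'.1 - (B.1 + t * (A.1 - B.1)), B'.2 - (B.2 + t * (A.2 - B.2))]

/-- The rounding check `x - y ≤ δ x`, as `δ⁻¹ (x - y) ≤ x` for `2 w`-bit integers. -/
def rounding (w : ℕ) (x y : Expr (ZMod p) ι) (b : ℕ → Expr (ZMod p) ι) : List (Expr (ZMod p) ι) :=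
  compare (2 * w) (num p (2 ^ (w - 1)) * (x - y)) x b

/-- `θ` is `w` or `w - 1`. -/
def chooseTheta (w : ℕ) (θ : Expr (ZMod p) ι) : Expr (ZMod p) ι :=
  (θ - num p w) * (θ - num p (w - 1))

/-- `2 ^ θ`, for `θ` equal to `w` or `w - 1`, by interpolation. -/
def mid (w : ℕ) (θ : Expr (ZMod p) ι) : Expr (ZMod p) ι :=
  (θ - num p (w - 1)) * num p (2 ^ w) - (θ - num p w) * num p (2 ^ (w - 1))

/-- Multiplication. Here and below decimals are pairs (significand, exponent), and the result is the
pair of wires `a 0, a 1`. It uses `3 * w + 4` auxiliary wires `a`. -/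
def floatMul (w : ℕ) (A B : Expr (ZMod p) ι × Expr (ZMod p) ι) (a : ℕ → Expr (ZMod p) ι) :
    List (Expr (ZMod p) ι) :=
  let s := a 0; let e := a 1; let θ := a 2
  [e - θ - (A.2 + B.2), chooseTheta w θ] ++
    rounding w (A.1 * B.1) (s * mid w θ) (fun i => a (3 + w + i)) ++
    normalized w s (fun i => a (3 + i))

/-- Division. It uses `3 * w + 4` auxiliary wires `a`. -/
def floatDiv (w : ℕ) (A B : Expr (ZMod p) ι × Expr (ZMod p) ι) (a : ℕ → Expr (ZMod p) ι) :
    List (Expr (ZMod p) ι) :=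
  let s := a 0; let e := a 1; let θ := a 2
  [e + θ - (A.2 - B.2), chooseTheta w θ] ++
    rounding w (A.1 * mid w θ) (s * B.1) (fun i => a (3 + w + i)) ++
    normalized w s (fun i => a (3 + i))

/-- Addition, with exponents compared in `k` bits.
It uses `3 * w + 2 * Nat.size w + k + 13` auxiliary wires `a`. -/
def floatAdd (w k : ℕ) (A B : Expr (ZMod p) ι × Expr (ZMod p) ι) (a : ℕ → Expr (ZMod p) ι) :
    List (Expr (ZMod p) ι) :=
  let s := a 0; let e := a 1; let θ := a 2; let l := a 3; let mid' := a 4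
  let A' := (a 6, a 7); let B' := (a 8, a 9)
  let x := A'.1 * mid' + B'.1
  let y := s * (mid' * (θ - l + num p 1))
  permutationCheck A B A' B' (a 5) ++
    compare k B'.2 A'.2 (fun i => a (10 + 3 * w + 1 + 2 * Nat.size w + 1 + i)) ++
    [B'.2 - (e - θ), A'.2 - B'.2 - l, (θ - l) * (θ - (l + num p 1))] ++
    exponentialCheck w l mid' (fun i => a (10 + 3 * w + 1 + i)) ++
    rounding w x y (fun i => a (10 + w + i)) ++
    normalized w s (fun i => a (10 + i))

/-- Selection by the bit `b`: the result is `A` if it is set, and `B` otherwise.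
It uses `2` auxiliary wires. -/
def select (b : Expr (ZMod p) ι) (A B : Expr (ZMod p) ι × Expr (ZMod p) ι)
    (a : ℕ → Expr (ZMod p) ι) : List (Expr (ZMod p) ι) :=
  [a 0 - (B.1 + b * (A.1 - B.1)), a 1 - (B.2 + b * (A.2 - B.2))]

/-- The integer `t` as a normalized decimal. It uses `w + 2 * Nat.size w + 5` auxiliary wires. -/
def ofNat (w : ℕ) (t : Expr (ZMod p) ι) (a : ℕ → Expr (ZMod p) ι) : List (Expr (ZMod p) ι) :=
  let s := a 0; let e := a 1; let θ := a 2; let mid := a 3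
  [s - t * mid, e + θ] ++
    exponentialCheck w θ mid (fun i => a (4 + w + i)) ++
    normalized w s (fun i => a (4 + i))

/-- `z` is the indicator of `u = 0`; `v` is an inverse of `u` if there is one. -/
def isZero (u z v : Expr (ZMod p) ι) : List (Expr (ZMod p) ι) :=
  [z - (num p 1 - u * v), u * z]

/-- Indicator `a 0` of equality of two decimals. It uses `5` auxiliary wires. -/
def equal (A B : Expr (ZMod p) ι × Expr (ZMod p) ι) (a : ℕ → Expr (ZMod p) ι) :
    List (Expr (ZMod p) ι) :=
  isZero (A.1 - B.1) (a 1) (a 2) ++ isZero (A.2 - B.2) (a 3) (a 4) ++ [a 0 - a 1 * a 3]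

/-- Indicator of `≤` between two decimals, by comparison of `e * 2 ^ w + s` in `k + w` bits; it is
the wire `a (k + w)`. It uses `k + w + 1` auxiliary wires. -/
def lessEq (w k : ℕ) (A B : Expr (ZMod p) ι × Expr (ZMod p) ι) (a : ℕ → Expr (ZMod p) ι) :
    List (Expr (ZMod p) ι) :=
  compareBits (k + w) (A.2 * num p (2 ^ w) + A.1) (B.2 * num p (2 ^ w) + B.1) a

end Gadget

/-! ### Compilation of an algorithm into a circuit -/

/-- Wires of the values computed so far, and the number of auxiliary wires in use. -/
structure Layout (p : ℕ) where
  decs : List (Expr (ZMod p) Wire × Expr (ZMod p) Wire)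
  bits : List (Expr (ZMod p) Wire)
  next : ℕ

namespace Layout

variable {p : ℕ}

/-- The wires of the `i`-th decimal, or a default value. -/
def dec (w : ℕ) (L : Layout p) (i : ℕ) : Expr (ZMod p) Wire × Expr (ZMod p) Wire :=
  L.decs.getD i (Gadget.num p (2 ^ (w - 1)), Gadget.num p 0)

/-- The wire of the `i`-th bit, or a default value. -/
def bit (L : Layout p) (i : ℕ) : Expr (ZMod p) Wire := L.bits.getD i (Gadget.num p 0)

/-- A new decimal on the first two of `len` new auxiliary wires `a`. -/
def pushDec (L : Layout p) (a : ℕ → Expr (ZMod p) Wire) (len : ℕ) : Layout p :=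
  ⟨L.decs ++ [(a 0, a 1)], L.bits, L.next + len⟩

/-- A new bit `b`, with `len` new auxiliary wires. -/
def pushBit (L : Layout p) (b : Expr (ZMod p) Wire) (len : ℕ) : Layout p :=
  ⟨L.decs, L.bits ++ [b], L.next + len⟩

end Layout

/-- One operation, with exponents compared in `k` bits, and the auxiliary wires in witness block
`blk`. -/
def Instr.compile {p w E : ℕ} (k blk : ℕ) (L : Layout p) :
    Instr w E → Layout p × List (Expr (ZMod p) Wire) := fun ins =>
  let a : ℕ → Expr (ZMod p) Wire := fun i => .wire (.wit blk (L.next + i))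
  match ins with
  | .const c => (L.pushDec a 2, [a 0 - .const (c.val.s : ZMod p), a 1 - .const (c.val.e : ZMod p)])
  | .add i j => (L.pushDec a (3 * w + 2 * Nat.size w + k + 13),
      Gadget.floatAdd w k (L.dec w i) (L.dec w j) a)
  | .mul i j => (L.pushDec a (3 * w + 4), Gadget.floatMul w (L.dec w i) (L.dec w j) a)
  | .div i j => (L.pushDec a (3 * w + 4), Gadget.floatDiv w (L.dec w i) (L.dec w j) a)
  | .sel b i j => (L.pushDec a 2, Gadget.select (L.bit b) (L.dec w i) (L.dec w j) a)
  | .count l => (L.pushDec a (w + 2 * Nat.size w + 5),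
      Gadget.ofNat w (Expr.sum (l.map fun i => L.bit i)) a)
  | .eq i j => (L.pushBit (a 0) 5, Gadget.equal (L.dec w i) (L.dec w j) a)
  | .le i j => (L.pushBit (a (k + w)) (k + w + 1), Gadget.lessEq w k (L.dec w i) (L.dec w j) a)
  | .not b => (L.pushBit (a 0) 1, [a 0 - (Gadget.num p 1 - L.bit b)])

/-- A list of operations. -/
def compile {p w E : ℕ} (k blk : ℕ) :
    List (Instr w E) → Layout p → Layout p × List (Expr (ZMod p) Wire)
  | [], L => (L, [])
  | ins :: code, L =>
      let r := ins.compile k blk L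
      let r' := compile k blk code r.1
      (r'.1, r.2 ++ r'.2)

namespace TIAlg

variable {w E m n h : ℕ}

/-- The `i`-th decimal in a block of wires. -/
def blockDec (p : ℕ) (blk : ℕ → Wire) (i : ℕ) : Expr (ZMod p) Wire × Expr (ZMod p) Wire :=
  (.wire (blk (2 * i)), .wire (blk (2 * i + 1)))

/-- The wires at the beginning. The public blocks are the commitments to the `m` answer vectors and
to the inferred truth, the qualities, and the prior factors; the witness blocks are the
answer vectors, the inferred truth, the randomness of the `m + 1` commitments, the
auxiliary values of their openings, and the auxiliary values of the algorithm. -/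
def layout (p m n h : ℕ) : Layout p :=
  ⟨((List.range m).flatMap fun j => (List.range n).map fun i => blockDec p (.wit j) i) ++
    (List.range h).map (fun i => blockDec p (.pub (m + 2)) i), [], 0⟩

/-- The compiled iteration, without the outputs. -/
def compiled (p : ℕ) (f : TIAlg w E m n h) : Layout p × List (Expr (ZMod p) Wire) :=
  compile f.width (3 * (m + 1)) f.code (layout p m n h)

/-- The constraints of one iteration of the algorithm: the operations, and equality of the outputs
with the inferred truth and the qualities. -/
def constraints (p : ℕ) (f : TIAlg w E m n h) : List (Expr (ZMod p) Wire) :=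
  let equate (A B : Expr (ZMod p) Wire × Expr (ZMod p) Wire) : List (Expr (ZMod p) Wire) :=
    [A.1 - B.1, A.2 - B.2]
  (f.compiled p).2 ++
    (List.ofFn fun i : Fin n =>
      equate (blockDec p (.wit m) i) ((f.compiled p).1.dec w (f.truth i))).flatten ++
    (List.ofFn fun j : Fin m =>
      equate (blockDec p (.pub (m + 1)) j) ((f.compiled p).1.dec w (f.qual j))).flatten

/-- The constraints of the opening of the `j`-th commitment. -/
def openConstraints {p : ℕ} (m n : ℕ) (K : CommitScheme (ZMod p)) (κ j : ℕ) :
    List (Expr (ZMod p) Wire) :=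
  (K.gates κ (2 * n)).map fun g => g.rename fun v => match v with
    | .com i => .pub j i
    | .msg i => .wit j i
    | .rnd i => .wit (m + 1 + j) i
    | .aux i => .wit (2 * (m + 1) + j) i

/-- The overall circuit, for security parameter `κ`: one iteration of the algorithm, and the opening
of all commitments. -/
def circuit {p : ℕ} (f : TIAlg w E m n h) (K : CommitScheme (ZMod p)) (κ : ℕ) :
    Circuit (ZMod p) where
  pubShape := List.replicate (m + 1) (K.comLen κ (2 * n)) ++ [2 * m, 2 * h]
  witShape := List.replicate (m + 1) (2 * n) ++ List.replicate (m + 1) (K.rndLen κ (2 * n)) ++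
    List.replicate (m + 1) (K.auxLen κ (2 * n)) ++ [(f.compiled p).1.next]
  constraints := f.constraints p ++ (List.range (m + 1)).flatMap fun j => openConstraints m n K κ j

end TIAlg

/-! ### Zero-knowledge truth inference protocols -/

/-- One vector of field elements for each worker, and one for the aggregator. Commitments to all
answer vectors and to the inferred truth are of this form, and so is their randomness. -/
abbrev Party (p m : ℕ) : Type := (Fin m → List (ZMod p)) × List (ZMod p)

/-- Public parameters: those of the proof system, and the prior factors. -/
abbrev Params (p w E h : ℕ) : Type := Data × FVec p w E h

/-- The algorithms of a truth inference protocol with proofs. The first argument is always the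
security parameter. -/
structure Scheme (p w E m n h : ℕ) where
  setup : ℕ → PMF (Params p w E h)
  /-- the randomness of one commitment -/
  rnd : ℕ → PMF (List (ZMod p))
  /-- commitment to a vector with given randomness -/
  com : ℕ → FVec p w E n → List (ZMod p) → List (ZMod p)
  /-- auxiliary inputs of the prover, from answers, inferred truth, qualities and randomness -/
  aux : ℕ × Params p w E h × (Fin m → FVec p w E n) × FVec p w E n × FVec p w E m × Party p m →
    Party p m × List (ZMod p)
  /-- proof, from commitments, answers, inferred truth, qualities, randomness, auxiliary inputs -/
  prove : ℕ × Params p w E h × Party p m × (Fin m → FVec p w E n) × FVec p w E n ×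
    FVec p w E m × Party p m × Party p m × List (ZMod p) → PMF Data
  /-- decision, from commitments, qualities and the proof -/
  verify : ℕ × Params p w E h × Party p m × FVec p w E m × Data → PMF Bool

namespace Scheme

variable {p w E m n h : ℕ}

/-- All commitments, with given randomness. -/
def comAll (S : Scheme p w E m n h) (κ : ℕ) (V : Fin m → FVec p w E n) (Vs : FVec p w E n)
    (r : Party p m) : Party p m :=
  (fun j => S.com κ (V j) (r.1 j), S.com κ Vs r.2)

/-- The workers commit to their answers, and the aggregator to the inferred truth, with independent
randomness; the result are the commitments and the randomness. -/
def commit (S : Scheme p w E m n h) (i : ℕ × (Fin m → FVec p w E n) × FVec p w E n) :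
    PMF (Party p m × Party p m) :=
  (samples (S.rnd i.1) m).bind fun r => (S.rnd i.1).bind fun rs =>
    PMF.pure (S.comAll i.1 i.2.1 i.2.2 (r, rs), (r, rs))

/-- The honest execution: public parameters, commitments and proof. -/
def real (S : Scheme p w E m n h) (κ : ℕ) (V : Fin m → FVec p w E n) (Vs : FVec p w E n)
    (Q : FVec p w E m) : PMF (Params p w E h × Party p m × Data) :=
  (S.setup κ).bind fun pp => (S.commit (κ, V, Vs)).bind fun c =>
    let a := S.aux (κ, pp, V, Vs, Q, c.2)
    (S.prove (κ, pp, c.1, V, Vs, Q, c.2, a.1, a.2)).bind fun π => PMF.pure (pp, c.1, π)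

end Scheme

/-- The output of a cheating aggregator: commitments with openings, qualities and a proof. -/
structure Forgery (p w E m n : ℕ) where
  com : Party p m
  V : Fin m → FVec p w E n
  Vs : FVec p w E n
  rnd : Party p m
  Q : FVec p w E m
  π : Data

instance {p w E m n : ℕ} : Enc (Forgery p w E m n) :=
  ⟨fun o => Enc.enc (o.com, o.V, o.Vs, o.rnd, o.Q, o.π)⟩

/-- The scheme is a zero-knowledge truth inference protocol for the algorithm `f` with prior
factors `η`. -/
structure IsZkTI {p w E m n h : ℕ} (f : TIAlg w E m n h) (η : FVec p w E h)
    (S : Scheme p w E m n h) : Prop where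
  ppt_setup : IsPPT S.setup
  ppt_commit : IsPPT S.commit
  ppt_aux : IsPPT fun i => PMF.pure (S.aux i)
  ppt_prove : IsPPT S.prove
  ppt_verify : IsPPT S.verify
  prior : ∀ κ, ∀ pp ∈ (S.setup κ).support, pp.2 = η
  /-- Completeness: honest executions are accepted with probability one. -/
  complete : ∀ (κ : ℕ) V Vs Q, f.Runs V η Vs Q →
    ((S.real κ V Vs Q).bind fun t => S.verify (κ, t.1, t.2.1, Q, t.2.2)) = PMF.pure true
  /-- Soundness: no efficient adversary gets accepted a result that is not correct for the
  committed values. -/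
  sound : ∀ A : ℕ × Params p w E h → PMF (Forgery p w E m n), IsPPT A →
    Negligible fun κ => prob
      ((S.setup κ).bind fun pp => (A (κ, pp)).bind fun o =>
        (S.verify (κ, pp, o.com, o.Q, o.π)).bind fun b => PMF.pure (o, b))
      {r | r.2 = true ∧ r.1.com = S.comAll κ r.1.V r.1.Vs r.1.rnd ∧
        ¬ f.Valid r.1.V η r.1.Vs r.1.Q}
  /-- Zero knowledge: public parameters, commitments and proof are simulated from the
  qualities alone; the commitments are simulated even without them. -/
  zk : ∃ (S₁ : ℕ → PMF (Params p w E h × Party p m × Data))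
      (S₂ : ℕ × Params p w E h × Party p m × Data × FVec p w E m → PMF Data),
    IsPPT S₁ ∧ IsPPT S₂ ∧
    ∀ V Vs Q, f.Runs V η Vs Q →
      ∀ D : ℕ × Params p w E h × Party p m × FVec p w E m × Data → PMF Bool, IsPPT D →
        Negligible fun κ =>
          |prob ((S.real κ V Vs Q).bind fun t => D (κ, t.1, t.2.1, Q, t.2.2)) {true} -
            prob ((S₁ κ).bind fun s => (S₂ (κ, s.1, s.2.1, s.2.2, Q)).bind fun π =>
              D (κ, s.1, s.2.1, Q, π)) {true}|

/-! ### The protocol -/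

namespace TIAlg

variable {p w E m n h : ℕ}

/-- The public input of the circuit. -/
def publicInput (c : Party p m) (Q : FVec p w E m) (η : FVec p w E h) : Blocks (ZMod p) :=
  List.ofFn c.1 ++ [c.2, Q.toField, η.toField]

/-- The witness of the circuit. -/
def witness (V : Fin m → FVec p w E n) (Vs : FVec p w E n) (r a : Party p m)
    (b : List (ZMod p)) : Blocks (ZMod p) :=
  (List.ofFn fun j => (V j).toField) ++ [Vs.toField] ++ List.ofFn r.1 ++ [r.2] ++
    List.ofFn a.1 ++ [a.2, b]

open Classical in
/-- Auxiliary values that make all the arithmetic gadgets accept. The gadgets do not look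
at the wires of the commitments, which are left empty here. -/
def algAux [Fact p.Prime] (f : TIAlg w E m n h) (η : FVec p w E h) (V : Fin m → FVec p w E n)
    (Vs : FVec p w E n) (Q : FVec p w E m) : List (ZMod p) :=
  let blank : Party p m := (fun _ => [], [])
  if H : ∃ b : List (ZMod p), b.length = (f.compiled p).1.next ∧ ∀ g ∈ f.constraints p,
      g.eval (assign (publicInput blank Q η) (witness V Vs blank blank b)) = 0
  then H.choose else []

/-- The protocol, for the algorithm `f` with prior factors `η`, from a commitment scheme and
a ZKP system for circuits. -/
def protocol [Fact p.Prime] (f : TIAlg w E m n h) (η : FVec p w E h) (K : CommitScheme (ZMod p))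
    (Z : ZKP (ZMod p)) : Scheme p w E m n h where
  setup κ := (Z.setup κ).bind fun pp => PMF.pure (pp, η)
  rnd κ := K.rnd κ (2 * n)
  com κ v r := K.com κ v.toField r
  aux := fun (κ, pp, V, Vs, Q, r) =>
    ((fun j => K.aux κ (V j).toField (r.1 j), K.aux κ Vs.toField r.2), f.algAux pp.2 V Vs Q)
  prove := fun (κ, pp, c, V, Vs, Q, r, a, b) =>
    Z.prove κ (f.circuit K κ) pp.1 (publicInput c Q pp.2) (witness V Vs r a b)
  verify := fun (κ, pp, c, Q, π) =>
    Z.verify κ (f.circuit K κ) pp.1 (publicInput c Q pp.2) π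

end TIAlg

/-! ### The two instantiations -/

/-- Construction of straight-line programs: the operations emitted so far, and the numbers of
decimals and of bits present. -/
structure Draft (w E : ℕ) where
  code : List (Instr w E)
  decs : ℕ
  bits : ℕ

/-- Emit an operation that yields a decimal, and return its position. -/
def emitDec {w E : ℕ} (ins : Instr w E) : StateM (Draft w E) ℕ := fun d =>
  (d.decs, ⟨d.code ++ [ins], d.decs + 1, d.bits⟩)

/-- Emit an operation that yields a bit, and return its position. -/
def emitBit {w E : ℕ} (ins : Instr w E) : StateM (Draft w E) ℕ := fun d =>
  (d.bits, ⟨d.code ++ [ins], d.decs, d.bits + 1⟩)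

/-- Combine a nonempty list of decimals by a binary operation, from left to right. -/
def emitFold {w E : ℕ} (op : ℕ → ℕ → Instr w E) : List ℕ → StateM (Draft w E) ℕ
  | [] => pure 0
  | a :: l => l.foldlM (fun x y => emitDec (op x y)) a

/-- Total distance of pairs of decimals, for a distance `d` given by operations with a decimal as
result: the sum of all distances. -/
def sumDist {w E : ℕ} (d : ℕ → ℕ → StateM (Draft w E) ℕ) (l : List (ℕ × ℕ)) :
    StateM (Draft w E) ℕ := do
  emitFold .add (← l.mapM fun x => d x.1 x.2)

/-- Total distance of pairs of decimals, for the distance that is `1` for different decimals and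
`0` otherwise: the number of pairs of different decimals. -/
def countDist {w E : ℕ} (l : List (ℕ × ℕ)) : StateM (Draft w E) ℕ := do
  let bits ← l.mapM fun x => do
    let b ← emitBit (.eq x.1 x.2)
    emitBit (.not b)
  emitDec (.count bits)

/-- One iteration of CRH. The prior factors are the qualities `q j` of the workers. The inferred
truth of task `i` is `(∑ j, q j * v j i) / ∑ j, q j`. The new quality of worker `j` is the total
distance of all answers from the inferred truth, divided by that of the answers of worker `j`;
the logarithm of this ratio is a public function of it. The parameter `dist` emits the operations
that compute the total distance of pairs (answer, truth), such as `sumDist d` or `countDist`. -/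
def crh (w E m n : ℕ) (dist : List (ℕ × ℕ) → StateM (Draft w E) ℕ) : TIAlg w E m n m :=
  let v (j i : ℕ) : ℕ := j * n + i
  let q (j : ℕ) : ℕ := m * n + j
  let build : StateM (Draft w E) (List ℕ × List ℕ) := do
    let sumq ← emitFold .add ((List.range m).map q)
    let truth ← (List.range n).mapM fun i => do
      let terms ← (List.range m).mapM fun j => emitDec (.mul (q j) (v j i))
      let total ← emitFold .add terms
      emitDec (.div total sumq)
    let pairs (j : ℕ) : List (ℕ × ℕ) := (List.range n).map fun i => (v j i, truth.getD i 0)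
    let all ← dist ((List.range m).flatMap pairs)
    let qual ← (List.range m).mapM fun j => do
      let own ← dist (pairs j)
      emitDec (.div all own)
    pure (truth, qual)
  let r := build ⟨[], m * n + m, 0⟩
  { code := r.2.code
    truth := fun i => r.1.1.getD i 0
    qual := fun j => r.1.2.getD j 0 }

/-- One iteration of ZenCrowd with choices `c k`. The prior factors are the qualities `q j` of the
workers followed by the numbers `1 - q j`. For each task the probability of `c k` is proportional
to the product, over all workers, of `q j` if the answer is `c k`, and of `1 - q j` otherwise. The
inferred truth is a choice of the highest probability, and the new quality of a worker
is the mean, over all tasks, of the probability of the answer given. -/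
def zenCrowd (w E m n l : ℕ) (c : Fin l → Flt w E) : TIAlg w E m n (m + m) :=
  let v (j i : ℕ) : ℕ := j * n + i
  let q (j : ℕ) : ℕ := m * n + j
  let q' (j : ℕ) : ℕ := m * n + m + j
  let build : StateM (Draft w E) (List ℕ × List ℕ) := do
    let labels ← (List.ofFn c).mapM fun x => emitDec (.const x)
    -- for each task, the inferred truth, and the probability of the answer of each worker
    let tasks ← (List.range n).mapM fun i => do
      let cols ← labels.mapM fun lab => do
        let ind ← (List.range m).mapM fun j => emitBit (.eq (v j i) lab)
        let factors ← (List.range m).mapM fun j => emitDec (.sel (ind.getD j 0) (q j) (q' j))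
        let weight ← emitFold .mul factors
        pure (lab, ind, weight)
      let total ← emitFold .add (cols.map fun x => x.2.2)
      let probs ← cols.mapM fun x => do
        let pr ← emitDec (.div x.2.2 total)
        pure (x.1, x.2.1, pr)
      let first := probs.headD (0, [], 0)
      let best ← probs.tail.foldlM (fun (y : ℕ × ℕ) x => do
        let b ← emitBit (.le x.2.2 y.2)
        let lab ← emitDec (.sel b y.1 x.1)
        let pr ← emitDec (.sel b y.2 x.2.2)
        pure (lab, pr)) (first.1, first.2.2)
      let given ← (List.range m).mapM fun j =>
        probs.tail.foldlM (fun y x => emitDec (.sel (x.2.1.getD j 0) x.2.2 y)) first.2.2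
      pure (best.1, given)
    -- the number of tasks as a decimal, by counting a set bit
    let one ← emitBit (.eq 0 0)
    let size ← emitDec (.count (List.replicate n one))
    let qual ← (List.range m).mapM fun j => do
      let total ← emitFold .add (tasks.map fun t => t.2.getD j 0)
      emitDec (.div total size)
    pure (tasks.map Prod.fst, qual)
  let r := build ⟨[], m * n + (m + m), 0⟩
  { code := r.2.code
    truth := fun i => r.1.1.getD i 0
    qual := fun j => r.1.2.getD j 0 }

end ZkTI

end

noncomputable section

namespace ZkTI

/-! ### Runs of programs -/

/-! Three independent ingredients carry the theorem.

The circuit means what it should. Over `ZMod p` a gadget only asserts congruences. Digit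
decompositions bound the quantities inside a gadget, and the propagated magnitude bounds the
exponents in every admissible execution (`bounded_steps`). Wherever an equality of integers is
needed, its two sides differ by less than `p`, so the congruence is that equality. The rounding
gadget forces `x - 2 ^ (w - 1) * (x - y)` into `[0, 2 ^ (2 * w))`, which is exactly the pair of
inequalities of the relative error model (`rounds_iff`); its integers stay below `2 ^ (3 * w + 1)`,
and those in the treatment of exponents and counters below `2 ^ (w + k + 1)`. So a satisfied circuit
contains an admissible execution (`compile_sound`, `valid_of_holds`). Conversely rounding down is
admissible (`steps_of_exec`), and an admissible execution determines values of the auxiliary wires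
(`compile_complete`, `sat_of_runs`).

Security is a reduction to the two building blocks. Completeness is that of the proof system. For
soundness, the knowledge extractor turns an accepting prover into one that also outputs a witness.
The witness opens every commitment; if its messages are those of the adversary's own openings, the
result is valid (`of_sat`), and otherwise some commitment has been opened in two ways, against
binding (`sound_protocol`). For zero knowledge, the real proof is first replaced by a simulated one,
and then the commitments by commitments to zero vectors (`zk_protocol`).

All reductions have to be programs with a polynomial time bound. Every step of a program costs at
least the size of its input, so the output is no longer than the time spent (`Prog.paid`), and
surplus time changes nothing (`Prog.run_addTime`). Hence polynomial time is closed under composition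
and sequential sampling (`IsPPT.comp`, `IsPPT.bind`). Functions defined by choice are efficient when
their arguments come from a finite set independent of the security parameter, since a fixed table
computes them (`IsPoly.of_finite`). -/

theorem bind_congr_support {α β : Type} (d : PMF α) {f g : α → PMF β}
    (h : ∀ a ∈ d.support, f a = g a) : d.bind f = d.bind g := by
  ext b
  rw [PMF.bind_apply, PMF.bind_apply]
  refine tsum_congr fun a => ?_
  by_cases ha : a ∈ d.support
  · rw [h a ha]
  · rw [PMF.mem_support_iff, not_not] at ha
    simp [ha]

/-- Add `d` to the time that is left. -/
def addTime (d : ℕ) : Option (Data × ℕ) → Option (Data × ℕ) := Option.map fun z => (z.1, z.2 + d)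

theorem andThen_addTime {D D' : Outcome} {k k' : Data → ℕ → Outcome} {d : ℕ}
    (hD : none ∉ D.support → D' = D.map (addTime d))
    (hk : ∀ y s, none ∉ (k y s).support → k' y (s + d) = (k y s).map (addTime d))
    (h : none ∉ (andThen D k).support) :
    andThen D' k' = (andThen D k).map (addTime d) := by
  -- If the composite run never times out, neither does its first part, nor any continuation that is
  -- reached.
  have h' : ∀ o ∈ D.support, ∃ y s, o = some (y, s) ∧ none ∉ (k y s).support := by
    intro o ho
    cases o with
    | none => exact absurd ((PMF.mem_support_bind_iff _ _ _).2 ⟨none, ho, by simp⟩) h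
    | some z => exact ⟨z.1, z.2, rfl, fun hn => h ((PMF.mem_support_bind_iff _ _ _).2 ⟨_, ho, hn⟩)⟩
  rw [hD fun hn => by obtain ⟨_, _, h1, _⟩ := h' _ hn; cases h1]
  unfold andThen
  rw [PMF.bind_map, PMF.map_bind]
  refine bind_congr_support _ fun o ho => ?_
  obtain ⟨y, s, rfl, hn⟩ := h' o ho
  exact hk y s hn

theorem charge_addTime {c t d : ℕ} {k k' : ℕ → Outcome}
    (hk : ∀ s, none ∉ (k s).support → k' (s + d) = (k s).map (addTime d))
    (h : none ∉ (charge c t k).support) :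
    charge c (t + d) k' = (charge c t k).map (addTime d) := by
  unfold charge at h ⊢
  by_cases hc : c ≤ t
  · rw [if_pos hc] at h ⊢
    rw [if_pos (by omega), show t + d - c = t - c + d by omega, hk _ h]
  · rw [if_neg hc] at h
    simp at h

/-- The number of rounds and the time are raised separately; `Prog.run` ties the former to the
latter, so both grow when the budget does. -/
theorem loopRun_addTime {body : ℕ → Data → Outcome}
    (hb : ∀ t d y, none ∉ (body t y).support → body (t + d) y = (body t y).map (addTime d))
    (r e t d : ℕ) (x : Data) (h : none ∉ (loopRun body r t x).support) :
    loopRun body (r + e) (t + d) x = (loopRun body r t x).map (addTime d) := by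
  induction r generalizing t x with
  | zero => simp [loopRun] at h
  | succ r ih =>
    rw [show r + 1 + e = r + e + 1 by omega]
    unfold loopRun at h ⊢
    refine charge_addTime (fun s hs => ?_) h
    revert hs
    cases x.left with
    | leaf => intro _; simp [PMF.pure_map, addTime]
    | node a b =>
      intro hs
      exact andThen_addTime (fun hn => hb _ _ _ hn) (fun y s hn => ih s y hn) hs

/-- The clock influences a run only by running out. A budget that suffices for all coins can
therefore be enlarged, and the surplus is simply left over; this is what lets the budgets of
consecutive programs be added. -/
theorem Prog.run_addTime (P : Prog) (t d : ℕ) (x : Data) (h : none ∉ (P.run t x).support) :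
    P.run (t + d) x = (P.run t x).map (addTime d) := by
  induction P generalizing t d x with
  | leaf | id | fst | snd =>
    exact charge_addTime (fun s hs => by simp [PMF.pure_map, addTime]) h
  | flip =>
    refine charge_addTime (fun s hs => ?_) h
    simp [PMF.map_bind, PMF.pure_map, addTime]
  | comp g f ihg ihf =>
    exact charge_addTime (fun s hs => andThen_addTime (fun hn => ihf _ _ _ hn)
      (fun y s hn => ihg _ _ _ hn) hs) h
  | pair f g ihf ihg =>
    refine charge_addTime (fun s hs => andThen_addTime (fun hn => ihf _ _ _ hn)
      (fun y s hn => andThen_addTime (fun hn => ihg _ _ _ hn) (fun z s hn => ?_) hn) hs) h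
    simp [PMF.pure_map, addTime]
  | cond f g ihf ihg =>
    refine charge_addTime (fun s hs => ?_) h
    revert hs
    cases x.left with
    | leaf => exact fun hs => ihf _ _ _ hs
    | node a b => exact fun hs => ihg _ _ _ hs
  | loop f ih =>
    have := loopRun_addTime (fun t d y hn => ih t d y hn) (t + 1) d t d x h
    rw [show t + 1 + d = t + d + 1 by omega] at this
    exact this

/-- Whatever is built has been paid for. -/
def Paid (t : ℕ) (D : Outcome) : Prop := ∀ y s, some (y, s) ∈ D.support → y.size + s ≤ t

theorem Paid.mono {t t' : ℕ} {D : Outcome} (h : Paid t D) (ht : t ≤ t') : Paid t' D :=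
  fun y s hy => (h y s hy).trans ht

theorem paid_andThen {t t' : ℕ} {D : Outcome} {k : Data → ℕ → Outcome} (hD : Paid t D)
    (hk : ∀ y s, y.size + s ≤ t → Paid t' (k y s)) : Paid t' (andThen D k) := by
  intro z s hz
  obtain ⟨o, ho, hz⟩ := (PMF.mem_support_bind_iff _ _ _).1 hz
  cases o with
  | none => simp at hz
  | some y => exact hk y.1 y.2 (hD _ _ ho) z s hz

theorem paid_charge {c t : ℕ} {k : ℕ → Outcome} (hk : ∀ s, s + c = t → Paid t (k s)) :
    Paid t (charge c t k) := by
  unfold charge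
  split_ifs with h
  · exact hk _ (by omega)
  · intro y s hy; simp at hy

theorem paid_pure {t s : ℕ} {y : Data} (h : y.size + s ≤ t) : Paid t (PMF.pure (some (y, s))) := by
  intro z r hz
  simp only [PMF.mem_support_pure_iff, Option.some.injEq, Prod.mk.injEq] at hz
  obtain ⟨rfl, rfl⟩ := hz
  exact h

theorem paid_loopRun {body : ℕ → Data → Outcome} (hb : ∀ t y, Paid t (body t y)) (r t : ℕ)
    (x : Data) : Paid t (loopRun body r t x) := by
  induction r generalizing t x with
  | zero => intro y s hy; simp [loopRun] at hy
  | succ r ih =>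
    unfold loopRun
    refine paid_charge fun s hs => ?_
    cases x.left with
    | leaf => exact paid_pure (by omega)
    | node a b => exact paid_andThen (hb s x) fun y u h => (ih u y).mono (by omega)

theorem Data.size_left (x : Data) : x.left.size ≤ x.size := by
  cases x <;> simp [Data.left, Data.size]; omega

theorem Data.size_right (x : Data) : x.right.size ≤ x.size := by
  cases x <;> simp [Data.right, Data.size]

/-- Each step pays for the tree it reads plus three, which covers copying the tree and the few new
nodes. This bounds output size by time and so makes polynomial bounds compose. -/
theorem Prog.paid (P : Prog) (t : ℕ) (x : Data) : Paid t (P.run t x) := by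
  induction P generalizing t x with
  | leaf => exact paid_charge fun s hs => paid_pure (by simp [Data.size]; omega)
  | id => exact paid_charge fun s hs => paid_pure (by omega)
  | fst => exact paid_charge fun s hs => paid_pure (by have := x.size_left; omega)
  | snd => exact paid_charge fun s hs => paid_pure (by have := x.size_right; omega)
  | flip =>
    refine paid_charge fun s hs y u hy => ?_
    obtain ⟨b, -, hy⟩ := (PMF.mem_support_bind_iff _ _ _).1 hy
    refine paid_pure (y := if b then Data.node .leaf .leaf else .leaf) ?_ y u hy
    cases b <;> simp [Data.size] <;> omega
  | comp g f ihg ihf =>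
    exact paid_charge fun s hs => paid_andThen (ihf s x) fun y u h => (ihg u y).mono (by omega)
  | pair f g ihf ihg =>
    refine paid_charge fun s hs => paid_andThen (ihf s x) fun y u h =>
      paid_andThen (ihg u x) fun z v h' => paid_pure ?_
    simp [Data.size]; omega
  | cond f g ihf ihg =>
    refine paid_charge fun s hs => ?_
    cases x.left with
    | leaf => exact (ihf _ _).mono (by omega)
    | node a b => exact (ihg _ _).mono (by omega)
  | loop f ih => exact paid_loopRun (fun t y => ih t y) _ _ _

/-- With time budget `T`, the program `P` halts on `x`, and its output has distribution `μ`. -/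
def Computes (P : Prog) (x : Data) (T : ℕ) (μ : PMF Data) : Prop :=
  (P.run T x).map (Option.map Prod.fst) = μ.map some

/-! ### Programs with a prescribed output distribution and time budget. -/

namespace Computes

variable {P f g : Prog} {x : Data} {T T' : ℕ} {μ ν : PMF Data}

theorem not_none (h : Computes P x T μ) : none ∉ (P.run T x).support := by
  intro hn
  have : none ∈ (μ.map some).support := by
    rw [← h]; exact (PMF.mem_support_map_iff _ _ _).2 ⟨none, hn, rfl⟩
  obtain ⟨y, -, hy⟩ := (PMF.mem_support_map_iff _ _ _).1 this
  cases hy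

theorem size_le (h : Computes P x T μ) {y : Data} (hy : y ∈ μ.support) : y.size ≤ T := by
  have : some y ∈ (μ.map some).support := (PMF.mem_support_map_iff _ _ _).2 ⟨y, hy, rfl⟩
  rw [← h] at this
  obtain ⟨o, ho, ho'⟩ := (PMF.mem_support_map_iff _ _ _).1 this
  cases o with
  | none => cases ho'
  | some z =>
    obtain rfl : z.1 = y := by simpa using ho'
    have := P.paid T x z.1 z.2 ho
    omega

theorem mono (h : Computes P x T μ) (hT : T ≤ T') : Computes P x T' μ := by
  obtain ⟨d, rfl⟩ := Nat.exists_eq_add_of_le hT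
  unfold Computes
  rw [P.run_addTime T d x h.not_none, PMF.map_comp, ← h]
  congr 1
  funext o
  cases o <;> rfl

/-- Continue a computation, with time `T'` for the continuation. -/
theorem andThen (h : Computes P x T μ) {k : Data → ℕ → Outcome} {κ : Data → PMF Data}
    (hk : ∀ y ∈ μ.support, ∀ s, T' ≤ s →
      (k y s).map (Option.map Prod.fst) = (κ y).map some) {t : ℕ} (ht : T + T' ≤ t) :
    (andThen (P.run t x) k).map (Option.map Prod.fst) = (μ.bind κ).map some := by
  obtain ⟨d, rfl⟩ := Nat.exists_eq_add_of_le ht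
  have h0 := h.not_none
  rw [add_assoc, P.run_addTime T (T' + d) x h0]
  unfold ZkTI.andThen
  -- The target law is rewritten as a bind over the run itself, so that both sides can be compared
  -- outcome by outcome. The default `.leaf` is never used, because the run does not time out.
  have hb : μ.bind κ = (P.run T x).bind fun o => κ ((o.map Prod.fst).getD .leaf) := by
    have : μ = ((P.run T x).map (Option.map Prod.fst)).map fun o => o.getD .leaf := by
      rw [h, PMF.map_comp]; exact (PMF.map_id _).symm
    conv_lhs => rw [this]
    rw [PMF.map_comp, PMF.bind_map]
    rfl
  rw [hb, PMF.bind_map, PMF.map_bind, PMF.map_bind]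
  refine bind_congr_support _ fun o ho => ?_
  cases o with
  | none => exact absurd ho h0
  | some z =>
    refine hk z.1 ?_ (z.2 + (T' + d)) (by omega)
    have : some z.1 ∈ (μ.map some).support := by
      rw [← h]; exact (PMF.mem_support_map_iff _ _ _).2 ⟨_, ho, rfl⟩
    simpa using this

theorem of_charge {c t : ℕ} {k : ℕ → Outcome} (hc : c + T ≤ t)
    (hk : (k (t - c)).map (Option.map Prod.fst) = μ.map some) :
    (charge c t k).map (Option.map Prod.fst) = μ.map some := by
  unfold charge
  rw [if_pos (by omega), hk]

theorem leaf (x : Data) : Computes .leaf x (x.size + 3) (PMF.pure .leaf) := by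
  simp [Computes, Prog.run, charge, PMF.pure_map]

theorem id (x : Data) : Computes .id x (x.size + 3) (PMF.pure x) := by
  simp [Computes, Prog.run, charge, PMF.pure_map]

theorem fst (x : Data) : Computes .fst x (x.size + 3) (PMF.pure x.left) := by
  simp [Computes, Prog.run, charge, PMF.pure_map]

theorem snd (x : Data) : Computes .snd x (x.size + 3) (PMF.pure x.right) := by
  simp [Computes, Prog.run, charge, PMF.pure_map]

theorem comp (hf : Computes f x T μ) {κ : Data → PMF Data}
    (hg : ∀ y ∈ μ.support, Computes g y T' (κ y)) :
    Computes (.comp g f) x (x.size + 3 + T + T') (μ.bind κ) :=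
  of_charge (T := T + T') (by omega)
    (hf.andThen (T' := T') (fun y hy s hs => (hg y hy).mono hs) (by omega))

theorem pair (hf : Computes f x T μ) (hg : Computes g x T' ν) :
    Computes (.pair f g) x (x.size + 3 + T + T')
      (μ.bind fun y => ν.bind fun z => PMF.pure (.node y z)) :=
  of_charge (T := T + T') (by omega)
    (hf.andThen (T' := T') (fun y _ s hs => hg.andThen (T' := 0)
      (fun z _ s _ => by simp [PMF.pure_map]) (by omega)) (by omega))

theorem cond_leaf (hx : x.left = .leaf) (h : Computes f x.right T μ) :
    Computes (.cond f g) x (x.size + 3 + T) μ := by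
  refine of_charge (T := T) (by omega) ?_
  rw [hx]
  exact h.mono (by omega)

theorem cond_node {a b : Data} (hx : x.left = .node a b) (h : Computes g x.right T μ) :
    Computes (.cond f g) x (x.size + 3 + T) μ := by
  refine of_charge (T := T) (by omega) ?_
  rw [hx]
  exact h.mono (by omega)

end Computes

theorem Computes.unique {P : Prog} {x : Data} {T : ℕ} {μ ν : PMF Data} (h : Computes P x T μ)
    (h' : Computes P x T ν) : μ = ν := by
  have : (μ.map some).map (fun o => o.getD .leaf) = (ν.map some).map (fun o => o.getD .leaf) := by
    rw [← h, ← h']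
  rw [PMF.map_comp, PMF.map_comp] at this
  exact (PMF.map_id μ).symm.trans (this.trans (PMF.map_id ν))

/-- The encoding `e` need not be injective, so `κ` must first descend to encodings. It does: values
of the support with the same encoding are fed to the same program with the same budget, and the
output law is unique. -/
theorem Computes.comp_map {β : Type} {f g : Prog} {x : Data} {T T' : ℕ} {μ : PMF β} {e : β → Data}
    {κ : β → PMF Data} (hf : Computes f x T (μ.map e))
    (hg : ∀ b ∈ μ.support, Computes g (e b) T' (κ b)) :
    Computes (.comp g f) x (x.size + 3 + T + T') (μ.bind κ) := by
  classical
  let κ' : Data → PMF Data := fun y =>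
    if h : ∃ b ∈ μ.support, e b = y then κ h.choose else PMF.pure .leaf
  have hκ : ∀ b ∈ μ.support, κ' (e b) = κ b := by
    intro b hb
    have h : ∃ c ∈ μ.support, e c = e b := ⟨b, hb, rfl⟩
    have h1 : κ' (e b) = κ h.choose := dif_pos h
    rw [h1]
    have h2 := hg _ h.choose_spec.1
    rw [h.choose_spec.2] at h2
    exact h2.unique (hg b hb)
  have := hf.comp (g := g) (T' := T') (κ := κ') fun y hy => by
    obtain ⟨b, hb, rfl⟩ := (PMF.mem_support_map_iff _ _ _).1 hy
    rw [hκ b hb]; exact hg b hb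
  rwa [PMF.bind_map, bind_congr_support μ (f := κ' ∘ e) (g := κ) hκ] at this

theorem eval_le_eval (q : Polynomial ℕ) {a b : ℕ} (h : a ≤ b) : q.eval a ≤ q.eval b := by
  rw [Polynomial.eval_eq_sum, Polynomial.eval_eq_sum]
  exact Finset.sum_le_sum fun i _ => Nat.mul_le_mul_left _ (Nat.pow_le_pow_left h i)

/-! ### Deterministic maps of trees -/

/-- A map of trees that some program computes in polynomial time. -/
def PolyMap (h : Data → Data) : Prop :=
  ∃ (P : Prog) (q : Polynomial ℕ), ∀ x, Computes P x (q.eval x.size) (PMF.pure (h x))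

namespace PolyMap

variable {f g k : Data → Data}

theorem leaf : PolyMap fun _ => .leaf :=
  ⟨.leaf, .X + 3, fun x => by simpa using Computes.leaf x⟩

theorem id : PolyMap fun x => x := ⟨.id, .X + 3, fun x => by simpa using Computes.id x⟩

/-- The intermediate tree has size at most the first running time `q`, so the second stage costs at
most `r` evaluated at `q`. -/
theorem comp (hg : PolyMap g) (hf : PolyMap f) : PolyMap fun x => g (f x) := by
  obtain ⟨P, q, hP⟩ := hf
  obtain ⟨Q, r, hQ⟩ := hg
  refine ⟨.comp Q P, .X + 3 + q + r.comp q, fun x => ?_⟩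
  have := (hP x).comp (g := Q) (T' := r.eval (q.eval x.size)) (κ := fun y => PMF.pure (g y))
    fun y hy => (hQ y).mono (eval_le_eval r ((hP x).size_le hy))
  simpa [Polynomial.eval_comp] using this

theorem left (hf : PolyMap f) : PolyMap fun x => (f x).left :=
  comp ⟨.fst, .X + 3, fun x => by simpa using Computes.fst x⟩ hf

theorem right (hf : PolyMap f) : PolyMap fun x => (f x).right :=
  comp ⟨.snd, .X + 3, fun x => by simpa using Computes.snd x⟩ hf

theorem node (hf : PolyMap f) (hg : PolyMap g) : PolyMap fun x => .node (f x) (g x) := by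
  obtain ⟨P, q, hP⟩ := hf
  obtain ⟨Q, r, hQ⟩ := hg
  exact ⟨.pair P Q, .X + 3 + q + r, fun x => by simpa using (hP x).pair (hQ x)⟩

theorem const : ∀ d : Data, PolyMap fun _ => d
  | .leaf => leaf
  | .node a b => (const a).node (const b)

open Classical in
theorem ite_leaf (hk : PolyMap k) (hf : PolyMap f) (hg : PolyMap g) :
    PolyMap fun x => if k x = .leaf then f x else g x := by
  have H : PolyMap fun y => if y.left = .leaf then f y.right else g y.right := by
    obtain ⟨P, q, hP⟩ := hf
    obtain ⟨Q, r, hQ⟩ := hg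
    refine ⟨.cond P Q, .X + 3 + q + r, fun x => ?_⟩
    have h1 := eval_le_eval q x.size_right
    have h2 := eval_le_eval r x.size_right
    cases hx : x.left with
    | leaf =>
      change Computes _ _ _ (PMF.pure (if x.left = .leaf then f x.right else g x.right))
      rw [if_pos hx]
      exact (Computes.cond_leaf hx (hP x.right)).mono (by simp; omega)
    | node a b =>
      change Computes _ _ _ (PMF.pure (if x.left = .leaf then f x.right else g x.right))
      rw [if_neg (by simp [hx])]
      exact (Computes.cond_node hx (hQ x.right)).mono (by simp; omega)
  exact H.comp (hk.node id)

-- The tree `d` is fixed, so equality with it takes a fixed number of tests for being a leaf, by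
-- recursion along `d`.
open Classical in
theorem ite_eq (hk : PolyMap k) (d : Data) (hf : PolyMap f) (hg : PolyMap g) :
    PolyMap fun x => if k x = d then f x else g x := by
  induction d generalizing k f g with
  | leaf => exact ite_leaf hk hf hg
  | node a b iha ihb =>
    have := ite_leaf hk hg (iha hk.left (ihb hk.right hf hg) hg)
    convert this using 2 with x
    cases k x with
    | leaf => simp
    | node c d =>
      simp only [Data.node.injEq, reduceCtorEq, if_false, Data.left, Data.right]
      by_cases h1 : c = a <;> by_cases h2 : d = b <;> simp [h1, h2]

/-- A table with finitely many entries. -/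
theorem exists_table {ι : Type} [Finite ι] (e G : ι → Data) (h : ∀ i j, e i = e j → G i = G j) :
    ∃ f, PolyMap f ∧ ∀ i, f (e i) = G i := by
  classical
  have := Fintype.ofFinite ι
  have H : ∀ s : Finset ι, ∃ f, PolyMap f ∧ ∀ i ∈ s, f (e i) = G i := by
    intro s
    induction s using Finset.induction_on with
    | empty => exact ⟨_, leaf, by simp⟩
    | insert i s _ ih =>
      obtain ⟨f, hf, hs⟩ := ih
      refine ⟨_, ite_eq id (e i) (const (G i)) hf, fun j hj => ?_⟩
      by_cases hij : e j = e i
      · simp only [hij, if_true]; exact (h _ _ hij).symm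
      · simp only [hij, if_false]
        rcases Finset.mem_insert.1 hj with rfl | hj
        · exact absurd rfl hij
        · exact hs j hj
  obtain ⟨f, hf, hs⟩ := H Finset.univ
  exact ⟨f, hf, fun i => hs i (Finset.mem_univ i)⟩

end PolyMap

/-! ### Deterministic maps of encoded values -/

/-- A map that is computed in polynomial time on encodings. -/
def IsPoly {α β : Type} [Enc α] [Enc β] (g : α → β) : Prop :=
  ∃ h, PolyMap h ∧ ∀ a, Enc.enc (g a) = h (Enc.enc a)

namespace IsPoly

variable {α β γ : Type} [Enc α] [Enc β] [Enc γ]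

/-- Computability depends on encodings only; this transfers it between types that are encoded alike,
such as lists and `Fin n → α`, or vectors of floats and their field elements. -/
theorem of_enc {f : α → β} {g : α → γ} (hf : IsPoly f) (h : ∀ a, Enc.enc (g a) = Enc.enc (f a)) :
    IsPoly g := by
  obtain ⟨k, hk, hkf⟩ := hf
  exact ⟨k, hk, fun a => (h a).trans (hkf a)⟩

theorem id : IsPoly fun a : α => a := ⟨_, PolyMap.id, fun _ => rfl⟩

theorem const (b : β) : IsPoly fun _ : α => b := ⟨_, PolyMap.const _, fun _ => rfl⟩

theorem comp {g : β → γ} {f : α → β} (hg : IsPoly g) (hf : IsPoly f) : IsPoly fun a => g (f a) := by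
  obtain ⟨k, hk, hkg⟩ := hg
  obtain ⟨l, hl, hlf⟩ := hf
  exact ⟨_, hk.comp hl, fun a => by rw [hkg, hlf]⟩

theorem fst {f : α → β × γ} (hf : IsPoly f) : IsPoly fun a => (f a).1 := by
  obtain ⟨k, hk, hkf⟩ := hf
  exact ⟨_, hk.left, fun a => by rw [← hkf]; rfl⟩

theorem snd {f : α → β × γ} (hf : IsPoly f) : IsPoly fun a => (f a).2 := by
  obtain ⟨k, hk, hkf⟩ := hf
  exact ⟨_, hk.right, fun a => by rw [← hkf]; rfl⟩

theorem prod {f : α → β} {g : α → γ} (hf : IsPoly f) (hg : IsPoly g) :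
    IsPoly fun a => (f a, g a) := by
  obtain ⟨k, hk, hkf⟩ := hf
  obtain ⟨l, hl, hlg⟩ := hg
  exact ⟨_, hk.node hl, fun a => by rw [← hkf, ← hlg]; rfl⟩

theorem cons {f : α → β} {g : α → List β} (hf : IsPoly f) (hg : IsPoly g) :
    IsPoly fun a => f a :: g a :=
  (hf.prod hg).of_enc fun _ => rfl

theorem nil : IsPoly fun _ : α => ([] : List β) := const _

theorem tail {f : α → List β} (hf : IsPoly f) : IsPoly fun a => (f a).tail := by
  obtain ⟨k, hk, hkf⟩ := hf
  refine ⟨_, hk.right, fun a => ?_⟩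
  rw [← hkf]
  beta_reduce
  cases f a <;> rfl

theorem drop {f : α → List β} (hf : IsPoly f) (i : ℕ) : IsPoly fun a => (f a).drop i := by
  induction i with
  | zero => simpa using hf
  | succ i ih => simpa using ih.tail

/-- The default has to be `[]`: it is encoded as a leaf, and the left subtree of the empty list's
encoding is a leaf too. -/
theorem getD_nil {f : α → List (List β)} (hf : IsPoly f) (i : ℕ) : IsPoly fun a => (f a).getD i [] := by
  obtain ⟨k, hk, hkf⟩ := hf.drop i
  refine ⟨_, hk.left, fun a => ?_⟩
  rw [← hkf]
  beta_reduce
  have : (f a).getD i [] = ((f a).drop i).headD [] := by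
    simp [List.getD_eq_getElem?_getD, List.headD_eq_head?_getD, List.head?_drop]
  rw [this]
  cases (f a).drop i <;> rfl

theorem ofFn {n : ℕ} {f : Fin n → α → β} (hf : ∀ i, IsPoly (f i)) :
    IsPoly fun a => List.ofFn fun i => f i a := by
  induction n with
  | zero => exact nil
  | succ n ih =>
    simp only [List.ofFn_succ]
    exact (hf 0).cons (ih fun i => hf i.succ)

theorem pi {n : ℕ} {f : Fin n → α → β} (hf : ∀ i, IsPoly (f i)) :
    IsPoly fun a => fun i => f i a :=
  (ofFn hf).of_enc fun _ => rfl

theorem apply {n : ℕ} {f : α → Fin n → β} (hf : IsPoly f) (i : Fin n) : IsPoly fun a => f a i := by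
  have h1 : IsPoly fun a => List.ofFn (f a) := hf.of_enc fun _ => rfl
  obtain ⟨k, hk, hkf⟩ := h1.drop i
  refine ⟨_, hk.left, fun a => ?_⟩
  rw [← hkf]
  beta_reduce
  rw [List.drop_eq_getElem_cons (by simp), List.getElem_ofFn]
  rfl

theorem append {n : ℕ} {f : Fin n → α → β} {g : α → List β} (hf : ∀ i, IsPoly (f i))
    (hg : IsPoly g) : IsPoly fun a => List.ofFn (fun i => f i a) ++ g a := by
  induction n with
  | zero => simpa using hg
  | succ n ih =>
    simp only [List.ofFn_succ, List.cons_append]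
    exact (hf 0).cons (ih fun i => hf i.succ)

end IsPoly

/-! ### Closure properties of probabilistic polynomial time -/

theorem isPPT_iff {α β : Type} [Enc α] [Enc β] {A : α → PMF β} :
    IsPPT A ↔ ∃ (P : Prog) (q : Polynomial ℕ), ∀ a : α,
      Computes P (Enc.enc a) (q.eval (Enc.enc a).size) ((A a).map Enc.enc) := by
  simp only [IsPPT, Computes, PMF.map_comp]
  rfl

namespace IsPPT

variable {α β γ : Type} [Enc α] [Enc β] [Enc γ]

theorem pure {g : α → β} (hg : IsPoly g) : IsPPT fun a => PMF.pure (g a) := by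
  obtain ⟨k, ⟨P, q, hP⟩, hk⟩ := hg
  refine isPPT_iff.2 ⟨P, q, fun a => ?_⟩
  rw [PMF.pure_map, hk]
  exact hP _

theorem comp {B : β → PMF γ} (hB : IsPPT B) {g : α → β} (hg : IsPoly g) :
    IsPPT fun a => B (g a) := by
  obtain ⟨k, ⟨P, q, hP⟩, hk⟩ := hg
  obtain ⟨Q, r, hQ⟩ := isPPT_iff.1 hB
  refine isPPT_iff.2 ⟨.comp Q P, .X + 3 + q + r.comp q, fun a => ?_⟩
  have h1 := hP (Enc.enc a)
  have h2 := h1.comp (g := Q) (T' := r.eval (q.eval (Enc.enc a).size))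
    (κ := fun _ => (B (g a)).map Enc.enc) fun y hy => by
      have hs := h1.size_le hy
      obtain rfl : y = k (Enc.enc a) := by simpa using hy
      rw [← hk] at hs ⊢
      exact (hQ (g a)).mono (eval_le_eval r hs)
  simpa [Polynomial.eval_comp] using h2

/-- Pairing with `.id` keeps the input available for the second stage, which may depend on it. -/
theorem bind {A : α → PMF β} {B : α → β → PMF γ} (hA : IsPPT A)
    (hB : IsPPT fun x : α × β => B x.1 x.2) : IsPPT fun a => (A a).bind (B a) := by
  obtain ⟨P, q, hP⟩ := isPPT_iff.1 hA
  obtain ⟨Q, r, hQ⟩ := isPPT_iff.1 hB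
  let s : Polynomial ℕ := .X + 3 + (.X + 3) + q
  refine isPPT_iff.2 ⟨.comp Q (.pair .id P), .X + 3 + s + r.comp s, fun a => ?_⟩
  have h1 := (Computes.id (Enc.enc a)).pair (hP a)
  have h2 : Computes (.pair .id P) (Enc.enc a) (s.eval (Enc.enc a).size)
      ((A a).map fun b => Enc.enc (a, b)) := by
    have e : (s.eval (Enc.enc a).size) = (Enc.enc a).size + 3 + ((Enc.enc a).size + 3) +
        q.eval (Enc.enc a).size := by simp [s]
    rw [e]
    rw [PMF.pure_bind, PMF.bind_map] at h1
    exact h1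
  have h3 := h2.comp_map (g := Q) (T' := r.eval (s.eval (Enc.enc a).size))
    (κ := fun b => (B a b).map Enc.enc) fun b hb =>
      (hQ (a, b)).mono (eval_le_eval r (h2.size_le ((PMF.mem_support_map_iff _ _ _).2 ⟨b, hb, rfl⟩)))
  rw [PMF.map_bind]
  simpa [Polynomial.eval_comp] using h3

theorem map {A : α → PMF β} {g : α → β → γ} (hA : IsPPT A)
    (hg : IsPoly fun x : α × β => g x.1 x.2) : IsPPT fun a => (A a).map (g a) :=
  bind hA (pure hg)

/-- The map `g` may be uncomputable on values that never occur. The postprocessing is therefore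
carried out on `Data`, by a total map `h` that has to agree with `g` on the support only. -/
theorem map_of_support {A : α → PMF β} {g : β → γ} (hA : IsPPT A) {h : Data → Data}
    (hh : PolyMap h) (hg : ∀ a, ∀ b ∈ (A a).support, Enc.enc (g b) = h (Enc.enc b)) :
    IsPPT fun a => (A a).map g := by
  obtain ⟨P, q, hP⟩ := isPPT_iff.1 hA
  have hB : IsPPT (fun d : Data => PMF.pure (h d)) := pure ⟨h, hh, fun _ => rfl⟩
  have hA' : IsPPT (fun a => (A a).map (fun b => (Enc.enc b : Data))) :=
    isPPT_iff.2 ⟨P, q, fun a => by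
      have := hP a
      have e : ((A a).map (fun b => (Enc.enc b : Data))).map (Enc.enc : Data → Data) =
        (A a).map Enc.enc := PMF.map_id _
      rwa [e]⟩
  obtain ⟨Q, r, hQ⟩ := isPPT_iff.1 (bind (B := fun _ d => PMF.pure (h d)) hA'
    (hB.comp (g := fun x : α × Data => x.2) IsPoly.id.snd))
  refine isPPT_iff.2 ⟨Q, r, fun a => ?_⟩
  have := hQ a
  have e : (((A a).map (fun b => (Enc.enc b : Data))).bind fun b => PMF.pure (h b)).map
      (Enc.enc : Data → Data) = ((A a).map g).map Enc.enc := by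
    rw [PMF.bind_map, PMF.map_comp]
    refine (PMF.map_id _).trans (bind_congr_support _ fun b hb => ?_)
    simp only [Function.comp]
    rw [hg a b hb]
  rwa [e] at this

theorem samples {d : α → PMF β} (hd : IsPPT d) (n : ℕ) : IsPPT fun a => samples (d a) n := by
  induction n with
  | zero => exact pure (IsPoly.const _)
  | succ n ih =>
    refine bind hd (bind (ih.comp IsPoly.id.fst) (pure ?_))
    refine (IsPoly.cons (IsPoly.id.fst.snd) (g := fun x : (α × β) × (Fin n → β) => List.ofFn x.2)
      (IsPoly.id.snd.of_enc fun _ => rfl)).of_enc fun x => ?_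
    change Enc.enc (List.ofFn (Fin.cons x.1.2 x.2 : Fin (n + 1) → β)) = _
    simp [List.ofFn_succ]

end IsPPT

/-! ### Probabilities -/

section prob

variable {α β : Type}

theorem toOuterMeasure_ne_top (d : PMF α) (S : Set α) : d.toOuterMeasure S ≠ ⊤ := by
  refine ne_top_of_le_ne_top ENNReal.one_ne_top ?_
  calc d.toOuterMeasure S ≤ d.toOuterMeasure Set.univ := d.toOuterMeasure.mono (Set.subset_univ S)
    _ = 1 := (d.toOuterMeasure_apply_eq_one_iff _).2 (Set.subset_univ _)

theorem prob_nonneg (d : PMF α) (S : Set α) : 0 ≤ prob d S := ENNReal.toReal_nonneg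

theorem prob_mono (d : PMF α) {S T : Set α} (h : ∀ a ∈ d.support, a ∈ S → a ∈ T) :
    prob d S ≤ prob d T :=
  ENNReal.toReal_mono (toOuterMeasure_ne_top d T)
    (d.toOuterMeasure_mono fun a ha => h a ha.2 ha.1)

theorem prob_union_le (d : PMF α) (S T : Set α) : prob d (S ∪ T) ≤ prob d S + prob d T := by
  unfold prob
  rw [← ENNReal.toReal_add (toOuterMeasure_ne_top d S) (toOuterMeasure_ne_top d T)]
  exact ENNReal.toReal_mono
    (ENNReal.add_ne_top.2 ⟨toOuterMeasure_ne_top d S, toOuterMeasure_ne_top d T⟩)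
    (MeasureTheory.measure_union_le S T)

theorem prob_iUnion_le (d : PMF α) {ι : Type} (s : Finset ι) (S : ι → Set α) :
    prob d {a | ∃ i ∈ s, a ∈ S i} ≤ ∑ i ∈ s, prob d (S i) := by
  classical
  induction s using Finset.induction_on with
  | empty => simp [prob]
  | insert i s hi ih =>
    rw [Finset.sum_insert hi]
    refine (prob_mono d (T := S i ∪ {a | ∃ i ∈ s, a ∈ S i}) ?_).trans
      ((prob_union_le d _ _).trans (by gcongr))
    rintro a - ⟨j, hj, ha⟩
    rcases Finset.mem_insert.1 hj with rfl | hj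
    · exact Or.inl ha
    · exact Or.inr ⟨j, hj, ha⟩

theorem prob_map (d : PMF α) (f : α → β) (S : Set β) : prob (d.map f) S = prob d (f ⁻¹' S) := by
  simp [prob, PMF.toOuterMeasure_map_apply]

theorem prob_bind (d : PMF α) (f : α → PMF β) (S : Set β) :
    prob (d.bind f) S = ∑' a, (d a).toReal * prob (f a) S := by
  simp only [prob, PMF.toOuterMeasure_bind_apply]
  rw [ENNReal.tsum_toReal_eq fun a => ENNReal.mul_ne_top (d.apply_ne_top a)
    (toOuterMeasure_ne_top _ S)]
  simp [ENNReal.toReal_mul]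

theorem prob_le_one (d : PMF α) (S : Set α) : prob d S ≤ 1 := by
  refine ENNReal.toReal_le_of_le_ofReal zero_le_one ?_
  rw [ENNReal.ofReal_one]
  calc d.toOuterMeasure S ≤ d.toOuterMeasure Set.univ := d.toOuterMeasure.mono (Set.subset_univ S)
    _ = 1 := (d.toOuterMeasure_apply_eq_one_iff _).2 (Set.subset_univ _)

theorem summable_toReal (d : PMF α) : Summable fun a => (d a).toReal :=
  ENNReal.summable_toReal (by rw [d.tsum_coe]; exact ENNReal.one_ne_top)

theorem tsum_toReal (d : PMF α) : ∑' a, (d a).toReal = 1 := by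
  rw [← ENNReal.tsum_toReal_eq d.apply_ne_top, d.tsum_coe, ENNReal.toReal_one]

theorem summable_mul_prob (d : PMF α) (f : α → PMF β) (S : Set β) :
    Summable fun a => (d a).toReal * prob (f a) S :=
  (summable_toReal d).of_nonneg_of_le
    (fun _ => mul_nonneg ENNReal.toReal_nonneg (prob_nonneg _ _))
    fun _ => mul_le_of_le_one_right ENNReal.toReal_nonneg (prob_le_one _ _)

/-- An average of pointwise bounds: the constant `c` is itself averaged, and values outside the
support have weight zero. -/
theorem prob_bind_le {γ : Type} (d : PMF α) {f : α → PMF β} {g : α → PMF γ} {S : Set β} {T : Set γ}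
    {c : ℝ} (h : ∀ a ∈ d.support, prob (f a) S ≤ prob (g a) T + c) :
    prob (d.bind f) S ≤ prob (d.bind g) T + c := by
  rw [prob_bind, prob_bind]
  have e : c = ∑' a, (d a).toReal * c := by rw [tsum_mul_right, tsum_toReal, one_mul]
  rw [e, ← (summable_mul_prob d g T).tsum_add ((summable_toReal d).mul_right c)]
  refine (summable_mul_prob d f S).tsum_le_tsum (fun a => ?_)
    ((summable_mul_prob d g T).add ((summable_toReal d).mul_right c))
  by_cases ha : a ∈ d.support
  · rw [← mul_add]
    exact mul_le_mul_of_nonneg_left (h a ha) ENNReal.toReal_nonneg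
  · rw [PMF.mem_support_iff, not_not] at ha
    simp [ha]

theorem abs_prob_bind_sub_le (d : PMF α) {f g : α → PMF β} {S : Set β} {c : ℝ}
    (h : ∀ a ∈ d.support, |prob (f a) S - prob (g a) S| ≤ c) :
    |prob (d.bind f) S - prob (d.bind g) S| ≤ c := by
  have h1 := prob_bind_le (S := S) (T := S) (c := c) d (f := f) (g := g) fun a ha => by
    have := (abs_le.1 (h a ha)).2; linarith
  have h2 := prob_bind_le (S := S) (T := S) (c := c) d (f := g) (g := f) fun a ha => by
    have := (abs_le.1 (h a ha)).1; linarith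
  exact abs_le.2 ⟨by linarith, by linarith⟩

end prob

/-! ### Negligible functions -/

namespace Negligible

variable {μ ν : ℕ → ℝ}

theorem add (hμ : Negligible μ) (hν : Negligible ν) : Negligible fun n => μ n + ν n :=
  Asymptotics.SuperpolynomialDecay.add hμ hν

theorem mono (hν : Negligible ν) (h : ∀ n, |μ n| ≤ ν n) : Negligible μ :=
  Asymptotics.SuperpolynomialDecay.trans_abs_le hν fun n => (h n).trans (le_abs_self _)

theorem zero : Negligible fun _ => 0 := Asymptotics.superpolynomialDecay_zero _ _

theorem sum {ι : Type} (s : Finset ι) {μ : ι → ℕ → ℝ} (h : ∀ i ∈ s, Negligible (μ i)) :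
    Negligible fun n => ∑ i ∈ s, μ i n := by
  classical
  induction s using Finset.induction_on with
  | empty => simpa using zero
  | insert i s hi ih =>
    simp only [Finset.sum_insert hi]
    exact (h i (Finset.mem_insert_self i s)).add (ih fun j hj => h j (Finset.mem_insert_of_mem hj))

end Negligible

/-! ### Values of gadgets -/

theorem natCast_inj_of_lt {p a b : ℕ} (h : (a : ZMod p) = b) (ha : a < p) (hb : b < p) : a = b := by
  rw [ZMod.natCast_eq_natCast_iff'] at h
  rwa [Nat.mod_eq_of_lt ha, Nat.mod_eq_of_lt hb] at h

/-- Zero is the only multiple of `p` of absolute value below `p`. This turns congruences of wires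
into equalities of integers. -/
theorem intCast_inj_of_lt {p : ℕ} {a b : ℤ} (h : (a : ZMod p) = b) (hab : |b - a| < p) : a = b := by
  rw [ZMod.intCast_eq_intCast_iff_dvd_sub] at h
  have := Int.eq_zero_of_abs_lt_dvd h hab
  omega

section holds

variable {F ι : Type} [CommRing F] {v : ι → F}

/-- All expressions vanish. -/
def Holds (v : ι → F) (l : List (Expr F ι)) : Prop := ∀ g ∈ l, g.eval v = 0

@[simp] theorem holds_nil : Holds v [] := by simp [Holds]

@[simp] theorem holds_cons {g : Expr F ι} {l : List (Expr F ι)} :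
    Holds v (g :: l) ↔ g.eval v = 0 ∧ Holds v l := by simp [Holds]

@[simp] theorem holds_append {l l' : List (Expr F ι)} :
    Holds v (l ++ l') ↔ Holds v l ∧ Holds v l' := by
  simp [Holds, or_imp, forall_and]

@[simp] theorem Expr.eval_add (a b : Expr F ι) : (a + b).eval v = a.eval v + b.eval v := rfl
@[simp] theorem Expr.eval_sub (a b : Expr F ι) : (a - b).eval v = a.eval v - b.eval v := rfl
@[simp] theorem Expr.eval_mul (a b : Expr F ι) : (a * b).eval v = a.eval v * b.eval v := rfl

theorem Expr.eval_sum (l : List (Expr F ι)) :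
    (Expr.sum l).eval v = (l.map fun e => e.eval v).sum := by
  induction l with
  | nil => rfl
  | cons a l ih => simp only [List.map_cons, List.sum_cons, ← ih]; rfl

theorem Expr.eval_prod (l : List (Expr F ι)) :
    (Expr.prod l).eval v = (l.map fun e => e.eval v).prod := by
  induction l with
  | nil => rfl
  | cons a l ih => simp only [List.map_cons, List.prod_cons, ← ih]; rfl

end holds

/-! ### Digits, comparison, powers of two, rounding; multiplication and division. -/

namespace Gadget

variable {p : ℕ} {ι : Type} {v : ι → ZMod p}

@[simp] theorem eval_num (t : ℕ) : (num p t : Expr (ZMod p) ι).eval v = t := rfl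

/-- The `i`-th binary digit of `t`, as a field element. -/
def digit (p t i : ℕ) : ZMod p := ((t.testBit i).toNat : ZMod p)

theorem testBit_iff_le {t k : ℕ} (ht : t < 2 ^ (k + 1)) : t.testBit k = true ↔ 2 ^ k ≤ t := by
  constructor
  · exact Nat.ge_two_pow_of_testBit
  · intro h
    obtain ⟨d, rfl⟩ := Nat.exists_eq_add_of_le h
    rw [Nat.testBit_two_pow_add_eq, Nat.testBit_lt_two_pow (by rw [pow_succ] at ht; omega)]
    rfl

theorem sum_digits (p t k : ℕ) : ((List.range k).map fun i => (2 : ZMod p) ^ i * digit p t i).sum =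
    ((t % 2 ^ k : ℕ) : ZMod p) := by
  induction k with
  | zero => simp [Nat.mod_one]
  | succ k ih =>
    rw [List.range_succ, List.map_append, List.sum_append, ih, Nat.mod_pow_succ, ← Nat.toNat_testBit]
    simp [digit]

/-- For a bit `β` the factor `1 + β * (2 ^ 2 ^ i - 1)` is `2 ^ (β * 2 ^ i)`, so the product adds up
the binary expansion in the exponent. -/
theorem prod_digits (p t k : ℕ) :
    ((List.range k).map fun i => 1 + digit p t i * ((2 : ZMod p) ^ 2 ^ i - 1)).prod =
      2 ^ (t % 2 ^ k) := by
  induction k with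
  | zero => simp [Nat.mod_one]
  | succ k ih =>
    rw [List.range_succ, List.map_append, List.prod_append, ih, Nat.mod_pow_succ, ← Nat.toNat_testBit, pow_add]
    cases h : t.testBit k <;> simp [digit, h]

theorem two_pow_size_le {w : ℕ} (hw : 1 ≤ w) : 2 ^ Nat.size w ≤ 2 * w := by
  have h : 0 < Nat.size w := Nat.size_pos.2 hw
  have := Nat.lt_size.1 (Nat.sub_lt h one_pos)
  have e : 2 ^ Nat.size w = 2 * 2 ^ (Nat.size w - 1) := by
    rw [← pow_succ', Nat.sub_add_cancel h]
  omega

theorem four_mul_lt {w : ℕ} (hp : 2 ^ (3 * w + 1) < p) : 4 * w < p := by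
  have h1 : w < 2 ^ w := Nat.lt_two_pow_self
  rcases Nat.eq_zero_or_pos w with rfl | hw
  · simpa using (Nat.zero_le _).trans_lt hp
  have h2 : 4 * 2 ^ w ≤ 2 ^ (3 * w + 1) := by
    rw [show 4 = 2 ^ 2 by norm_num, ← pow_add]
    exact Nat.pow_le_pow_right (by norm_num) (by omega)
  omega

/-- The wires carry the decimal `a`. -/
def DecEval (v : ι → ZMod p) (A : Expr (ZMod p) ι × Expr (ZMod p) ι) (a : Dec) : Prop :=
  A.1.eval v = (a.s : ZMod p) ∧ A.2.eval v = (a.e : ZMod p)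

variable [Fact p.Prime]

theorem digit_eq_one {t i : ℕ} : digit p t i = 1 ↔ t.testBit i = true := by
  unfold digit
  cases t.testBit i <;> simp

theorem exists_digits (b : ℕ → ZMod p) (k : ℕ) (hb : ∀ i < k, b i = 0 ∨ b i = 1) :
    ∃ t : ℕ, t < 2 ^ k ∧ ∀ i < k, b i = digit p t i := by
  induction k with
  | zero => exact ⟨0, by simp, by simp⟩
  | succ k ih =>
    obtain ⟨t, ht, h⟩ := ih fun i hi => hb i (by omega)
    obtain ⟨β, hβ, hk⟩ : ∃ β < 2, b k = digit p β 0 := by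
      rcases hb k (by omega) with h | h
      · exact ⟨0, by omega, by simp [h, digit]⟩
      · exact ⟨1, by omega, by simp [h, digit]⟩
    refine ⟨2 ^ k * β + t, ?_, fun i hi => ?_⟩
    · have : 2 ^ k * β ≤ 2 ^ k * 1 := Nat.mul_le_mul_left _ (by omega)
      rw [pow_succ]; omega
    · unfold digit at h hk ⊢
      rw [Nat.testBit_two_pow_mul_add _ ht]
      by_cases hik : i < k
      · rw [if_pos hik, h i hik]
      · obtain rfl : i = k := by omega
        simp [hk]

/-- The integer `t` is read off the bits, so nothing is assumed about `2 ^ k` and `p`. That `t` is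
the intended integer, and not just congruent to it, has to come from size bounds wherever this is
used. -/
theorem holds_bitDecompose {k : ℕ} {x : Expr (ZMod p) ι} {b : ℕ → Expr (ZMod p) ι} :
    Holds v (bitDecompose k x b) ↔
      ∃ t : ℕ, t < 2 ^ k ∧ x.eval v = (t : ZMod p) ∧ ∀ i < k, (b i).eval v = digit p t i := by
  have h1 : Holds v ((List.range k).map fun i => isBit (b i)) ↔
      ∀ i < k, (b i).eval v = 0 ∨ (b i).eval v = 1 := by
    simp [Holds, isBit, sub_eq_zero]
  have h2 : ∀ t < 2 ^ k, (∀ i < k, (b i).eval v = digit p t i) →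
      (Expr.sum ((List.range k).map fun i => num p (2 ^ i) * b i)).eval v = (t : ZMod p) := by
    intro t ht hb
    rw [Expr.eval_sum, List.map_map]
    have : ((List.range k).map ((fun e => Expr.eval v e) ∘ fun i => num p (2 ^ i) * b i)) =
        (List.range k).map fun i => (2 : ZMod p) ^ i * digit p t i := by
      refine List.map_congr_left fun i hi => ?_
      simp [hb i (List.mem_range.1 hi)]
    rw [this, sum_digits, Nat.mod_eq_of_lt ht]
  rw [bitDecompose, holds_append, h1]
  simp only [holds_cons, holds_nil, and_true, Expr.eval_sub, sub_eq_zero]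
  constructor
  · rintro ⟨hb, hx⟩
    obtain ⟨t, ht, h⟩ := exists_digits (fun i => (b i).eval v) k hb
    exact ⟨t, ht, hx.trans (h2 t ht h), h⟩
  · rintro ⟨t, ht, hx, h⟩
    refine ⟨fun i hi => ?_, hx.trans (h2 t ht h).symm⟩
    rw [h i hi, digit]
    cases t.testBit i <;> simp

theorem holds_compareBits {k : ℕ} {x y : Expr (ZMod p) ι} {b : ℕ → Expr (ZMod p) ι} :
    Holds v (compareBits k x y b) ↔
      ∃ t : ℕ, t < 2 ^ (k + 1) ∧ y.eval v - x.eval v + 2 ^ k = (t : ZMod p) ∧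
        ∀ i < k + 1, (b i).eval v = digit p t i := by
  simp [compareBits, holds_bitDecompose]

/-- A top digit one says that the decomposed number is at least the offset `2 ^ k`; what remains
represents `y - x` with `k` digits. -/
theorem holds_compare {k : ℕ} {x y : Expr (ZMod p) ι} {b : ℕ → Expr (ZMod p) ι} :
    Holds v (compare k x y b) ↔
      ∃ t : ℕ, t < 2 ^ k ∧ y.eval v - x.eval v = (t : ZMod p) ∧
        ∀ i < k + 1, (b i).eval v = digit p (t + 2 ^ k) i := by
  rw [compare, holds_append, holds_compareBits]
  simp only [holds_cons, holds_nil, and_true, Expr.eval_sub, eval_num, Nat.cast_one, sub_eq_zero]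
  constructor
  · rintro ⟨⟨t, ht, hxy, hb⟩, h1⟩
    rw [hb k (by omega), digit_eq_one, testBit_iff_le ht] at h1
    obtain ⟨d, rfl⟩ := Nat.exists_eq_add_of_le h1
    refine ⟨d, by rw [pow_succ] at ht; omega, ?_, fun i hi => by rw [hb i hi, add_comm]⟩
    push_cast at hxy
    linear_combination hxy
  · rintro ⟨t, ht, hxy, hb⟩
    have hlt : t + 2 ^ k < 2 ^ (k + 1) := by rw [pow_succ]; omega
    refine ⟨⟨t + 2 ^ k, hlt, by push_cast; rw [hxy], hb⟩, ?_⟩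
    rw [hb k (by omega), digit_eq_one, testBit_iff_le hlt]
    omega

theorem holds_normalized {w : ℕ} (hw : 1 ≤ w) {s : Expr (ZMod p) ι} {b : ℕ → Expr (ZMod p) ι} :
    Holds v (normalized w s b) ↔
      ∃ t : ℕ, (2 ^ (w - 1) ≤ t ∧ t < 2 ^ w) ∧ s.eval v = (t : ZMod p) ∧
        ∀ i < w, (b i).eval v = digit p t i := by
  rw [normalized, holds_append, holds_bitDecompose]
  simp only [holds_cons, holds_nil, and_true, Expr.eval_sub, eval_num, Nat.cast_one, sub_eq_zero]
  have hlt : ∀ {t}, t < 2 ^ w → t < 2 ^ (w - 1 + 1) := fun h => by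
    rwa [Nat.sub_add_cancel hw]
  constructor
  · rintro ⟨⟨t, ht, hs, hb⟩, h1⟩
    rw [hb _ (by omega), digit_eq_one, testBit_iff_le (hlt ht)] at h1
    exact ⟨t, ⟨h1, ht⟩, hs, hb⟩
  · rintro ⟨t, ⟨h1, ht⟩, hs, hb⟩
    refine ⟨⟨t, ht, hs, hb⟩, ?_⟩
    rwa [hb _ (by omega), digit_eq_one, testBit_iff_le (hlt ht)]

/-- The two decompositions yield `t` for `l` and `u` for `w - l`, with `t + u` congruent to `w`.
Both are below `2 ^ Nat.size w ≤ 2 * w`, and `4 * w < p`, so `t + u = w` and thus `t ≤ w`. -/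
theorem holds_exponentialCheck {w : ℕ} (hw : 1 ≤ w) (hp : 2 ^ (3 * w + 1) < p)
    {l r : Expr (ZMod p) ι} {b : ℕ → Expr (ZMod p) ι} :
    Holds v (exponentialCheck w l r b) ↔
      ∃ t : ℕ, t ≤ w ∧ l.eval v = (t : ZMod p) ∧ r.eval v = 2 ^ t ∧
        (∀ i < Nat.size w, (b i).eval v = digit p t i) ∧
        ∀ i < Nat.size w + 1, (b (Nat.size w + i)).eval v =
          digit p (w - t + 2 ^ Nat.size w) i := by
  have hsize := two_pow_size_le hw
  have h4 := four_mul_lt hp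
  have hwlt : w < 2 ^ Nat.size w := Nat.lt_size_self w
  have key : ∀ t < 2 ^ Nat.size w, (∀ i < Nat.size w, (b i).eval v = digit p t i) →
      (Expr.prod ((List.range (Nat.size w)).map fun i =>
        num p 1 + b i * (num p (2 ^ 2 ^ i) - num p 1))).eval v = 2 ^ t := by
    intro t ht hb
    rw [Expr.eval_prod, List.map_map]
    have : ((List.range (Nat.size w)).map ((fun e => Expr.eval v e) ∘ fun i =>
        num p 1 + b i * (num p (2 ^ 2 ^ i) - num p 1))) =
        (List.range (Nat.size w)).map fun i => 1 + digit p t i * ((2 : ZMod p) ^ 2 ^ i - 1) := by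
      refine List.map_congr_left fun i hi => ?_
      simp [hb i (List.mem_range.1 hi)]
    rw [this, prod_digits, Nat.mod_eq_of_lt ht]
  rw [exponentialCheck, holds_append, holds_append, holds_bitDecompose, holds_compare]
  simp only [holds_cons, holds_nil, and_true, Expr.eval_sub, eval_num, sub_eq_zero]
  constructor
  · rintro ⟨⟨⟨t, ht, hl, hb⟩, u, hu, hlu, hb'⟩, hr⟩
    have hwt : w = t + u := by
      refine natCast_inj_of_lt (p := p) ?_ (by omega) (by omega)
      push_cast
      rw [← hl, ← hlu]; ring
    refine ⟨t, by omega, hl, hr.trans (key t ht hb), hb, fun i hi => ?_⟩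
    rw [hb' i hi, show w - t = u by omega]
  · rintro ⟨t, ht, hl, hr, hb, hb'⟩
    refine ⟨⟨⟨t, by omega, hl, hb⟩, w - t, by omega, ?_, hb'⟩, hr.trans (key t (by omega) hb).symm⟩
    rw [hl, Nat.cast_sub ht]

/-- Multiplication by `δ⁻¹ = 2 ^ (w - 1)`, with terms moved so that no subtraction of natural
numbers occurs. The two inequalities say that `X - 2 ^ (w - 1) * (X - Y)` is a nonnegative integer
of at most `2 * w` bits. -/
theorem rounds_iff {w X Y : ℕ} : Rounds w X Y ↔
    2 ^ (w - 1) * X ≤ X + 2 ^ (w - 1) * Y ∧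
      X + 2 ^ (w - 1) * Y < 2 ^ (2 * w) + 2 ^ (w - 1) * X := by
  have hW : (0 : ℚ) < 2 ^ (w - 1) := by positivity
  have h1 : ((X : ℚ) - Y ≤ δ w * X ↔ 2 ^ (w - 1) * X ≤ X + 2 ^ (w - 1) * Y) := by
    rw [δ, inv_mul_eq_div, le_div_iff₀ hW, ← Nat.cast_le (α := ℚ)]
    push_cast
    constructor <;> intro h <;> linarith
  have h2 : ((Y : ℚ) - X < δ w * (2 ^ (2 * w) - X) ↔
      X + 2 ^ (w - 1) * Y < 2 ^ (2 * w) + 2 ^ (w - 1) * X) := by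
    rw [δ, inv_mul_eq_div, lt_div_iff₀ hW, ← Nat.cast_lt (α := ℚ)]
    push_cast
    constructor <;> intro h <;> linarith
  rw [Rounds, h1, h2]

/-- The number that the rounding check decomposes into digits. -/
def roundingValue (w X Y : ℕ) : ℕ := X + 2 ^ (w - 1) * Y - 2 ^ (w - 1) * X + 2 ^ (2 * w)

/-- This is where `2 ^ (3 * w + 1) < p` is decisive: a product of the `w - 1` bit factor `2 ^ (w -
1)` with `Y` must not wrap around. The extra bit allowed for `Y` is needed for sums, whose shift `θ`
may be `w + 1`. -/
theorem holds_rounding {w : ℕ} (hw : 1 ≤ w) (hp : 2 ^ (3 * w + 1) < p) {x y : Expr (ZMod p) ι}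
    {b : ℕ → Expr (ZMod p) ι} {X Y : ℕ} (hx : x.eval v = (X : ZMod p)) (hy : y.eval v = (Y : ZMod p))
    (hX : X < 2 ^ (2 * w)) (hY : Y < 2 ^ (2 * w + 1)) :
    Holds v (rounding w x y b) ↔
      Rounds w X Y ∧ ∀ i < 2 * w + 1, (b i).eval v = digit p (roundingValue w X Y) i := by
  rw [rounding, holds_compare, rounds_iff, roundingValue]
  simp only [Expr.eval_mul, Expr.eval_sub, eval_num, hx, hy]
  obtain ⟨u, rfl⟩ : ∃ u, w = u + 1 := ⟨w - 1, by omega⟩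
  simp only [Nat.add_sub_cancel]
  have e1 : 2 ^ (2 * (u + 1)) = 4 * (2 ^ u * 2 ^ u) := by ring
  have e2 : 2 ^ (2 * (u + 1) + 1) = 8 * (2 ^ u * 2 ^ u) := by ring
  have e3 : 2 ^ (3 * (u + 1) + 1) = 16 * (2 ^ u * (2 ^ u * 2 ^ u)) := by ring
  rw [e3] at hp
  rw [e1] at hX
  rw [e2] at hY
  have hW : 1 ≤ 2 ^ u := Nat.one_le_two_pow
  constructor
  · rintro ⟨t, ht, h, hb⟩
    rw [e1] at ht
    -- With `u = w - 1` the left side is below `12 * 8 ^ u` and the right side below `8 * 8 ^ u`,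
    -- both less than `16 * 8 ^ u = 2 ^ (3 * w + 1)`.
    have key : X + 2 ^ u * Y = t + 2 ^ u * X := by
      refine natCast_inj_of_lt (p := p) ?_ ?_ ?_
      · push_cast at h ⊢
        linear_combination h
      · have : 2 ^ u * Y ≤ 2 ^ u * (8 * (2 ^ u * 2 ^ u)) := Nat.mul_le_mul_left _ hY.le
        nlinarith [Nat.mul_le_mul_right (2 ^ u * 2 ^ u) hW]
      · have : 2 ^ u * X ≤ 2 ^ u * (4 * (2 ^ u * 2 ^ u)) := Nat.mul_le_mul_left _ hX.le
        nlinarith [Nat.mul_le_mul_right (2 ^ u * 2 ^ u) hW]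
    refine ⟨⟨by omega, by omega⟩, fun i hi => ?_⟩
    rw [hb i hi, key, Nat.add_sub_cancel]
  · rintro ⟨⟨h1, h2⟩, hb⟩
    refine ⟨X + 2 ^ u * Y - 2 ^ u * X, by omega, ?_, hb⟩
    rw [Nat.cast_sub h1]
    push_cast
    ring

theorem chooseTheta_iff {w : ℕ} {x : Expr (ZMod p) ι} :
    (chooseTheta w x).eval v = 0 ↔ ∃ θ : ℕ, (θ = w - 1 ∨ θ = w) ∧ x.eval v = (θ : ZMod p) := by
  simp only [chooseTheta, Expr.eval_mul, Expr.eval_sub, eval_num, mul_eq_zero, sub_eq_zero,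
    or_and_right, exists_or, exists_eq_left]
  exact or_comm

theorem eval_mid {w : ℕ} (hw : 1 ≤ w) {x : Expr (ZMod p) ι} {θ : ℕ} (hθ : θ = w - 1 ∨ θ = w)
    (hx : x.eval v = (θ : ZMod p)) : (mid w x).eval v = ((2 ^ θ : ℕ) : ZMod p) := by
  obtain ⟨u, rfl⟩ : ∃ u, w = u + 1 := ⟨w - 1, by omega⟩
  rcases hθ with rfl | rfl <;> simp [mid, hx]

theorem mul_lt_of_normal {w : ℕ} {a b : ℕ} (ha : a < 2 ^ w) (hb : b ≤ 2 ^ w) :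
    a * b < 2 ^ (2 * w) := by
  rw [two_mul, pow_add]
  exact Nat.mul_lt_mul_of_lt_of_le ha hb (by positivity)

theorem pow_le_of_theta {w θ : ℕ} (hθ : θ = w - 1 ∨ θ = w) : 2 ^ θ ≤ 2 ^ w :=
  Nat.pow_le_pow_right (by norm_num) (by omega)

variable {w : ℕ} {A B : Expr (ZMod p) ι × Expr (ZMod p) ι} {x : ℕ → Expr (ZMod p) ι} {a b c : Dec}

/-- The exponent of `c` is taken to be the integer `a.e + b.e + θ`; the exponent wire is only known
modulo `p`, and nothing more is needed for it to carry `c`. The significand is pinned down by its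
digits. -/
theorem floatMul_sound (hw : 1 ≤ w) (hp : 2 ^ (3 * w + 1) < p) (hA : DecEval v A a)
    (hB : DecEval v B b) (ha : a.Normal w) (hb : b.Normal w) (h : Holds v (floatMul w A B x)) :
    ∃ c, MulRel w a b c ∧ DecEval v (x 0, x 1) c := by
  simp only [floatMul, holds_append, holds_cons, holds_nil, and_true, Expr.eval_sub, Expr.eval_add,
    chooseTheta_iff, holds_normalized hw] at h
  obtain ⟨⟨⟨he, θ, hθ, hx⟩, hr⟩, s, hs, hxs, -⟩ := h
  rw [holds_rounding hw hp (X := a.s * b.s) (Y := s * 2 ^ θ)] at hr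
  · refine ⟨⟨s, a.e + b.e + θ⟩, ⟨hs, θ, hθ, by simp, ?_⟩, hxs, ?_⟩
    · have := hr.1
      push_cast at this
      exact this
    · rw [hx, hA.2, hB.2] at he
      push_cast
      linear_combination he
  · simp [hA.1, hB.1]
  · simp [hxs, eval_mid hw hθ hx]
  · exact mul_lt_of_normal ha.2 hb.2.le
  · exact (mul_lt_of_normal hs.2 (pow_le_of_theta hθ)).trans (Nat.pow_lt_pow_right (by norm_num) (by omega))

/-- The values `g` are chosen before the wires and the assignment are: the assignment contains these
values itself, so they may depend on the decimals alone. The other completeness lemmas have the same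
form for the same reason. -/
theorem floatMul_complete (hw : 1 ≤ w) (hp : 2 ^ (3 * w + 1) < p) (ha : a.Normal w) (hb : b.Normal w)
    (h : MulRel w a b c) :
    ∃ g : ℕ → ZMod p, ∀ (ι : Type) (v : ι → ZMod p) (A B : Expr (ZMod p) ι × Expr (ZMod p) ι)
      (x : ℕ → Expr (ZMod p) ι), DecEval v A a → DecEval v B b →
      (∀ i < 3 * w + 4, (x i).eval v = g i) →
      Holds v (floatMul w A B x) ∧ DecEval v (x 0, x 1) c := by
  obtain ⟨hs, θ, hθ, he, hr⟩ := h
  -- The wires are: significand, exponent and `θ`; `w` digits of the significand; `2 * w + 1` digits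
  -- of the rounding check.
  refine ⟨fun i => if i = 0 then (c.s : ZMod p) else if i = 1 then (c.e : ZMod p) else
    if i = 2 then (θ : ZMod p) else if i < 3 + w then digit p c.s (i - 3) else
    digit p (roundingValue w (a.s * b.s) (c.s * 2 ^ θ)) (i - (3 + w)), ?_⟩
  intro ι v A B x hA hB hx
  have h0 := hx 0 (by omega)
  have h1 := hx 1 (by omega)
  have h2 := hx 2 (by omega)
  norm_num at h0 h1 h2
  refine ⟨?_, h0, h1⟩
  simp only [floatMul, holds_append, holds_cons, holds_nil, and_true, Expr.eval_sub, Expr.eval_add,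
    chooseTheta_iff, holds_normalized hw]
  refine ⟨⟨⟨?_, θ, hθ, h2⟩, ?_⟩, c.s, hs, h0, fun i hi => ?_⟩
  · rw [h1, h2, hA.2, hB.2, show c.e = a.e + b.e + θ by omega]
    push_cast
    ring
  · rw [holds_rounding hw hp (X := a.s * b.s) (Y := c.s * 2 ^ θ)]
    · refine ⟨by push_cast; exact hr, fun i hi => ?_⟩
      rw [hx _ (by omega)]
      beta_reduce
      rw [if_neg (by omega), if_neg (by omega), if_neg (by omega),
        if_neg (by omega), Nat.add_sub_cancel_left]
    · simp [hA.1, hB.1]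
    · simp [h0, eval_mid hw hθ h2]
    · exact mul_lt_of_normal ha.2 hb.2.le
    · exact (mul_lt_of_normal hs.2 (pow_le_of_theta hθ)).trans (Nat.pow_lt_pow_right (by norm_num) (by omega))
  · rw [hx _ (by omega)]
    beta_reduce
    rw [if_neg (by omega), if_neg (by omega), if_neg (by omega),
      if_pos (by omega), Nat.add_sub_cancel_left]

theorem floatDiv_sound (hw : 1 ≤ w) (hp : 2 ^ (3 * w + 1) < p) (hA : DecEval v A a)
    (hB : DecEval v B b) (ha : a.Normal w) (hb : b.Normal w) (h : Holds v (floatDiv w A B x)) :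
    ∃ c, DivRel w a b c ∧ DecEval v (x 0, x 1) c := by
  simp only [floatDiv, holds_append, holds_cons, holds_nil, and_true, Expr.eval_sub, Expr.eval_add,
    chooseTheta_iff, holds_normalized hw] at h
  obtain ⟨⟨⟨he, θ, hθ, hx⟩, hr⟩, s, hs, hxs, -⟩ := h
  rw [holds_rounding hw hp (X := a.s * 2 ^ θ) (Y := s * b.s)] at hr
  · refine ⟨⟨s, a.e - b.e - θ⟩, ⟨hs, θ, hθ, by simp, ?_⟩, hxs, ?_⟩
    · have := hr.1
      push_cast at this
      exact this
    · rw [hx, hA.2, hB.2] at he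
      push_cast
      linear_combination he
  · simp [hA.1, eval_mid hw hθ hx]
  · simp [hxs, hB.1]
  · exact mul_lt_of_normal ha.2 (pow_le_of_theta hθ)
  · exact (mul_lt_of_normal hs.2 hb.2.le).trans (Nat.pow_lt_pow_right (by norm_num) (by omega))

theorem floatDiv_complete (hw : 1 ≤ w) (hp : 2 ^ (3 * w + 1) < p) (ha : a.Normal w) (hb : b.Normal w)
    (h : DivRel w a b c) :
    ∃ g : ℕ → ZMod p, ∀ (ι : Type) (v : ι → ZMod p) (A B : Expr (ZMod p) ι × Expr (ZMod p) ι)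
      (x : ℕ → Expr (ZMod p) ι), DecEval v A a → DecEval v B b →
      (∀ i < 3 * w + 4, (x i).eval v = g i) →
      Holds v (floatDiv w A B x) ∧ DecEval v (x 0, x 1) c := by
  obtain ⟨hs, θ, hθ, he, hr⟩ := h
  refine ⟨fun i => if i = 0 then (c.s : ZMod p) else if i = 1 then (c.e : ZMod p) else
    if i = 2 then (θ : ZMod p) else if i < 3 + w then digit p c.s (i - 3) else
    digit p (roundingValue w (a.s * 2 ^ θ) (c.s * b.s)) (i - (3 + w)), ?_⟩
  intro ι v A B x hA hB hx
  have h0 := hx 0 (by omega)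
  have h1 := hx 1 (by omega)
  have h2 := hx 2 (by omega)
  norm_num at h0 h1 h2
  refine ⟨?_, h0, h1⟩
  simp only [floatDiv, holds_append, holds_cons, holds_nil, and_true, Expr.eval_sub, Expr.eval_add,
    chooseTheta_iff, holds_normalized hw]
  refine ⟨⟨⟨?_, θ, hθ, h2⟩, ?_⟩, c.s, hs, h0, fun i hi => ?_⟩
  · rw [h1, h2, hA.2, hB.2, show c.e = a.e - b.e - θ by omega]
    push_cast
    ring
  · rw [holds_rounding hw hp (X := a.s * 2 ^ θ) (Y := c.s * b.s)]
    · refine ⟨by push_cast; exact hr, fun i hi => ?_⟩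
      rw [hx _ (by omega)]
      beta_reduce
      rw [if_neg (by omega), if_neg (by omega), if_neg (by omega),
        if_neg (by omega), Nat.add_sub_cancel_left]
    · simp [hA.1, eval_mid hw hθ h2]
    · simp [h0, hB.1]
    · exact mul_lt_of_normal ha.2 (pow_le_of_theta hθ)
    · exact (mul_lt_of_normal hs.2 hb.2.le).trans (Nat.pow_lt_pow_right (by norm_num) (by omega))
  · rw [hx _ (by omega)]
    beta_reduce
    rw [if_neg (by omega), if_neg (by omega), if_neg (by omega),
      if_pos (by omega), Nat.add_sub_cancel_left]

end Gadget

/-! ### Addition, selection, counting, and the indicators of equality and order. -/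

namespace Gadget

theorem add_two_pow_lt (w k : ℕ) : w + 2 ^ k < 2 ^ (w + k + 1) := by
  have h1 : w < 2 ^ w := Nat.lt_two_pow_self
  have h2 : 2 ^ w ≤ 2 ^ (w + k) := Nat.pow_le_pow_right (by norm_num) (by omega)
  have h3 : 2 ^ k ≤ 2 ^ (w + k) := Nat.pow_le_pow_right (by norm_num) (by omega)
  rw [pow_succ]
  omega

theorem aligned_lt {w l a b : ℕ} (hl : l ≤ w) (ha : a < 2 ^ w) (hb : b < 2 ^ w) :
    a * 2 ^ l + b < 2 ^ (2 * w) := by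
  have h1 : a * 2 ^ l ≤ a * 2 ^ w :=
    Nat.mul_le_mul_left _ (Nat.pow_le_pow_right (by norm_num) hl)
  have h2 : (a + 1) * 2 ^ w ≤ 2 ^ w * 2 ^ w := Nat.mul_le_mul_right _ ha
  rw [two_mul, pow_add]
  linarith

/-- Normalization determines the shift: `t * 2 ^ n` has exactly `w` bits only for `n = w - Nat.size
t`. The prover is thus left no freedom in writing a count as a decimal. -/
theorem ofNat_eq_some {w t n : ℕ} (hw : 1 ≤ w) (hn : n ≤ w) (h1 : 2 ^ (w - 1) ≤ t * 2 ^ n)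
    (h2 : t * 2 ^ n < 2 ^ w) : Dec.ofNat w t = some ⟨t * 2 ^ n, -(n : ℤ)⟩ := by
  have ht : 0 < t := by
    rcases Nat.eq_zero_or_pos t with rfl | h
    · have := Nat.two_pow_pos (w - 1)
      omega
    · exact h
  have hpos := Nat.two_pow_pos n
  have hlt : t < 2 ^ w := lt_of_le_of_lt (Nat.le_mul_of_pos_right t hpos) h2
  have hnw : n < w := by
    by_contra h
    obtain rfl : n = w := by omega
    have := Nat.le_mul_of_pos_left (2 ^ n) ht
    omega
  have hle : Nat.size t ≤ w - n := by
    rw [Nat.size_le]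
    refine Nat.lt_of_mul_lt_mul_right (a := 2 ^ n) ?_
    rwa [← pow_add, Nat.sub_add_cancel hn]
  have hge : w - n - 1 < Nat.size t := by
    rw [Nat.lt_size]
    refine Nat.le_of_mul_le_mul_right (c := 2 ^ n) ?_ hpos
    rwa [← pow_add, show w - n - 1 + n = w - 1 by omega]
  rw [Dec.ofNat, if_pos ⟨ht, hlt⟩, show w - Nat.size t = n by omega]

theorem normal_of_ofNat {w t : ℕ} {c : Dec} (h : Dec.ofNat w t = some c) :
    ∃ n ≤ w, c = ⟨t * 2 ^ n, -(n : ℤ)⟩ ∧ c.Normal w := by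
  unfold Dec.ofNat at h
  split_ifs at h with ht
  obtain rfl := Option.some.inj h
  refine ⟨_, Nat.sub_le _ _, rfl, ?_⟩
  have hs : 0 < Nat.size t := Nat.size_pos.2 ht.1
  have hsw : Nat.size t ≤ w := Nat.size_le.2 ht.2
  constructor
  · have := Nat.lt_size.1 (Nat.sub_lt hs one_pos)
    calc 2 ^ (w - 1) = 2 ^ (Nat.size t - 1) * 2 ^ (w - Nat.size t) := by
          rw [← pow_add]; congr 1; omega
      _ ≤ _ := Nat.mul_le_mul_right _ this
  · calc t * 2 ^ (w - Nat.size t) < 2 ^ Nat.size t * 2 ^ (w - Nat.size t) :=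
          Nat.mul_lt_mul_of_pos_right (Nat.lt_size_self t) (by positivity)
      _ = 2 ^ w := by rw [← pow_add]; congr 1; omega

/-- Significands differ by less than `2 ^ w`, so the lexicographic order on (exponent, significand)
is the order of the integers `e * 2 ^ w + s`. -/
theorem ble_iff {w : ℕ} {a b : Dec} (ha : a.Normal w) (hb : b.Normal w) :
    a.ble b = true ↔ 0 ≤ (b.e - a.e) * 2 ^ w + ((b.s : ℤ) - a.s) := by
  have h1 : (a.s : ℤ) < 2 ^ w := by exact_mod_cast ha.2
  have h2 : (b.s : ℤ) < 2 ^ w := by exact_mod_cast hb.2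
  simp only [Dec.ble, decide_eq_true_eq]
  constructor
  · rintro (h | ⟨h, h'⟩)
    · nlinarith
    · rw [h]; simp; omega
  · intro h
    rcases lt_trichotomy a.e b.e with hlt | heq | hgt
    · exact Or.inl hlt
    · rw [heq] at h; exact Or.inr ⟨heq, by simp at h; omega⟩
    · exfalso; nlinarith

theorem abs_gap_lt {w k : ℕ} {a b : Dec} (ha : a.Normal w) (hb : b.Normal w)
    (hk : |a.e - b.e| < 2 ^ k) :
    |(b.e - a.e) * 2 ^ w + ((b.s : ℤ) - a.s)| < 2 ^ (k + w) := by
  have h1 : (a.s : ℤ) < 2 ^ w := by exact_mod_cast ha.2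
  have h2 : (b.s : ℤ) < 2 ^ w := by exact_mod_cast hb.2
  rw [abs_lt] at hk ⊢
  rw [pow_add]
  constructor <;> nlinarith

variable {p : ℕ} {ι : Type} {v : ι → ZMod p}

/-- The wire carries the bit `β`. -/
def BitEval (v : ι → ZMod p) (b : Expr (ZMod p) ι) (β : Bool) : Prop :=
  b.eval v = (β.toNat : ZMod p)

variable [Fact p.Prime]

variable {w k : ℕ} {A B : Expr (ZMod p) ι × Expr (ZMod p) ι} {x : ℕ → Expr (ZMod p) ι} {a b c : Dec}

/-- The argument runs on the possibly exchanged summands (`core`), and the exchange bit then decides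
which disjunct of `AddRel` holds. -/
theorem floatAdd_sound (hw : 1 ≤ w) (hp : 2 ^ (3 * w + 1) < p) (hk : 2 ^ (w + k + 1) < p)
    (hA : DecEval v A a) (hB : DecEval v B b) (ha : a.Normal w) (hb : b.Normal w)
    (hab : |a.e - b.e| < 2 ^ k) (h : Holds v (floatAdd w k A B x)) :
    ∃ c, AddRel w a b c ∧ DecEval v (x 0, x 1) c := by
  have core : ∀ a b : Dec, a.Normal w → b.Normal w → |a.e - b.e| < 2 ^ k →
      DecEval v (x 6, x 7) a → DecEval v (x 8, x 9) b →
      ∃ c, AddCore w a b c ∧ DecEval v (x 0, x 1) c := by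
    intro a b ha hb hab hA hB
    simp only [floatAdd, holds_append, holds_cons, holds_nil, and_true, Expr.eval_sub,
      Expr.eval_add, Expr.eval_mul, eval_num, Nat.cast_one, holds_exponentialCheck hw hp,
      holds_normalized hw] at h
    obtain ⟨⟨⟨⟨-, he, hl, hθ⟩, l, hlw, hxl, hmid, -⟩, hr⟩, s, hs, hxs, -⟩ := h
    -- The gap is congruent to `l`, where `l ≤ w` and the gap is below `2 ^ k` in absolute value. As
    -- `w + 2 ^ k < 2 ^ (w + k + 1) < p`, it equals `l`; in particular it is nonnegative.
    have hgap : a.e - b.e = l := by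
      refine intCast_inj_of_lt (p := p) ?_ ?_
      · push_cast
        rw [← hxl, ← hA.2, ← hB.2]
        linear_combination hl
      · have := add_two_pow_lt w k
        rw [abs_lt] at hab ⊢
        zify at this hk hlw
        constructor <;> linarith
    obtain ⟨θ, hθl, hxθ⟩ : ∃ θ : ℕ, (θ = l ∨ θ = l + 1) ∧ (x 2).eval v = (θ : ZMod p) := by
      rw [hxl, mul_eq_zero, sub_eq_zero, sub_eq_zero] at hθ
      rcases hθ with h | h
      · exact ⟨l, Or.inl rfl, h⟩
      · exact ⟨l + 1, Or.inr rfl, by rw [h]; push_cast; rfl⟩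
    rw [holds_rounding hw hp (X := a.s * 2 ^ l + b.s) (Y := s * 2 ^ θ)] at hr
    · refine ⟨⟨s, b.e + θ⟩, ⟨hs, l, θ, hlw, hθl, by omega, by simp, ?_⟩, hxs, ?_⟩
      · have := hr.1
        push_cast at this
        exact this
      · rw [hxθ, hB.2] at he
        push_cast
        linear_combination -he
    · simp only [Expr.eval_add, Expr.eval_mul, hA.1, hB.1, hmid]
      push_cast
      rfl
    · simp only [Expr.eval_add, Expr.eval_sub, Expr.eval_mul, eval_num, hxs, hmid, hxθ, hxl]
      -- The factor `θ - l + 1` is `1` or `2`, that is, `2 ^ (θ - l)`.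
      rcases hθl with rfl | rfl <;> push_cast <;> ring
    · exact aligned_lt hlw ha.2 hb.2
    -- Here `θ ≤ l + 1 ≤ w + 1`, hence the one bit beyond `2 * w`.
    · calc s * 2 ^ θ < 2 ^ w * 2 ^ θ := Nat.mul_lt_mul_of_pos_right hs.2 (by positivity)
        _ = 2 ^ (w + θ) := (pow_add _ _ _).symm
        _ ≤ _ := Nat.pow_le_pow_right (by norm_num) (by omega)
  have hperm : (x 5).eval v = 0 ∨ (x 5).eval v = 1 := by
    simp only [floatAdd, permutationCheck, isBit, holds_append, holds_cons, Expr.eval_mul,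
      Expr.eval_sub, eval_num, Nat.cast_one, mul_eq_zero, sub_eq_zero] at h
    exact h.1.1.1.1.1.1
  simp only [floatAdd, permutationCheck, holds_append, holds_cons, Expr.eval_mul, Expr.eval_add,
    Expr.eval_sub] at h
  obtain ⟨⟨⟨⟨⟨⟨-, h6, h7, h8, h9, -⟩, -⟩, -⟩, -⟩, -⟩, -⟩ := h
  rcases hperm with h5 | h5 <;> rw [h5] at h6 h7 h8 h9
  · obtain ⟨c, hc, hx⟩ := core a b ha hb hab
      ⟨by rw [← hA.1]; linear_combination h6, by rw [← hA.2]; linear_combination h7⟩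
      ⟨by rw [← hB.1]; linear_combination h8, by rw [← hB.2]; linear_combination h9⟩
    exact ⟨c, Or.inl hc, hx⟩
  · obtain ⟨c, hc, hx⟩ := core b a hb ha (by rwa [abs_sub_comm])
      ⟨by rw [← hB.1]; linear_combination h6, by rw [← hB.2]; linear_combination h7⟩
      ⟨by rw [← hA.1]; linear_combination h8, by rw [← hA.2]; linear_combination h9⟩
    exact ⟨c, Or.inr hc, hx⟩

theorem floatAdd_complete (hw : 1 ≤ w) (hp : 2 ^ (3 * w + 1) < p) (ha : a.Normal w)
    (hb : b.Normal w) (hab : |a.e - b.e| < 2 ^ k) (h : AddRel w a b c) :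
    ∃ g : ℕ → ZMod p, ∀ (ι : Type) (v : ι → ZMod p) (A B : Expr (ZMod p) ι × Expr (ZMod p) ι)
      (x : ℕ → Expr (ZMod p) ι), DecEval v A a → DecEval v B b →
      (∀ i < 3 * w + 2 * Nat.size w + k + 13, (x i).eval v = g i) →
      Holds v (floatAdd w k A B x) ∧ DecEval v (x 0, x 1) c := by
  -- The summands are ordered by exponent, and `t` is the exchange bit.
  obtain ⟨t, a', b', ht, ha', hb', hab', h⟩ : ∃ (t : ZMod p) (a' b' : Dec),
      (t = 0 ∧ a' = a ∧ b' = b ∨ t = 1 ∧ a' = b ∧ b' = a) ∧ a'.Normal w ∧ b'.Normal w ∧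
        |a'.e - b'.e| < 2 ^ k ∧ AddCore w a' b' c := by
    rcases h with h | h
    · exact ⟨0, a, b, by simp, ha, hb, hab, h⟩
    · exact ⟨1, b, a, by simp, hb, ha, by rwa [abs_sub_comm], h⟩
  obtain ⟨hs, l, θ, hl, hθ, hgap, he, hr⟩ := h
  -- Ten wires with values, followed by the digits of the significand, of the rounding check, of
  -- `l`, of the comparison of `l` with `w`, and of the comparison of the exponents, whose
  -- difference is `l`.
  refine ⟨fun i => if i < 10 then [(c.s : ZMod p), (c.e : ZMod p), (θ : ZMod p), (l : ZMod p),
      2 ^ l, t, (a'.s : ZMod p), (a'.e : ZMod p), (b'.s : ZMod p), (b'.e : ZMod p)].getD i 0 else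
    if i < 10 + w then digit p c.s (i - 10) else
    if i < 10 + 3 * w + 1 then
      digit p (roundingValue w (a'.s * 2 ^ l + b'.s) (c.s * 2 ^ θ)) (i - (10 + w)) else
    if i < 10 + 3 * w + 1 + Nat.size w then digit p l (i - (10 + 3 * w + 1)) else
    if i < 10 + 3 * w + 1 + 2 * Nat.size w + 1 then
      digit p (w - l + 2 ^ Nat.size w) (i - (10 + 3 * w + 1 + Nat.size w)) else
    digit p (l + 2 ^ k) (i - (10 + 3 * w + 1 + 2 * Nat.size w + 1)), ?_⟩
  intro ι v A B x hA hB hx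
  have hx' : ∀ i < 10, (x i).eval v = [(c.s : ZMod p), (c.e : ZMod p), (θ : ZMod p),
      (l : ZMod p), 2 ^ l, t, (a'.s : ZMod p), (a'.e : ZMod p), (b'.s : ZMod p),
      (b'.e : ZMod p)].getD i 0 := fun i hi => by
    rw [hx i (by omega)]
    exact if_pos hi
  have h0 : (x 0).eval v = (c.s : ZMod p) := hx' 0 (by norm_num)
  have h1 : (x 1).eval v = (c.e : ZMod p) := hx' 1 (by norm_num)
  have h2 : (x 2).eval v = (θ : ZMod p) := hx' 2 (by norm_num)
  have h3 : (x 3).eval v = (l : ZMod p) := hx' 3 (by norm_num)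
  have h4 : (x 4).eval v = 2 ^ l := hx' 4 (by norm_num)
  have h5 : (x 5).eval v = t := hx' 5 (by norm_num)
  have h6 : (x 6).eval v = (a'.s : ZMod p) := hx' 6 (by norm_num)
  have h7 : (x 7).eval v = (a'.e : ZMod p) := hx' 7 (by norm_num)
  have h8 : (x 8).eval v = (b'.s : ZMod p) := hx' 8 (by norm_num)
  have h9 : (x 9).eval v = (b'.e : ZMod p) := hx' 9 (by norm_num)
  refine ⟨?_, h0, h1⟩
  have hgap' : (a'.e : ZMod p) = b'.e + l := by rw [← hgap]; push_cast; rfl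
  simp only [floatAdd, permutationCheck, isBit, holds_append, holds_cons, holds_nil, and_true,
    Expr.eval_sub, Expr.eval_add, Expr.eval_mul, eval_num, Nat.cast_one,
    holds_exponentialCheck hw hp, holds_normalized hw, holds_compare, h0, h1, h2, h3, h4, h5, h6,
    h7, h8, h9, hA.1, hA.2, hB.1, hB.2]
  refine ⟨⟨⟨⟨⟨?_, l, ?_, ?_, fun i hi => ?_⟩, ?_, ?_, ?_⟩, l, hl, rfl, rfl, fun i hi => ?_,
    fun i hi => ?_⟩, ?_⟩, c.s, hs, rfl, fun i hi => ?_⟩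
  · rcases ht with ⟨rfl, rfl, rfl⟩ | ⟨rfl, rfl, rfl⟩ <;> refine ⟨?_, ?_, ?_, ?_, ?_⟩ <;> ring
  · rw [abs_lt] at hab'
    zify
    linarith
  · rw [hgap']; ring
  · rw [hx _ (by omega)]
    beta_reduce
    rw [if_neg (by omega), if_neg (by omega), if_neg (by omega), if_neg (by omega),
      if_neg (by omega), Nat.add_sub_cancel_left]
  · rw [show c.e = b'.e + θ by omega]; push_cast; ring
  · rw [hgap']; ring
  · rcases hθ with rfl | rfl <;> push_cast <;> ring
  · rw [hx _ (by omega)]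
    beta_reduce
    rw [if_neg (by omega), if_neg (by omega), if_neg (by omega), if_pos (by omega),
      Nat.add_sub_cancel_left]
  · rw [hx _ (by omega)]
    beta_reduce
    rw [if_neg (by omega), if_neg (by omega), if_neg (by omega), if_neg (by omega),
      if_pos (by omega)]
    congr 1
    omega
  · rw [holds_rounding hw hp (X := a'.s * 2 ^ l + b'.s) (Y := c.s * 2 ^ θ)]
    · refine ⟨by push_cast; exact hr, fun i hi => ?_⟩
      rw [hx _ (by omega)]
      beta_reduce
      rw [if_neg (by omega), if_neg (by omega), if_pos (by omega), Nat.add_sub_cancel_left]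
    · simp only [Expr.eval_add, Expr.eval_mul, h6, h4, h8]
      push_cast
      rfl
    · simp only [Expr.eval_add, Expr.eval_sub, Expr.eval_mul, eval_num, h0, h4, h2, h3]
      rcases hθ with rfl | rfl <;> push_cast <;> ring
    · exact aligned_lt hl ha'.2 hb'.2
    · calc c.s * 2 ^ θ < 2 ^ w * 2 ^ θ := Nat.mul_lt_mul_of_pos_right hs.2 (by positivity)
        _ = 2 ^ (w + θ) := (pow_add _ _ _).symm
        _ ≤ _ := Nat.pow_le_pow_right (by norm_num) (by omega)
  · rw [hx _ (by omega)]
    beta_reduce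
    rw [if_neg (by omega), if_pos (by omega), Nat.add_sub_cancel_left]

theorem select_iff {β : Bool} {s : Expr (ZMod p) ι} (hs : BitEval v s β) (hA : DecEval v A a)
    (hB : DecEval v B b) :
    Holds v (select s A B x) ↔ DecEval v (x 0, x 1) (if β then a else b) := by
  unfold BitEval at hs
  simp only [select, holds_cons, holds_nil, and_true, Expr.eval_sub, Expr.eval_add, Expr.eval_mul,
    hs, hA.1, hA.2, hB.1, hB.2, DecEval, sub_eq_zero]
  cases β <;> simp

/-- Since `t * 2 ^ n ≤ t * 2 ^ w < p`, the relation `s = t * 2 ^ n` holds between integers. For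
counts outside `[1, 2 ^ w)` the normalization of `s` then makes the gadget unsatisfiable. -/
theorem ofNat_sound (hw : 1 ≤ w) (hp : 2 ^ (3 * w + 1) < p) {t : ℕ} {T : Expr (ZMod p) ι}
    (hT : T.eval v = (t : ZMod p)) (ht : t * 2 ^ w < p) (h : Holds v (ofNat w T x)) :
    ∃ c, Dec.ofNat w t = some c ∧ DecEval v (x 0, x 1) c := by
  simp only [ofNat, holds_append, holds_cons, holds_nil, and_true, Expr.eval_sub, Expr.eval_add,
    Expr.eval_mul, holds_exponentialCheck hw hp, holds_normalized hw, hT] at h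
  obtain ⟨⟨⟨hts, he⟩, n, hn, hxn, hmid, -⟩, s, hs, hxs, -⟩ := h
  have hsp : 2 ^ w ≤ 2 ^ (3 * w + 1) := Nat.pow_le_pow_right (by norm_num) (by omega)
  have hst : s = t * 2 ^ n := by
    refine natCast_inj_of_lt (p := p) ?_ (by have := hs.2; omega) ?_
    · push_cast
      rw [← hxs, ← hmid]
      linear_combination hts
    · exact lt_of_le_of_lt (Nat.mul_le_mul_left _ (Nat.pow_le_pow_right (by norm_num) hn)) ht
  refine ⟨_, ofNat_eq_some hw hn (hst ▸ hs.1) (hst ▸ hs.2), by rw [← hst]; exact hxs, ?_⟩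
  rw [hxn] at he
  push_cast
  linear_combination he

theorem ofNat_complete (hw : 1 ≤ w) (hp : 2 ^ (3 * w + 1) < p) {t : ℕ}
    (h : Dec.ofNat w t = some c) :
    ∃ g : ℕ → ZMod p, ∀ (ι : Type) (v : ι → ZMod p) (T : Expr (ZMod p) ι)
      (x : ℕ → Expr (ZMod p) ι), T.eval v = (t : ZMod p) →
      (∀ i < w + 2 * Nat.size w + 5, (x i).eval v = g i) →
      Holds v (ofNat w T x) ∧ DecEval v (x 0, x 1) c := by
  obtain ⟨n, hn, hc, hs⟩ := normal_of_ofNat h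
  have hcs : c.s = t * 2 ^ n := by rw [hc]
  have hce : c.e = -(n : ℤ) := by rw [hc]
  refine ⟨fun i => if i < 4 then [(c.s : ZMod p), (c.e : ZMod p), (n : ZMod p), 2 ^ n].getD i 0 else
    if i < 4 + w then digit p c.s (i - 4) else
    if i < 4 + w + Nat.size w then digit p n (i - (4 + w)) else
      digit p (w - n + 2 ^ Nat.size w) (i - (4 + w + Nat.size w)), ?_⟩
  intro ι v T x hT hx
  have hx' : ∀ i < 4, (x i).eval v =
      [(c.s : ZMod p), (c.e : ZMod p), (n : ZMod p), 2 ^ n].getD i 0 := fun i hi => by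
    rw [hx i (by omega)]
    exact if_pos hi
  have h0 : (x 0).eval v = (c.s : ZMod p) := hx' 0 (by norm_num)
  have h1 : (x 1).eval v = (c.e : ZMod p) := hx' 1 (by norm_num)
  have h2 : (x 2).eval v = (n : ZMod p) := hx' 2 (by norm_num)
  have h3 : (x 3).eval v = 2 ^ n := hx' 3 (by norm_num)
  refine ⟨?_, h0, h1⟩
  simp only [ofNat, holds_append, holds_cons, holds_nil, and_true, Expr.eval_sub, Expr.eval_add,
    Expr.eval_mul, holds_exponentialCheck hw hp, holds_normalized hw, hT, h0, h1, h2, h3]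
  refine ⟨⟨⟨?_, ?_⟩, n, hn, rfl, rfl, fun i hi => ?_, fun i hi => ?_⟩, c.s, hs, rfl, fun i hi => ?_⟩
  · rw [hcs]; push_cast; ring
  · rw [hce]; push_cast; ring
  · rw [hx _ (by omega)]
    beta_reduce
    rw [if_neg (by omega), if_neg (by omega), if_pos (by omega), Nat.add_sub_cancel_left]
  · rw [hx _ (by omega)]
    beta_reduce
    rw [if_neg (by omega), if_neg (by omega), if_neg (by omega)]
    congr 1
    omega
  · rw [hx _ (by omega)]
    beta_reduce
    rw [if_neg (by omega), if_pos (by omega), Nat.add_sub_cancel_left]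

/-- If `u = 0` the first equation gives `z = 1`; otherwise the second one gives `z = 0`, as there
are no zero divisors. -/
theorem isZero_sound {u z y : Expr (ZMod p) ι} (h : Holds v (isZero u z y)) :
    z.eval v = ((decide (u.eval v = 0)).toNat : ZMod p) := by
  simp only [isZero, holds_cons, holds_nil, and_true, Expr.eval_sub, Expr.eval_mul, eval_num,
    Nat.cast_one, mul_eq_zero] at h
  by_cases hu : u.eval v = 0
  · have := h.1
    rw [hu] at this
    simp only [hu, decide_true, Bool.toNat_true, Nat.cast_one]
    linear_combination this
  · simp [hu, h.2.resolve_left hu]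

theorem isZero_complete {u z y : Expr (ZMod p) ι}
    (hz : z.eval v = ((decide (u.eval v = 0)).toNat : ZMod p)) (hy : y.eval v = (u.eval v)⁻¹) :
    Holds v (isZero u z y) := by
  simp only [isZero, holds_cons, holds_nil, and_true, Expr.eval_sub, Expr.eval_mul, eval_num,
    Nat.cast_one, hz, hy]
  by_cases hu : u.eval v = 0
  · simp [hu]
  · simp [hu]

theorem beq_toNat (hp : 2 ^ (3 * w + 1) < p) (hA : DecEval v A a) (hB : DecEval v B b)
    (ha : a.Normal w) (hb : b.Normal w) (hab : |a.e - b.e| < p) :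
    ((decide ((A.1 - B.1).eval v = 0)).toNat : ZMod p) *
      ((decide ((A.2 - B.2).eval v = 0)).toNat : ZMod p) = ((a.beq b).toNat : ZMod p) := by
  have hwp : 2 ^ w < p :=
    (Nat.pow_le_pow_right (by norm_num) (show w ≤ 3 * w + 1 by omega)).trans_lt hp
  have e1 : (A.1 - B.1).eval v = 0 ↔ a.s = b.s := by
    rw [Expr.eval_sub, hA.1, hB.1, sub_eq_zero]
    exact ⟨fun h => natCast_inj_of_lt h (ha.2.trans hwp) (hb.2.trans hwp), fun h => by rw [h]⟩
  have e2 : (A.2 - B.2).eval v = 0 ↔ a.e = b.e := by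
    rw [Expr.eval_sub, hA.2, hB.2, sub_eq_zero]
    exact ⟨fun h => intCast_inj_of_lt h (by rwa [abs_sub_comm]), fun h => by rw [h]⟩
  simp only [e1, e2, Dec.beq]
  by_cases h1 : a.s = b.s <;> by_cases h2 : a.e = b.e <;> simp [h1, h2]

theorem equal_sound (hp : 2 ^ (3 * w + 1) < p) (hA : DecEval v A a) (hB : DecEval v B b)
    (ha : a.Normal w) (hb : b.Normal w) (hab : |a.e - b.e| < p) (h : Holds v (equal A B x)) :
    BitEval v (x 0) (a.beq b) := by
  simp only [equal, holds_append, holds_cons, holds_nil, and_true, Expr.eval_sub,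
    Expr.eval_mul] at h
  obtain ⟨⟨h1, h2⟩, h0⟩ := h
  rw [isZero_sound h1, isZero_sound h2, beq_toNat hp hA hB ha hb hab] at h0
  exact sub_eq_zero.1 h0

theorem equal_complete (hp : 2 ^ (3 * w + 1) < p) (ha : a.Normal w) (hb : b.Normal w)
    (hab : |a.e - b.e| < p) :
    ∃ g : ℕ → ZMod p, ∀ (ι : Type) (v : ι → ZMod p) (A B : Expr (ZMod p) ι × Expr (ZMod p) ι)
      (x : ℕ → Expr (ZMod p) ι), DecEval v A a → DecEval v B b →
      (∀ i < 5, (x i).eval v = g i) →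
      Holds v (equal A B x) ∧ BitEval v (x 0) (a.beq b) := by
  refine ⟨fun i => [((a.beq b).toNat : ZMod p),
    ((decide ((a.s : ZMod p) - b.s = 0)).toNat : ZMod p), ((a.s : ZMod p) - b.s)⁻¹,
    ((decide ((a.e : ZMod p) - b.e = 0)).toNat : ZMod p), ((a.e : ZMod p) - b.e)⁻¹].getD i 0, ?_⟩
  intro ι v A B x hA hB hx
  have h0 := hx 0 (by norm_num)
  refine ⟨?_, h0⟩
  have e1 : (A.1 - B.1).eval v = (a.s : ZMod p) - b.s := by rw [Expr.eval_sub, hA.1, hB.1]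
  have e2 : (A.2 - B.2).eval v = (a.e : ZMod p) - b.e := by rw [Expr.eval_sub, hA.2, hB.2]
  have hprod := beq_toNat hp hA hB ha hb hab
  have h1 : (x 1).eval v = ((decide ((A.1 - B.1).eval v = 0)).toNat : ZMod p) := by
    rw [hx 1 (by norm_num), e1]; rfl
  have h3 : (x 3).eval v = ((decide ((A.2 - B.2).eval v = 0)).toNat : ZMod p) := by
    rw [hx 3 (by norm_num), e2]; rfl
  simp only [equal, holds_append, holds_cons, holds_nil, and_true]
  refine ⟨⟨isZero_complete h1 ?_, isZero_complete h3 ?_⟩, ?_⟩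
  · rw [hx 2 (by norm_num), e1]; rfl
  · rw [hx 4 (by norm_num), e2]; rfl
  · rw [Expr.eval_sub, Expr.eval_mul, h1, h3, hprod, h0]
    exact sub_self _

/-- With `D` the difference of the integers `e * 2 ^ w + s`, both `D + 2 ^ (k + w)` and `t` lie in
`[0, 2 ^ (k + w + 1))`, which is shorter than `p`. So they agree, and the top digit of `t` is the
sign of `D`. -/
theorem lessEq_sound (hk : 2 ^ (w + k + 1) < p) (hA : DecEval v A a) (hB : DecEval v B b)
    (ha : a.Normal w) (hb : b.Normal w) (hab : |a.e - b.e| < 2 ^ k)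
    (h : Holds v (lessEq w k A B x)) : BitEval v (x (k + w)) (a.ble b) := by
  rw [lessEq, holds_compareBits] at h
  obtain ⟨t, ht, hxy, hx⟩ := h
  have hD := abs_lt.1 (abs_gap_lt ha hb hab)
  have hle := ble_iff ha hb
  set D := (b.e - a.e) * 2 ^ w + ((b.s : ℤ) - a.s) with hDdef
  have hDt : D + 2 ^ (k + w) = t := by
    refine intCast_inj_of_lt (p := p) ?_ ?_
    · simp only [Expr.eval_add, Expr.eval_mul, eval_num, hA.1, hA.2, hB.1, hB.2] at hxy
      rw [hDdef]
      push_cast at hxy ⊢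
      linear_combination hxy
    · rw [abs_lt]
      rw [show w + k + 1 = k + w + 1 by omega, pow_succ] at hk
      rw [pow_succ] at ht
      zify at hk ht
      constructor <;> linarith
  unfold BitEval
  rw [hx _ (by omega), digit]
  congr 2
  rw [Bool.eq_iff_iff, testBit_iff_le ht, hle]
  zify
  rw [← hDt]
  constructor <;> intro h <;> linarith

theorem lessEq_complete (ha : a.Normal w) (hb : b.Normal w) (hab : |a.e - b.e| < 2 ^ k) :
    ∃ g : ℕ → ZMod p, ∀ (ι : Type) (v : ι → ZMod p) (A B : Expr (ZMod p) ι × Expr (ZMod p) ι)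
      (x : ℕ → Expr (ZMod p) ι), DecEval v A a → DecEval v B b →
      (∀ i < k + w + 1, (x i).eval v = g i) →
      Holds v (lessEq w k A B x) ∧ BitEval v (x (k + w)) (a.ble b) := by
  have hD := abs_lt.1 (abs_gap_lt ha hb hab)
  have hle := ble_iff ha hb
  set D := (b.e - a.e) * 2 ^ w + ((b.s : ℤ) - a.s) with hDdef
  obtain ⟨t, ht⟩ : ∃ t : ℕ, (t : ℤ) = D + 2 ^ (k + w) :=
    ⟨(D + 2 ^ (k + w)).toNat, Int.toNat_of_nonneg (by linarith)⟩
  have htlt : t < 2 ^ (k + w + 1) := by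
    rw [pow_succ]
    zify
    linarith
  refine ⟨digit p t, fun ι v A B x hA hB hx => ⟨?_, ?_⟩⟩
  · rw [lessEq, holds_compareBits]
    refine ⟨t, htlt, ?_, hx⟩
    have : ((t : ℤ) : ZMod p) = ((D + 2 ^ (k + w) : ℤ) : ZMod p) := by rw [ht]
    simp only [Expr.eval_add, Expr.eval_mul, eval_num, hA.1, hA.2, hB.1, hB.2]
    rw [hDdef] at this
    push_cast at this ⊢
    rw [this]
    ring
  · unfold BitEval
    rw [hx _ (by omega), digit]
    congr 2
    rw [Bool.eq_iff_iff, testBit_iff_le htlt, hle]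
    zify
    rw [ht]
    constructor <;> intro h <;> linarith

end Gadget

section

open Gadget

/-! ### Honest results are admissible -/

/-- The remainder `r` satisfies `2 ^ (w - 1) * (r + 1) ≤ 2 ^ (w - 1 + θ) ≤ x + 2 ^ (w - 1)`, hence
`r ≤ δ x`. The other inequality is free, because rounding down never exceeds `x < 2 ^ (2 * w)`. -/
theorem rounds_of_floor {w x θ : ℕ} (hx : x < 2 ^ (2 * w))
    (h : 2 ^ (w - 1 + θ) ≤ x + 2 ^ (w - 1)) : Rounds w x ((x / 2 ^ θ * 2 ^ θ : ℕ) : ℚ) := by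
  rw [rounds_iff]
  have h1 := Nat.div_add_mod' x (2 ^ θ)
  have h2 := Nat.mod_lt x (Nat.two_pow_pos θ)
  have h3 : 2 ^ (w - 1) * (x / 2 ^ θ * 2 ^ θ) ≤ 2 ^ (w - 1) * x :=
    Nat.mul_le_mul_left _ (Nat.div_mul_le_self _ _)
  refine ⟨?_, by omega⟩
  rw [pow_add] at h
  have h4 : 2 ^ (w - 1) * (x % 2 ^ θ + 1) ≤ 2 ^ (w - 1) * 2 ^ θ := Nat.mul_le_mul_left _ h2
  have h5 : 2 ^ (w - 1) * x = 2 ^ (w - 1) * (x / 2 ^ θ * 2 ^ θ) + 2 ^ (w - 1) * (x % 2 ^ θ) := by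
    rw [← mul_add, h1]
  rw [mul_add] at h4
  omega

theorem div_normal {w x d : ℕ} (hd : 0 < d) (h1 : 2 ^ (w - 1) * d ≤ x) (h2 : x < 2 ^ w * d) :
    2 ^ (w - 1) ≤ x / d ∧ x / d < 2 ^ w :=
  ⟨(Nat.le_div_iff_mul_le hd).2 h1, (Nat.div_lt_iff_lt_mul hd).2 h2⟩

/-- The product of two normalized significands has `2 * w - 1` or `2 * w` bits, and `θ` cuts off all
but the leading `w`. -/
theorem mulRel_mul {w : ℕ} (hw : 1 ≤ w) {a b : Dec} (ha : a.Normal w) (hb : b.Normal w) :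
    MulRel w a b (Dec.mul w a b) := by
  have hlow : 2 ^ (w - 1) * 2 ^ (w - 1) ≤ a.s * b.s := Nat.mul_le_mul ha.1 hb.1
  have hup : a.s * b.s < 2 ^ (2 * w) := mul_lt_of_normal ha.2 hb.2.le
  have key : ∀ θ, (θ = w - 1 ∨ θ = w) → 2 ^ (w - 1 + θ) ≤ a.s * b.s → a.s * b.s < 2 ^ (w + θ) →
      MulRel w a b ⟨a.s * b.s / 2 ^ θ, a.e + b.e + θ⟩ := by
    intro θ hθ h1 h2
    refine ⟨div_normal (Nat.two_pow_pos θ) (by rwa [← pow_add]) (by rwa [← pow_add]), θ, hθ,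
      by simp, ?_⟩
    have := rounds_of_floor hup (h1.trans (Nat.le_add_right _ _))
    push_cast at this ⊢
    exact this
  unfold Dec.mul
  dsimp only
  split_ifs with h
  · refine key _ (Or.inl rfl) (by rwa [pow_add]) ?_
    rwa [show w + (w - 1) = 2 * w - 1 by omega]
  · refine key _ (Or.inr rfl) ?_ (by rwa [← two_mul])
    rw [show w - 1 + w = 2 * w - 1 by omega]
    omega

/-- The choice of `θ` puts `a.s * 2 ^ θ / b.s` into `[2 ^ (w - 1), 2 ^ w)`. The remainder is below
`b.s`, and `2 ^ (w - 1) * b.s ≤ a.s * 2 ^ θ` bounds the relative error. -/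
theorem divRel_div {w : ℕ} (hw : 1 ≤ w) {a b : Dec} (ha : a.Normal w) (hb : b.Normal w) :
    DivRel w a b (Dec.div w a b) := by
  have hbpos : 0 < b.s := (Nat.two_pow_pos _).trans_le hb.1
  have e : 2 ^ w = 2 * 2 ^ (w - 1) := by rw [← pow_succ', Nat.sub_add_cancel hw]
  have key : ∀ θ, (θ = w - 1 ∨ θ = w) → 2 ^ (w - 1) * b.s ≤ a.s * 2 ^ θ →
      a.s * 2 ^ θ < 2 ^ w * b.s → DivRel w a b ⟨a.s * 2 ^ θ / b.s, a.e - b.e - θ⟩ := by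
    intro θ hθ h1 h2
    refine ⟨div_normal hbpos h1 h2, θ, hθ, by simp, ?_⟩
    have hr : Rounds w ((a.s * 2 ^ θ : ℕ) : ℚ) ((a.s * 2 ^ θ / b.s * b.s : ℕ) : ℚ) := by
      rw [rounds_iff]
      have hX : a.s * 2 ^ θ < 2 ^ (2 * w) := mul_lt_of_normal ha.2 (pow_le_of_theta hθ)
      have h3 := Nat.div_add_mod' (a.s * 2 ^ θ) b.s
      have h4 := Nat.mod_lt (a.s * 2 ^ θ) hbpos
      have h5 : 2 ^ (w - 1) * (a.s * 2 ^ θ / b.s * b.s) ≤ 2 ^ (w - 1) * (a.s * 2 ^ θ) :=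
        Nat.mul_le_mul_left _ (Nat.div_mul_le_self _ _)
      refine ⟨?_, by omega⟩
      have h6 : 2 ^ (w - 1) * (a.s * 2 ^ θ) = 2 ^ (w - 1) * (a.s * 2 ^ θ / b.s * b.s) +
          2 ^ (w - 1) * (a.s * 2 ^ θ % b.s) := by rw [← mul_add, h3]
      have h7 : 2 ^ (w - 1) * (a.s * 2 ^ θ % b.s) ≤ 2 ^ (w - 1) * b.s :=
        Nat.mul_le_mul_left _ h4.le
      omega
    push_cast at hr ⊢
    exact hr
  unfold Dec.div
  dsimp only
  split_ifs with h
  · refine key _ (Or.inl rfl) (by rw [mul_comm]; exact Nat.mul_le_mul_right _ h) ?_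
    have h1 : a.s < 2 * b.s := by have := ha.2; have := hb.1; omega
    calc a.s * 2 ^ (w - 1) < 2 * b.s * 2 ^ (w - 1) :=
          Nat.mul_lt_mul_of_pos_right h1 (Nat.two_pow_pos _)
      _ = 2 ^ w * b.s := by rw [e]; ring
  · refine key _ (Or.inr rfl) ?_ ?_
    · rw [e]
      have h1 : b.s ≤ 2 * a.s := by have := hb.2; have := ha.1; omega
      calc 2 ^ (w - 1) * b.s ≤ 2 ^ (w - 1) * (2 * a.s) := Nat.mul_le_mul_left _ h1
        _ = _ := by ring
    · rw [mul_comm]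
      exact Nat.mul_lt_mul_of_pos_left (by omega) (Nat.two_pow_pos _)

theorem addCore_addCore {w : ℕ} (hw : 1 ≤ w) {a b : Dec} (ha : a.Normal w) (hb : b.Normal w)
    (hab : b.e ≤ a.e) (hle : a.e - b.e ≤ w) : AddCore w a b (Dec.addCore w a b) := by
  obtain ⟨l, hl⟩ : ∃ l : ℕ, a.e - b.e = l := ⟨(a.e - b.e).toNat, by omega⟩
  have hlw : l ≤ w := by omega
  have hx := aligned_lt hlw ha.2 hb.2
  have key : ∀ θ, (θ = l ∨ θ = l + 1) → 2 ^ (w - 1 + θ) ≤ a.s * 2 ^ l + b.s →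
      a.s * 2 ^ l + b.s < 2 ^ (w + θ) →
      AddCore w a b ⟨(a.s * 2 ^ l + b.s) / 2 ^ θ, b.e + θ⟩ := by
    intro θ hθ h1 h2
    refine ⟨div_normal (Nat.two_pow_pos θ) (by rwa [← pow_add]) (by rwa [← pow_add]), l, θ, hlw,
      hθ, by omega, by simp, ?_⟩
    have := rounds_of_floor hx (h1.trans (Nat.le_add_right _ _))
    push_cast at this ⊢
    exact this
  unfold Dec.addCore
  rw [hl, Int.toNat_natCast]
  dsimp only
  split_ifs with h
  · refine key _ (Or.inl rfl) ?_ h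
    rw [pow_add]
    exact (Nat.mul_le_mul_right _ ha.1).trans (Nat.le_add_right _ _)
  · refine key _ (Or.inr rfl) ?_ ?_
    · rw [show w - 1 + (l + 1) = w + l by omega]; omega
    -- A carry lengthens the sum by one bit at most: both summands are below `2 ^ (w + l)`.
    · have h1 : a.s * 2 ^ l ≤ (2 ^ w - 1) * 2 ^ l :=
        Nat.mul_le_mul_right _ (by have := ha.2; omega)
      have h2 : 2 ^ w ≤ 2 ^ (w + l) := Nat.pow_le_pow_right (by norm_num) (by omega)
      have h3 : (2 ^ w - 1) * 2 ^ l ≤ 2 ^ (w + l) := by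
        rw [pow_add]; exact Nat.mul_le_mul_right _ (Nat.sub_le _ _)
      have := hb.2
      rw [← add_assoc, pow_succ]
      omega

theorem addRel_add {w : ℕ} (hw : 1 ≤ w) {a b c : Dec} (ha : a.Normal w) (hb : b.Normal w)
    (h : Dec.add w a b = some c) : AddRel w a b c := by
  unfold Dec.add at h
  split_ifs at h with h1 h2
  · obtain rfl := Option.some.inj h
    rw [abs_le] at h1
    exact Or.inl (addCore_addCore hw ha hb h2 h1.2)
  · obtain rfl := Option.some.inj h
    rw [abs_le] at h1
    exact Or.inr (addCore_addCore hw hb ha (by omega) (by omega))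

/-! ### Invariants of an execution -/

/-- Positions out of range yield the default before and after, so the invariants can be stated for
all `i`, without a condition on the operands of an operation. -/
theorem getD_append_singleton {α : Type} (l : List α) (a d : α) (i : ℕ) :
    (l ++ [a]).getD i d = if i = l.length then a else l.getD i d := by
  rcases lt_trichotomy i l.length with h | h | h
  · rw [List.getD_append _ _ _ _ h, if_neg h.ne]
  · subst h; simp
  · rw [if_neg h.ne', List.getD_eq_default _ _ (by simpa using h),
      List.getD_eq_default _ _ h.le]

/-- All decimals are normalized, and their exponents obey the bounds. -/
structure Bounded (w : ℕ) (st : State) (acc : List ℕ × ℕ) : Prop where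
  length : acc.1.length = st.decs.length
  normal : ∀ i, (st.dec w i).Normal w
  abs_exp_le : ∀ i, |(st.dec w i).e| ≤ acc.1.getD i 0
  le : ∀ i, acc.1.getD i 0 ≤ acc.2

theorem State.dec_pushDec (w : ℕ) (st : State) (c : Dec) (i : ℕ) :
    (st.pushDec c).dec w i = if i = st.decs.length then c else st.dec w i :=
  getD_append_singleton _ _ _ _

theorem State.bit_pushBit (st : State) (b : Bool) (i : ℕ) :
    (st.pushBit b).bit i = if i = st.bits.length then b else st.bit i :=
  getD_append_singleton _ _ _ _

theorem Bounded.push {w : ℕ} {st : State} {acc : List ℕ × ℕ} (h : Bounded w st acc) {c : Dec}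
    {b B : ℕ} (hc : c.Normal w) (hb : |c.e| ≤ b) (hB : b ≤ B) :
    Bounded w (st.pushDec c) (acc.1 ++ [b], max acc.2 B) where
  length := by simp [State.pushDec, h.length]
  normal i := by
    rw [State.dec_pushDec]
    split_ifs
    · exact hc
    · exact h.normal i
  abs_exp_le i := by
    rw [State.dec_pushDec, getD_append_singleton, h.length]
    split_ifs
    · exact hb
    · exact h.abs_exp_le i
  le i := by
    rw [getD_append_singleton]
    split_ifs
    · exact le_max_of_le_right hB
    · exact le_max_of_le_left (h.le i)

theorem Bounded.pushBit {w : ℕ} {st : State} {acc : List ℕ × ℕ} (h : Bounded w st acc) (b : Bool) :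
    Bounded w (st.pushBit b) acc := ⟨h.length, h.normal, h.abs_exp_le, h.le⟩

variable {w E : ℕ}

theorem Instr.step_of_exec (hw : 1 ≤ w) {st st' : State} {acc : List ℕ × ℕ} (h : Bounded w st acc)
    (ins : Instr w E) (he : ins.exec st = some st') : ins.Step st st' := by
  cases ins with
  | add i j =>
    obtain ⟨c, hc, rfl⟩ := Option.map_eq_some_iff.1 he
    exact ⟨c, addRel_add hw (h.normal i) (h.normal j) hc, rfl⟩
  | mul i j => exact ⟨_, mulRel_mul hw (h.normal i) (h.normal j), (Option.some.inj he).symm⟩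
  | div i j => exact ⟨_, divRel_div hw (h.normal i) (h.normal j), (Option.some.inj he).symm⟩
  | _ => exact he

/-- The bounds must hold for every admissible result, not only for rounding down, because soundness
applies them to executions that come from an adversary's witness. -/
theorem Instr.bounded_step {st st' : State} {acc : List ℕ × ℕ} (h : Bounded w st acc)
    (ins : Instr w E) (hs : ins.Step st st') : Bounded w st' (TIAlg.bound acc ins) := by
  cases ins with
  | const c =>
    obtain rfl := Option.some.inj hs
    exact h.push c.normal c.range le_rfl
  | add i j =>
    obtain ⟨c, hc, rfl⟩ := hs
    have hi := abs_le.1 (h.abs_exp_le i)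
    have hj := abs_le.1 (h.abs_exp_le j)
    refine h.push ?_ ?_ le_rfl
    · rcases hc with hc | hc <;> exact hc.1
    · push_cast
      rw [abs_le]
      have h1 := le_max_left (acc.1.getD i 0 : ℤ) (acc.1.getD j 0)
      have h2 := le_max_right (acc.1.getD i 0 : ℤ) (acc.1.getD j 0)
      -- The exponent of a sum is the larger of the two exponents, or one more.
      rcases hc with ⟨-, l, θ, -, hθ, h3, h4, -⟩ | ⟨-, l, θ, -, hθ, h3, h4, -⟩ <;> omega
  | mul i j =>
    obtain ⟨c, ⟨hn, θ, hθ, he, -⟩, rfl⟩ := hs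
    have hi := abs_le.1 (h.abs_exp_le i)
    have hj := abs_le.1 (h.abs_exp_le j)
    refine h.push hn ?_ le_rfl
    push_cast
    rw [abs_le]
    omega
  | div i j =>
    obtain ⟨c, ⟨hn, θ, hθ, he, -⟩, rfl⟩ := hs
    have hi := abs_le.1 (h.abs_exp_le i)
    have hj := abs_le.1 (h.abs_exp_le j)
    refine h.push hn ?_ le_rfl
    push_cast
    rw [abs_le]
    omega
  | sel b i j =>
    obtain rfl := Option.some.inj hs
    refine h.push ?_ ?_ le_rfl
    · split_ifs <;> exact h.normal _
    · push_cast
      split_ifs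
      · exact (h.abs_exp_le i).trans (le_max_left _ _)
      · exact (h.abs_exp_le j).trans (le_max_right _ _)
  | count l =>
    obtain ⟨c, hc, rfl⟩ := Option.map_eq_some_iff.1 hs
    obtain ⟨n, hn, hce, hcn⟩ := normal_of_ofNat hc
    refine h.push hcn ?_ (le_max_left _ _)
    rw [hce, abs_neg, Nat.abs_cast]
    exact_mod_cast hn
  | eq i j => obtain rfl := Option.some.inj hs; exact h.pushBit _
  | le i j => obtain rfl := Option.some.inj hs; exact h.pushBit _
  | not b => obtain rfl := Option.some.inj hs; exact h.pushBit _

theorem steps_of_exec (hw : 1 ≤ w) (code : List (Instr w E)) {st st' : State} {acc : List ℕ × ℕ}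
    (h : Bounded w st acc) (he : exec code st = some st') : Steps code st st' := by
  induction code generalizing st acc with
  | nil => exact (Option.some.inj he).symm
  | cons ins code ih =>
    obtain ⟨st₁, h1, h2⟩ := Option.bind_eq_some_iff.1 he
    have hs := ins.step_of_exec hw h h1
    exact ⟨st₁, hs, ih (ins.bounded_step h hs) h2⟩

theorem bounded_steps (code : List (Instr w E)) {st st' : State} {acc : List ℕ × ℕ}
    (h : Bounded w st acc) (hs : Steps code st st') :
    Bounded w st' (code.foldl TIAlg.bound acc) := by
  induction code generalizing st acc with
  | nil => cases hs; exact h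
  | cons ins code ih =>
    obtain ⟨st₁, h1, h2⟩ := hs
    exact ih (ins.bounded_step h h1) h2

theorem le_bound (acc : List ℕ × ℕ) (ins : Instr w E) : acc.2 ≤ (TIAlg.bound acc ins).2 := by
  cases ins <;> simp [TIAlg.bound]

theorem le_foldl_bound (code : List (Instr w E)) (acc : List ℕ × ℕ) :
    acc.2 ≤ (code.foldl TIAlg.bound acc).2 := by
  induction code generalizing acc with
  | nil => exact le_rfl
  | cons ins code ih => exact (le_bound acc ins).trans (ih _)

/-! ### Compiled programs -/

variable {p : ℕ}

/-- The wires carry the values computed so far. -/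
structure Carries (w : ℕ) (v : Wire → ZMod p) (L : Layout p) (st : State) : Prop where
  length_decs : L.decs.length = st.decs.length
  length_bits : L.bits.length = st.bits.length
  dec : ∀ i, DecEval v (L.dec w i) (st.dec w i)
  bit : ∀ i, BitEval v (L.bit i) (st.bit i)

theorem Carries.pushDec {v : Wire → ZMod p} {L : Layout p} {st : State} (h : Carries w v L st)
    {c : Dec} {a : ℕ → Expr (ZMod p) Wire} (len : ℕ) (hc : DecEval v (a 0, a 1) c) :
    Carries w v (L.pushDec a len) (st.pushDec c) where
  length_decs := by simp [Layout.pushDec, State.pushDec, h.length_decs]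
  length_bits := h.length_bits
  dec i := by
    rw [State.dec_pushDec, Layout.dec, Layout.pushDec, getD_append_singleton, h.length_decs]
    split_ifs
    · exact hc
    · exact h.dec i
  bit := h.bit

theorem Carries.pushBit {v : Wire → ZMod p} {L : Layout p} {st : State} (h : Carries w v L st)
    {β : Bool} {b : Expr (ZMod p) Wire} (len : ℕ) (hb : BitEval v b β) :
    Carries w v (L.pushBit b len) (st.pushBit β) where
  length_decs := h.length_decs
  length_bits := by simp [Layout.pushBit, State.pushBit, h.length_bits]
  dec := h.dec
  bit i := by
    rw [State.bit_pushBit, Layout.bit, Layout.pushBit, getD_append_singleton, h.length_bits]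
    split_ifs
    · exact hb
    · exact h.bit i

theorem Carries.eval_sum {v : Wire → ZMod p} {L : Layout p} {st : State} (h : Carries w v L st)
    (l : List ℕ) :
    (Expr.sum (l.map fun i => L.bit i)).eval v = (st.count l : ZMod p) := by
  rw [Expr.eval_sum, State.count]
  induction l with
  | nil => simp
  | cons i l ih =>
    have := h.bit i
    unfold BitEval at this
    simp only [List.map_cons, List.sum_cons, ih, this]
    cases hb : st.bit i <;> simp [hb, add_comm]

/-- The bounds on the parameters under which the gadgets are correct: the field is large enough, and
`k` bits are enough for differences of exponents of absolute value at most `M`. -/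
structure Large (p w k M : ℕ) : Prop where
  one_le : 1 ≤ w
  cube : 2 ^ (3 * w + 1) < p
  size : 2 ^ (w + k + 1) < p
  width : 2 * M < 2 ^ k

variable {k M : ℕ}

theorem Large.two_pow_lt (h : Large p w k M) : 2 ^ k < p :=
  (Nat.pow_le_pow_right (by norm_num) (by omega)).trans_lt h.size

theorem Bounded.abs_sub_lt {st : State} {acc : List ℕ × ℕ} (h : Bounded w st acc)
    (hL : Large p w k M) (hM : acc.2 ≤ M) (i j : ℕ) :
    |(st.dec w i).e - (st.dec w j).e| < 2 ^ k := by
  have hi := abs_le.1 (h.abs_exp_le i)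
  have hj := abs_le.1 (h.abs_exp_le j)
  have h1 := h.le i
  have h2 := h.le j
  have := hL.width
  zify at this h1 h2 hM
  rw [abs_lt]
  constructor <;> linarith

theorem Bounded.abs_sub_lt_p {st : State} {acc : List ℕ × ℕ} (h : Bounded w st acc)
    (hL : Large p w k M) (hM : acc.2 ≤ M) (i j : ℕ) :
    |(st.dec w i).e - (st.dec w j).e| < p :=
  (h.abs_sub_lt hL hM i j).trans (by exact_mod_cast hL.two_pow_lt)

/-- The magnitude also bounds the number of bits counted, so a counter shifted by `w` bits stays
below `2 ^ (w + k)`. -/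
theorem count_mul_lt (hL : Large p w k M) {st : State} {l : List ℕ} (hl : l.length ≤ M) :
    st.count l * 2 ^ w < p := by
  have h1 : st.count l ≤ l.length := List.countP_le_length
  have h2 := hL.width
  calc st.count l * 2 ^ w ≤ 2 ^ k * 2 ^ w := Nat.mul_le_mul_right _ (by omega)
    _ = 2 ^ (w + k) := by rw [← pow_add, add_comm]
    _ < 2 ^ (w + k + 1) := Nat.pow_lt_pow_right (by norm_num) (by omega)
    _ < p := hL.size

/-- The number of auxiliary wires of an operation. -/
def Instr.auxLen (k : ℕ) : Instr w E → ℕ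
  | .const _ => 2
  | .add _ _ => 3 * w + 2 * Nat.size w + k + 13
  | .mul _ _ => 3 * w + 4
  | .div _ _ => 3 * w + 4
  | .sel _ _ _ => 2
  | .count _ => w + 2 * Nat.size w + 5
  | .eq _ _ => 5
  | .le _ _ => k + w + 1
  | .not _ => 1

theorem Instr.next_compile (ins : Instr w E) (blk : ℕ) (L : Layout p) :
    (ins.compile k blk L).1.next = L.next + ins.auxLen k := by
  cases ins <;> rfl

/-- The number of auxiliary wires of a program. -/
def auxLen (k : ℕ) (code : List (Instr w E)) : ℕ := (code.map fun ins => ins.auxLen k).sum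

theorem next_compile (code : List (Instr w E)) (blk : ℕ) (L : Layout p) :
    (compile k blk code L).1.next = L.next + auxLen k code := by
  induction code generalizing L with
  | nil => rfl
  | cons ins code ih =>
    simp only [compile, ih, Instr.next_compile, auxLen, List.map_cons, List.sum_cons, add_assoc]

variable [Fact p.Prime]

/-- The auxiliary wires that are still free. -/
def auxWire (blk : ℕ) (L : Layout p) (i : ℕ) : Expr (ZMod p) Wire := .wire (.wit blk (L.next + i))

/-- Wires determine values only modulo `p`. The bounds on the current state make each gadget exact,
and the new state is an honest object over the integers, to which `Instr.bounded_step` applies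
again. -/
theorem Instr.compile_sound (hL : Large p w k M) {st : State} {acc : List ℕ × ℕ}
    (h : Bounded w st acc) (ins : Instr w E) (hM : (TIAlg.bound acc ins).2 ≤ M) {blk : ℕ}
    {L : Layout p} {v : Wire → ZMod p} (hv : Carries w v L st)
    (hc : Holds v (ins.compile k blk L).2) :
    ∃ st', ins.Step st st' ∧ Carries w v (ins.compile k blk L).1 st' := by
  have hM' := (le_bound acc ins).trans hM
  cases ins with
  | const c =>
    refine ⟨_, rfl, hv.pushDec (a := auxWire blk L) _ ?_⟩
    simp only [Instr.compile, holds_cons, holds_nil, and_true, Expr.eval_sub, sub_eq_zero] at hc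
    exact hc
  | add i j =>
    obtain ⟨c, hr, hx⟩ := floatAdd_sound (x := auxWire blk L) hL.one_le hL.cube hL.size (hv.dec i) (hv.dec j)
      (h.normal i) (h.normal j) (h.abs_sub_lt hL hM' i j) hc
    exact ⟨_, ⟨c, hr, rfl⟩, hv.pushDec (a := auxWire blk L) _ hx⟩
  | mul i j =>
    obtain ⟨c, hr, hx⟩ := floatMul_sound (x := auxWire blk L) hL.one_le hL.cube (hv.dec i) (hv.dec j)
      (h.normal i) (h.normal j) hc
    exact ⟨_, ⟨c, hr, rfl⟩, hv.pushDec (a := auxWire blk L) _ hx⟩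
  | div i j =>
    obtain ⟨c, hr, hx⟩ := floatDiv_sound (x := auxWire blk L) hL.one_le hL.cube (hv.dec i) (hv.dec j)
      (h.normal i) (h.normal j) hc
    exact ⟨_, ⟨c, hr, rfl⟩, hv.pushDec (a := auxWire blk L) _ hx⟩
  | sel b i j =>
    exact ⟨_, rfl, hv.pushDec (a := auxWire blk L) _ ((select_iff (x := auxWire blk L) (hv.bit b) (hv.dec i) (hv.dec j)).1 hc)⟩
  | count l =>
    have hl : l.length ≤ M := by
      simp only [TIAlg.bound] at hM
      exact ((le_max_right _ _).trans (le_max_right _ _)).trans hM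
    obtain ⟨c, hr, hx⟩ := ofNat_sound (x := auxWire blk L) hL.one_le hL.cube (hv.eval_sum l) (count_mul_lt hL hl) hc
    exact ⟨_, Option.map_eq_some_iff.2 ⟨c, hr, rfl⟩, hv.pushDec (a := auxWire blk L) _ hx⟩
  | eq i j =>
    exact ⟨_, rfl, hv.pushBit _ (equal_sound (x := auxWire blk L) hL.cube (hv.dec i) (hv.dec j) (h.normal i)
      (h.normal j) (h.abs_sub_lt_p hL hM' i j) hc)⟩
  | le i j =>
    exact ⟨_, rfl, hv.pushBit _ (lessEq_sound (x := auxWire blk L) hL.size (hv.dec i) (hv.dec j) (h.normal i)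
      (h.normal j) (h.abs_sub_lt hL hM' i j) hc)⟩
  | not b =>
    refine ⟨_, rfl, hv.pushBit _ ?_⟩
    simp only [Instr.compile, holds_cons, holds_nil, and_true, Expr.eval_sub, sub_eq_zero] at hc
    have := hv.bit b
    unfold BitEval at this ⊢
    rw [hc, this]
    cases st.bit b <;> simp

theorem Instr.compile_complete (hL : Large p w k M) {st st' : State} {acc : List ℕ × ℕ}
    (h : Bounded w st acc) (ins : Instr w E) (hM : acc.2 ≤ M) (hs : ins.Step st st') :
    ∃ g : ℕ → ZMod p, ∀ (blk : ℕ) (L : Layout p) (v : Wire → ZMod p), Carries w v L st →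
      (∀ i < ins.auxLen k, v (.wit blk (L.next + i)) = g i) →
      Holds v (ins.compile k blk L).2 ∧ Carries w v (ins.compile k blk L).1 st' := by
  cases ins with
  | const c =>
    obtain rfl := Option.some.inj hs
    refine ⟨fun i => if i = 0 then (c.val.s : ZMod p) else (c.val.e : ZMod p),
      fun blk L v hv hg => ?_⟩
    have h0 := hg 0 (by norm_num [auxLen])
    have h1 := hg 1 (by norm_num [auxLen])
    refine ⟨?_, hv.pushDec (a := auxWire blk L) _ ⟨h0, h1⟩⟩
    simp only [Instr.compile, holds_cons, holds_nil, and_true, Expr.eval_sub, sub_eq_zero]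
    exact ⟨h0, h1⟩
  | add i j =>
    obtain ⟨c, hr, rfl⟩ := hs
    obtain ⟨g, hg⟩ := floatAdd_complete hL.one_le hL.cube (h.normal i) (h.normal j)
      (h.abs_sub_lt hL hM i j) hr
    refine ⟨g, fun blk L v hv hx => ?_⟩
    obtain ⟨h1, h2⟩ := hg _ v _ _ (auxWire blk L) (hv.dec i) (hv.dec j) hx
    exact ⟨h1, hv.pushDec (a := auxWire blk L) _ h2⟩
  | mul i j =>
    obtain ⟨c, hr, rfl⟩ := hs
    obtain ⟨g, hg⟩ := floatMul_complete hL.one_le hL.cube (h.normal i) (h.normal j) hr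
    refine ⟨g, fun blk L v hv hx => ?_⟩
    obtain ⟨h1, h2⟩ := hg _ v _ _ (auxWire blk L) (hv.dec i) (hv.dec j) hx
    exact ⟨h1, hv.pushDec (a := auxWire blk L) _ h2⟩
  | div i j =>
    obtain ⟨c, hr, rfl⟩ := hs
    obtain ⟨g, hg⟩ := floatDiv_complete hL.one_le hL.cube (h.normal i) (h.normal j) hr
    refine ⟨g, fun blk L v hv hx => ?_⟩
    obtain ⟨h1, h2⟩ := hg _ v _ _ (auxWire blk L) (hv.dec i) (hv.dec j) hx
    exact ⟨h1, hv.pushDec (a := auxWire blk L) _ h2⟩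
  | sel b i j =>
    obtain rfl := Option.some.inj hs
    let c : Dec := if st.bit b then st.dec w i else st.dec w j
    refine ⟨fun i => if i = 0 then (c.s : ZMod p) else (c.e : ZMod p), fun blk L v hv hg => ?_⟩
    have h0 := hg 0 (by norm_num [auxLen])
    have h1 := hg 1 (by norm_num [auxLen])
    exact ⟨(select_iff (x := auxWire blk L) (hv.bit b) (hv.dec i) (hv.dec j)).2 ⟨h0, h1⟩, hv.pushDec (a := auxWire blk L) _ ⟨h0, h1⟩⟩
  | count l =>
    obtain ⟨c, hc, rfl⟩ := Option.map_eq_some_iff.1 hs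
    obtain ⟨g, hg⟩ := ofNat_complete hL.one_le hL.cube hc
    refine ⟨g, fun blk L v hv hx => ?_⟩
    obtain ⟨h1, h2⟩ := hg _ v _ (auxWire blk L) (hv.eval_sum l) hx
    exact ⟨h1, hv.pushDec (a := auxWire blk L) _ h2⟩
  | eq i j =>
    obtain rfl := Option.some.inj hs
    obtain ⟨g, hg⟩ := equal_complete hL.cube (h.normal i) (h.normal j) (h.abs_sub_lt_p hL hM i j)
    refine ⟨g, fun blk L v hv hx => ?_⟩
    obtain ⟨h1, h2⟩ := hg _ v _ _ (auxWire blk L) (hv.dec i) (hv.dec j) hx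
    exact ⟨h1, hv.pushBit _ h2⟩
  | le i j =>
    obtain rfl := Option.some.inj hs
    obtain ⟨g, hg⟩ := lessEq_complete (p := p) (h.normal i) (h.normal j) (h.abs_sub_lt hL hM i j)
    refine ⟨g, fun blk L v hv hx => ?_⟩
    obtain ⟨h1, h2⟩ := hg _ v _ _ (auxWire blk L) (hv.dec i) (hv.dec j) hx
    exact ⟨h1, hv.pushBit _ h2⟩
  | not b =>
    obtain rfl := Option.some.inj hs
    refine ⟨fun _ => ((!st.bit b).toNat : ZMod p), fun blk L v hv hg => ?_⟩
    have h0 := hg 0 (by norm_num [auxLen])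
    refine ⟨?_, hv.pushBit _ h0⟩
    simp only [Instr.compile, holds_cons, holds_nil, and_true, Expr.eval_sub, sub_eq_zero, eval_num]
    refine h0.trans ?_
    have := hv.bit b
    unfold BitEval at this
    rw [this]
    cases st.bit b <;> simp

theorem compile_sound (hL : Large p w k M) (code : List (Instr w E)) {st : State}
    {acc : List ℕ × ℕ} (h : Bounded w st acc) (hM : (code.foldl TIAlg.bound acc).2 ≤ M) {blk : ℕ}
    {L : Layout p} {v : Wire → ZMod p} (hv : Carries w v L st)
    (hc : Holds v (compile k blk code L).2) :
    ∃ st', Steps code st st' ∧ Carries w v (compile k blk code L).1 st' := by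
  induction code generalizing st acc L with
  | nil => exact ⟨st, rfl, hv⟩
  | cons ins code ih =>
    obtain ⟨h1, h2⟩ := holds_append.1 hc
    obtain ⟨st₁, hs, hv₁⟩ := ins.compile_sound hL h ((le_foldl_bound code _).trans hM) hv h1
    obtain ⟨st', hs', hv'⟩ := ih (ins.bounded_step h hs) hM hv₁ h2
    exact ⟨st', ⟨st₁, hs, hs'⟩, hv'⟩

theorem compile_complete (hL : Large p w k M) (code : List (Instr w E)) {st st' : State}
    {acc : List ℕ × ℕ} (h : Bounded w st acc) (hM : (code.foldl TIAlg.bound acc).2 ≤ M)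
    (hs : Steps code st st') :
    ∃ g : ℕ → ZMod p, ∀ (blk : ℕ) (L : Layout p) (v : Wire → ZMod p), Carries w v L st →
      (∀ i < auxLen k code, v (.wit blk (L.next + i)) = g i) →
      Holds v (compile k blk code L).2 ∧ Carries w v (compile k blk code L).1 st' := by
  induction code generalizing st acc with
  | nil =>
    cases hs
    exact ⟨fun _ => 0, fun blk L v hv _ => ⟨holds_nil, hv⟩⟩
  | cons ins code ih =>
    obtain ⟨st₁, hs₁, hs₂⟩ := hs
    obtain ⟨g₁, hg₁⟩ := ins.compile_complete (p := p) hL h ((le_foldl_bound (ins :: code) _).trans hM) hs₁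
    obtain ⟨g₂, hg₂⟩ := ih (acc := TIAlg.bound acc ins) (ins.bounded_step h hs₁) hM hs₂
    -- The free wires are consumed from the left: the first operation takes its share, and the
    -- remaining code sees the rest with shifted index.
    refine ⟨fun i => if i < ins.auxLen k then g₁ i else g₂ (i - ins.auxLen k),
      fun blk L v hv hx => ?_⟩
    have e : auxLen k (ins :: code) = ins.auxLen k + auxLen k code := by simp [auxLen]
    obtain ⟨h1, hv₁⟩ := hg₁ blk L v hv fun i hi => by
      rw [hx i (by omega)]; exact if_pos hi
    obtain ⟨h2, hv₂⟩ := hg₂ blk _ v hv₁ fun i hi => by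
      rw [Instr.next_compile, add_assoc, hx _ (by omega)]
      beta_reduce
      rw [if_neg (by omega), Nat.add_sub_cancel_left]
    exact ⟨holds_append.2 ⟨h1, h2⟩, hv₂⟩

end

open Gadget

/-! ### Vectors of field elements -/

section lists

theorem getD_flatMap_pair {α F : Type} (f g : α → F) (d : F) (l : List α) (i : ℕ)
    (hi : i < l.length) :
    (l.flatMap fun x => [f x, g x]).getD (2 * i) d = f l[i] ∧
      (l.flatMap fun x => [f x, g x]).getD (2 * i + 1) d = g l[i] := by
  induction l generalizing i with
  | nil => simp at hi
  | cons a l ih =>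
    cases i with
    | zero => simp
    | succ i =>
      have := ih i (by simpa using hi)
      simpa [List.flatMap_cons, mul_add] using this

theorem forall₂_getD {α β : Type} {R : α → β → Prop} {l : List α} {l' : List β} {d : α} {d' : β}
    (h : List.Forall₂ R l l') (hd : R d d') (i : ℕ) : R (l.getD i d) (l'.getD i d') := by
  induction h generalizing i with
  | nil => simpa using hd
  | cons hab _ ih =>
    cases i with
    | zero => simpa using hab
    | succ i => simpa using ih i

theorem forall₂_append {α β : Type} {R : α → β → Prop} {l₁ l₂ : List α} {l₁' l₂' : List β}
    (h₁ : List.Forall₂ R l₁ l₁') (h₂ : List.Forall₂ R l₂ l₂') :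
    List.Forall₂ R (l₁ ++ l₂) (l₁' ++ l₂') := by
  induction h₁ with
  | nil => exact h₂
  | cons hab _ ih => exact .cons hab ih

theorem forall₂_map_ofFn {α β : Type} {R : α → β → Prop} {n : ℕ} {f : ℕ → α} {g : Fin n → β}
    (h : ∀ i : Fin n, R (f i) (g i)) : List.Forall₂ R ((List.range n).map f) (List.ofFn g) := by
  rw [List.ofFn_eq_map, ← List.map_coe_finRange_eq_range, List.map_map, List.forall₂_map_left_iff,
    List.forall₂_map_right_iff, List.forall₂_same]
  exact fun i _ => h i

theorem forall₂_flatMap_flatten {α β : Type} {R : α → β → Prop} {n : ℕ} {f : ℕ → List α}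
    {g : Fin n → List β} (h : ∀ i : Fin n, List.Forall₂ R (f i) (g i)) :
    List.Forall₂ R ((List.range n).flatMap f) (List.ofFn g).flatten := by
  rw [List.flatMap]
  have H := forall₂_map_ofFn (R := List.Forall₂ R) h
  generalize (List.range n).map f = l, List.ofFn g = l' at H
  induction H with
  | nil => exact .nil
  | cons hab _ ih => exact forall₂_append hab ih

theorem getD_append_left {α : Type} {l l' : List α} {i : ℕ} (h : i < l.length) (d : α) :
    (l ++ l').getD i d = l.getD i d := List.getD_append _ _ _ _ h

theorem getD_append_add {α : Type} {l l' : List α} {k : ℕ} (h : l.length = k) (i : ℕ) (d : α) :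
    (l ++ l').getD (k + i) d = l'.getD i d := by
  rw [List.getD_append_right _ _ _ _ (by omega), ← h, Nat.add_sub_cancel_left]

theorem getD_ofFn {α : Type} {n : ℕ} (f : Fin n → α) (i : Fin n) (d : α) :
    (List.ofFn f).getD i d = f i := by
  rw [List.getD_eq_getElem _ _ (by simp), List.getElem_ofFn]

end lists

section

variable {p w E n : ℕ}

theorem FVec.length_toField (v : FVec p w E n) : v.toField.length = 2 * n := by
  simp [FVec.toField, List.length_flatMap, List.sum_ofFn, mul_comm]

theorem FVec.getD_toField (v : FVec p w E n) (i : Fin n) :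
    v.toField.getD (2 * i) 0 = ((v i).val.s : ZMod p) ∧
      v.toField.getD (2 * i + 1) 0 = ((v i).val.e : ZMod p) := by
  have := getD_flatMap_pair (fun x : Flt w E => (x.val.s : ZMod p)) (fun x => (x.val.e : ZMod p)) 0
    (List.ofFn fun i : Fin n => v i) i (by simp)
  rw [List.getElem_ofFn] at this
  exact this

/-- Normalized decimals with close exponents are determined by their residues. It serves for the
outputs of the circuit and for the injectivity of encodings. -/
theorem dec_eq_of_cast {a b : Dec} (ha : a.Normal w) (hb : b.Normal w) (hp : 2 ^ w < p)
    (hab : |b.e - a.e| < p) (hs : (a.s : ZMod p) = b.s) (he : (a.e : ZMod p) = b.e) : a = b := by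
  have h1 := natCast_inj_of_lt hs (ha.2.trans hp) (hb.2.trans hp)
  have h2 := intCast_inj_of_lt he hab
  cases a
  cases b
  simp_all

end

/-- The list of the entries of all parties. -/
def parts {p m : ℕ} (c : Party p m) : Blocks (ZMod p) := List.ofFn c.1 ++ [c.2]

section parts

variable {p m : ℕ}

theorem length_parts (c : Party p m) : (parts c).length = m + 1 := by simp [parts]

theorem getD_parts (c : Party p m) (j : Fin m) : (parts c).getD j [] = c.1 j := by
  rw [parts, getD_append_left (by simp), getD_ofFn]

theorem getD_parts_last (c : Party p m) : (parts c).getD m [] = c.2 := by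
  rw [parts]
  exact getD_append_add (k := m) (by simp) 0 []

end parts

/-! ### Inputs and outputs of the algorithm on the wires of the circuit. -/

namespace TIAlg

variable {p w E m n h : ℕ}

/-- The messages to which the parties commit. -/
def messages (V : Fin m → FVec p w E n) (Vs : FVec p w E n) : Party p m :=
  (fun j => (V j).toField, Vs.toField)

theorem publicInput_eq (c : Party p m) (Q : FVec p w E m) (η : FVec p w E h) :
    publicInput c Q η = parts c ++ [Q.toField, η.toField] := by
  simp [publicInput, parts]

theorem witness_eq (V : Fin m → FVec p w E n) (Vs : FVec p w E n) (r a : Party p m)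
    (b : List (ZMod p)) :
    witness V Vs r a b = parts (messages V Vs) ++ (parts r ++ (parts a ++ [b])) := by
  simp [witness, parts, messages]

/-- The wires carry the answers, the inferred truth, the qualities and the prior factors. -/
structure CarriesInput (v : Wire → ZMod p) (V : Fin m → FVec p w E n) (Vs : FVec p w E n)
    (Q : FVec p w E m) (η : FVec p w E h) : Prop where
  answer : ∀ (j : Fin m) (i : ℕ), v (.wit j i) = (V j).toField.getD i 0
  truth : ∀ i : ℕ, v (.wit m i) = Vs.toField.getD i 0
  qual : ∀ i : ℕ, v (.pub (m + 1) i) = Q.toField.getD i 0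
  prior : ∀ i : ℕ, v (.pub (m + 2) i) = η.toField.getD i 0

/-- Only the first `m + 1` blocks of the witness are constrained. This covers the honest witness and
one returned by an extractor. -/
theorem carriesInput_of_parts {V : Fin m → FVec p w E n} {Vs : FVec p w E n} (c : Party p m)
    {Q : FVec p w E m} {η : FVec p w E h} {y : Blocks (ZMod p)}
    (hy : ∀ j < m + 1, y.getD j [] = (parts (messages V Vs)).getD j []) :
    CarriesInput (assign (publicInput c Q η) y) V Vs Q η where
  answer j i := by
    rw [assign, hy j (by omega), getD_parts]; rfl
  truth i := by
    rw [assign, hy m (by omega), getD_parts_last]; rfl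
  qual i := by
    rw [assign, publicInput_eq]
    exact congrArg (fun l => List.getD l i 0) (getD_append_add (length_parts c) 0 [])
  prior i := by
    rw [assign, publicInput_eq]
    exact congrArg (fun l => List.getD l i 0) (getD_append_add (length_parts c) 1 [])

theorem getD_witness_message {V : Fin m → FVec p w E n} {Vs : FVec p w E n} {r a : Party p m}
    {b : List (ZMod p)} {j : ℕ} (hj : j < m + 1) :
    (witness V Vs r a b).getD j [] = (parts (messages V Vs)).getD j [] := by
  rw [witness_eq, getD_append_left (by rwa [length_parts])]

theorem getD_witness_rnd {V : Fin m → FVec p w E n} {Vs : FVec p w E n} {r a : Party p m}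
    {b : List (ZMod p)} {j : ℕ} (hj : j < m + 1) :
    (witness V Vs r a b).getD (m + 1 + j) [] = (parts r).getD j [] := by
  rw [witness_eq, getD_append_add (length_parts _), getD_append_left (by rwa [length_parts])]

theorem getD_witness_aux {V : Fin m → FVec p w E n} {Vs : FVec p w E n} {r a : Party p m}
    {b : List (ZMod p)} {j : ℕ} (hj : j < m + 1) :
    (witness V Vs r a b).getD (2 * (m + 1) + j) [] = (parts a).getD j [] := by
  rw [witness_eq, two_mul, add_assoc, getD_append_add (length_parts _),
    getD_append_add (length_parts _), getD_append_left (by rwa [length_parts])]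

theorem getD_witness_alg {V : Fin m → FVec p w E n} {Vs : FVec p w E n} {r a : Party p m}
    {b : List (ZMod p)} : (witness V Vs r a b).getD (3 * (m + 1)) [] = b := by
  rw [witness_eq, show 3 * (m + 1) = m + 1 + (m + 1 + (m + 1 + 0)) by ring,
    getD_append_add (length_parts _), getD_append_add (length_parts _),
    getD_append_add (length_parts _)]
  rfl

theorem carries_init {v : Wire → ZMod p} {V : Fin m → FVec p w E n}
    {Vs : FVec p w E n} {Q : FVec p w E m} {η : FVec p w E h} (hv : CarriesInput v V Vs Q η) :
    Carries w v (layout p m n h) (init V η) := by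
  have key : List.Forall₂ (DecEval v) (layout p m n h).decs (init V η).decs := by
    refine forall₂_append (forall₂_flatMap_flatten fun j => forall₂_map_ofFn fun i => ?_)
      (forall₂_map_ofFn fun i => ?_)
    · exact ⟨(hv.answer j _).trans ((V j).getD_toField i).1,
        (hv.answer j _).trans ((V j).getD_toField i).2⟩
    · exact ⟨(hv.prior _).trans (η.getD_toField i).1, (hv.prior _).trans (η.getD_toField i).2⟩
  -- The default wires of the layout evaluate to the default values of the state, so positions out
  -- of range agree as well.
  refine ⟨key.length_eq, rfl, fun i => forall₂_getD key ⟨?_, ?_⟩ i, fun i => ?_⟩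
  · simp
  · simp
  · simp [BitEval, Layout.bit, State.bit, layout, init]

theorem bounded_init (hw : 1 ≤ w) (V : Fin m → FVec p w E n) (η : FVec p w E h) :
    Bounded w (init V η) (List.replicate (m * n + h) E, E) := by
  have hlen : (init V η).decs.length = m * n + h := by
    simp [init, List.length_flatten, List.map_ofFn, Function.comp_def]
  have hmem : ∀ d ∈ (init V η).decs, d.Normal w ∧ |d.e| ≤ E := by
    intro d hd
    simp only [init, List.mem_append, List.mem_flatten, List.mem_ofFn] at hd
    rcases hd with ⟨_, ⟨j, rfl⟩, hd⟩ | ⟨i, rfl⟩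
    · obtain ⟨i, rfl⟩ := List.mem_ofFn.1 hd
      exact ⟨(V j i).normal, (V j i).range⟩
    · exact ⟨(η i).normal, (η i).range⟩
  -- Past the inputs the default decimal is read; it is normalized and has exponent zero, in
  -- accordance with the default bound zero.
  have hi : ∀ i, i < m * n + h ∧ (init V η).dec w i ∈ (init V η).decs ∨
      m * n + h ≤ i ∧ (init V η).dec w i = ⟨2 ^ (w - 1), 0⟩ := by
    intro i
    rcases lt_or_ge i (m * n + h) with h | h
    · refine Or.inl ⟨h, ?_⟩
      rw [State.dec, List.getD_eq_getElem _ _ (by rwa [hlen])]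
      exact List.getElem_mem _
    · exact Or.inr ⟨h, List.getD_eq_default _ _ (by rwa [hlen])⟩
  refine ⟨by simp [hlen], fun i => ?_, fun i => ?_, fun i => ?_⟩
  · rcases hi i with ⟨-, h⟩ | ⟨-, h⟩
    · exact (hmem _ h).1
    · rw [h]
      exact ⟨le_rfl, Nat.pow_lt_pow_right (by norm_num) (by omega)⟩
  · rcases hi i with ⟨hlt, h⟩ | ⟨hge, h⟩
    · rw [List.getD_eq_getElem _ _ (by simpa using hlt), List.getElem_replicate]
      exact (hmem _ h).2
    · rw [h]
      simp
  · rcases hi i with ⟨hlt, h⟩ | ⟨hge, h⟩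
    · rw [List.getD_eq_getElem _ _ (by simpa using hlt), List.getElem_replicate]
    · rw [List.getD_eq_default _ _ (by simpa using hge)]
      exact Nat.zero_le _

theorem le_magnitude (f : TIAlg w E m n h) : E ≤ f.magnitude :=
  le_foldl_bound f.code (List.replicate (m * n + h) E, E)

theorem large (f : TIAlg w E m n h) (hw : 1 ≤ w) (hp : 2 ^ (3 * w + 1) < p)
    (hk : 2 ^ (w + f.width + 1) < p) : Large p w f.width f.magnitude :=
  ⟨hw, hp, hk, Nat.lt_size_self _⟩

theorem holds_outputs {v : Wire → ZMod p} {k : ℕ}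
    {A B : Fin k → Expr (ZMod p) Wire × Expr (ZMod p) Wire} :
    Holds v (List.ofFn fun i => [(A i).1 - (B i).1, (A i).2 - (B i).2]).flatten ↔
      ∀ i, (A i).1.eval v = (B i).1.eval v ∧ (A i).2.eval v = (B i).2.eval v := by
  simp only [Holds, List.mem_flatten, List.mem_ofFn]
  constructor
  · intro H i
    exact ⟨sub_eq_zero.1 (H ((A i).1 - (B i).1) ⟨_, ⟨i, rfl⟩, by simp⟩),
      sub_eq_zero.1 (H ((A i).2 - (B i).2) ⟨_, ⟨i, rfl⟩, by simp⟩)⟩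
  · rintro H g ⟨_, ⟨i, rfl⟩, hg⟩
    simp only [List.mem_cons, List.not_mem_nil, or_false] at hg
    rcases hg with rfl | rfl
    · exact sub_eq_zero.2 (H i).1
    · exact sub_eq_zero.2 (H i).2

variable [Fact p.Prime]

/-- The compiled operations yield an admissible execution. The output constraints equate its results
with the claimed floats modulo `p`, and the ranges of both sides turn this into equality. -/
theorem valid_of_holds (f : TIAlg w E m n h) (hL : Large p w f.width f.magnitude)
    {v : Wire → ZMod p} {V : Fin m → FVec p w E n} {Vs : FVec p w E n} {Q : FVec p w E m}
    {η : FVec p w E h} (hv : CarriesInput v V Vs Q η) (hc : Holds v (f.constraints p)) :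
    f.Valid V η Vs Q := by
  simp only [constraints, holds_append, holds_outputs] at hc
  obtain ⟨⟨h1, h2⟩, h3⟩ := hc
  obtain ⟨st, hs, hst⟩ := compile_sound hL f.code (bounded_init hL.one_le V η) le_rfl
    (carries_init hv) h1
  have hb := bounded_steps f.code (bounded_init hL.one_le V η) hs
  have hwp : 2 ^ w < p :=
    (Nat.pow_le_pow_right (by norm_num) (show w ≤ 3 * w + 1 by omega)).trans_lt hL.cube
  have heq : ∀ (x : Flt w E) (i : ℕ), (x.val.s : ZMod p) = (st.dec w i).s →
      (x.val.e : ZMod p) = (st.dec w i).e → x.val = st.dec w i := by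
    intro x i hs he
    refine dec_eq_of_cast x.normal (hb.normal i) hwp ?_ hs he
    -- The exponents are at most `E` and `f.magnitude` in absolute value, and `E ≤ f.magnitude`; so
    -- they differ by at most `2 * f.magnitude < 2 ^ f.width < p`.
    have e1 := abs_le.1 x.range
    have e2 := abs_le.1 (hb.abs_exp_le i)
    have e3 : _ ≤ f.magnitude := hb.le i
    have e4 := f.le_magnitude
    have e5 := hL.width
    have e6 := hL.two_pow_lt
    rw [abs_lt]
    zify at e3 e4 e5 e6
    constructor <;> linarith
  refine ⟨st, hs, fun i => heq _ _ ?_ ?_, fun j => heq _ _ ?_ ?_⟩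
  · rw [← (Vs.getD_toField i).1, ← hv.truth, ← (hst.dec _).1]
    exact (h2 i).1
  · rw [← (Vs.getD_toField i).2, ← hv.truth, ← (hst.dec _).2]
    exact (h2 i).2
  · rw [← (Q.getD_toField j).1, ← hv.qual, ← (hst.dec _).1]
    exact (h3 j).1
  · rw [← (Q.getD_toField j).2, ← hv.qual, ← (hst.dec _).2]
    exact (h3 j).2

/-- One list `b` serves all assignments with the given inputs, whatever the commitments and their
randomness are. -/
theorem exists_aux (f : TIAlg w E m n h) (hL : Large p w f.width f.magnitude)
    {V : Fin m → FVec p w E n} {Vs : FVec p w E n} {Q : FVec p w E m}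
    {η : FVec p w E h} (hr : f.Runs V η Vs Q) :
    ∃ b : List (ZMod p), b.length = (f.compiled p).1.next ∧ ∀ v, CarriesInput v V Vs Q η →
      (∀ i, v (.wit (3 * (m + 1)) i) = b.getD i 0) → Holds v (f.constraints p) := by
  obtain ⟨st, he, hVs, hQ⟩ := hr
  have hb := bounded_init hL.one_le V η
  obtain ⟨g, hg⟩ := compile_complete (p := p) hL f.code hb le_rfl (steps_of_exec hL.one_le _ hb he)
  have hnext : (f.compiled p).1.next = auxLen f.width f.code := by
    rw [compiled, next_compile]
    exact Nat.zero_add _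
  refine ⟨(List.range (auxLen f.width f.code)).map g, by simp [hnext], fun v hv hx => ?_⟩
  obtain ⟨h1, h2⟩ := hg (3 * (m + 1)) _ v (carries_init hv) fun i hi => by
    rw [hx, show (layout p m n h).next + i = i from Nat.zero_add i,
      List.getD_eq_getElem _ _ (by simpa using hi)]
    simp
  simp only [constraints, holds_append, holds_outputs]
  refine ⟨⟨h1, fun i => ⟨?_, ?_⟩⟩, fun j => ⟨?_, ?_⟩⟩
  · exact (hv.truth _).trans ((Vs.getD_toField i).1.trans (by rw [hVs]; exact (h2.dec _).1.symm))
  · exact (hv.truth _).trans ((Vs.getD_toField i).2.trans (by rw [hVs]; exact (h2.dec _).2.symm))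
  · exact (hv.qual _).trans ((Q.getD_toField j).1.trans (by rw [hQ]; exact (h2.dec _).1.symm))
  · exact (hv.qual _).trans ((Q.getD_toField j).2.trans (by rw [hQ]; exact (h2.dec _).2.symm))

end TIAlg

open Gadget

/-! ### Constraints that two assignments cannot tell apart -/

section same

variable {p : ℕ} {ι : Type} {v v' : ι → ZMod p}

/-- All expressions have the same values under both assignments. -/
def Same (v v' : ι → ZMod p) (l : List (Expr (ZMod p) ι)) : Prop :=
  ∀ g ∈ l, g.eval v = g.eval v'

@[simp] theorem same_nil : Same v v' [] := by simp [Same]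

@[simp] theorem same_cons {g : Expr (ZMod p) ι} {l : List (Expr (ZMod p) ι)} :
    Same v v' (g :: l) ↔ g.eval v = g.eval v' ∧ Same v v' l := by simp [Same]

@[simp] theorem same_append {l l' : List (Expr (ZMod p) ι)} :
    Same v v' (l ++ l') ↔ Same v v' l ∧ Same v v' l' := by
  simp [Same, or_imp, forall_and]

theorem Same.holds_iff {l : List (Expr (ZMod p) ι)} (h : Same v v' l) :
    Holds v l ↔ Holds v' l :=
  forall₂_congr fun g hg => by rw [h g hg]

theorem Same.eval_sum {l : List (Expr (ZMod p) ι)} (h : Same v v' l) :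
    (Expr.sum l).eval v = (Expr.sum l).eval v' := by
  rw [Expr.eval_sum, Expr.eval_sum]
  exact congrArg List.sum (List.map_congr_left h)

theorem Same.eval_prod {l : List (Expr (ZMod p) ι)} (h : Same v v' l) :
    (Expr.prod l).eval v = (Expr.prod l).eval v' := by
  rw [Expr.eval_prod, Expr.eval_prod]
  exact congrArg List.prod (List.map_congr_left h)

theorem same_map {α : Type} {l : List α} {f : α → Expr (ZMod p) ι}
    (h : ∀ a ∈ l, (f a).eval v = (f a).eval v') : Same v v' (l.map f) := by
  simpa [Same] using h

theorem same_bitDecompose {k : ℕ} {x : Expr (ZMod p) ι} {b : ℕ → Expr (ZMod p) ι}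
    (hx : x.eval v = x.eval v') (hb : ∀ i, (b i).eval v = (b i).eval v') :
    Same v v' (bitDecompose k x b) := by
  simp only [bitDecompose, same_append, same_cons, same_nil, and_true, Expr.eval_sub, hx]
  refine ⟨same_map fun i _ => by simp [isBit, hb], ?_⟩
  rw [(same_map (v := v) (v' := v') fun i _ => by simp [hb]).eval_sum]

theorem same_compare {k : ℕ} {x y : Expr (ZMod p) ι} {b : ℕ → Expr (ZMod p) ι}
    (hx : x.eval v = x.eval v') (hy : y.eval v = y.eval v')
    (hb : ∀ i, (b i).eval v = (b i).eval v') : Same v v' (Gadget.compare k x y b) := by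
  simp only [Gadget.compare, compareBits, same_append, same_cons, same_nil, and_true]
  exact ⟨same_bitDecompose (by simp [hx, hy]) hb, by simp [hb]⟩

theorem same_normalized {w : ℕ} {x : Expr (ZMod p) ι} {b : ℕ → Expr (ZMod p) ι}
    (hx : x.eval v = x.eval v') (hb : ∀ i, (b i).eval v = (b i).eval v') :
    Same v v' (normalized w x b) := by
  simp only [normalized, same_append, same_cons, same_nil, and_true]
  exact ⟨same_bitDecompose hx hb, by simp [hb]⟩

theorem same_exponentialCheck {w : ℕ} {l r : Expr (ZMod p) ι} {b : ℕ → Expr (ZMod p) ι}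
    (hl : l.eval v = l.eval v') (hr : r.eval v = r.eval v')
    (hb : ∀ i, (b i).eval v = (b i).eval v') : Same v v' (exponentialCheck w l r b) := by
  simp only [exponentialCheck, same_append, same_cons, same_nil, and_true, Expr.eval_sub, hr]
  refine ⟨⟨same_bitDecompose hl hb, same_compare hl rfl fun i => hb _⟩, ?_⟩
  rw [(same_map (v := v) (v' := v') fun i _ => by simp [hb]).eval_prod]

theorem same_rounding {w : ℕ} {x y : Expr (ZMod p) ι} {b : ℕ → Expr (ZMod p) ι}
    (hx : x.eval v = x.eval v') (hy : y.eval v = y.eval v')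
    (hb : ∀ i, (b i).eval v = (b i).eval v') : Same v v' (rounding w x y b) :=
  same_compare (by simp [hx, hy]) hx hb

end same

section

variable {p w E k blk : ℕ} {v v' : Wire → ZMod p}

/-- Both assignments agree on the values computed so far. -/
structure Layout.Agree (L : Layout p) (v v' : Wire → ZMod p) : Prop where
  decs : ∀ A ∈ L.decs, A.1.eval v = A.1.eval v' ∧ A.2.eval v = A.2.eval v'
  bits : ∀ b ∈ L.bits, b.eval v = b.eval v'

theorem getD_of_forall_mem {α : Type} {P : α → Prop} {l : List α} {d : α} (h : ∀ a ∈ l, P a)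
    (hd : P d) (i : ℕ) : P (l.getD i d) := by
  rcases lt_or_ge i l.length with hi | hi
  · rw [List.getD_eq_getElem _ _ hi]
    exact h _ (List.getElem_mem _)
  · rwa [List.getD_eq_default _ _ hi]

theorem Layout.Agree.dec {L : Layout p} (h : L.Agree v v') (w i : ℕ) :
    (L.dec w i).1.eval v = (L.dec w i).1.eval v' ∧
      (L.dec w i).2.eval v = (L.dec w i).2.eval v' :=
  getD_of_forall_mem (P := fun A : Expr (ZMod p) Wire × Expr (ZMod p) Wire =>
    A.1.eval v = A.1.eval v' ∧ A.2.eval v = A.2.eval v') h.decs ⟨rfl, rfl⟩ i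

theorem Layout.Agree.bit {L : Layout p} (h : L.Agree v v') (i : ℕ) :
    (L.bit i).eval v = (L.bit i).eval v' :=
  getD_of_forall_mem (P := fun b : Expr (ZMod p) Wire => b.eval v = b.eval v') h.bits rfl i

theorem Layout.Agree.pushDec {L : Layout p} (h : L.Agree v v') {a : ℕ → Expr (ZMod p) Wire}
    (ha : ∀ i, (a i).eval v = (a i).eval v') (len : ℕ) : (L.pushDec a len).Agree v v' where
  decs A hA := by
    rcases List.mem_append.1 hA with hA | hA
    · exact h.decs A hA
    · obtain rfl := List.mem_singleton.1 hA
      exact ⟨ha 0, ha 1⟩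
  bits := h.bits

theorem Layout.Agree.pushBit {L : Layout p} (h : L.Agree v v') {b : Expr (ZMod p) Wire}
    (hb : b.eval v = b.eval v') (len : ℕ) : (L.pushBit b len).Agree v v' where
  decs := h.decs
  bits c hc := by
    rcases List.mem_append.1 hc with hc | hc
    · exact h.bits c hc
    · obtain rfl := List.mem_singleton.1 hc
      exact hb

theorem Instr.same_compile (ins : Instr w E) {L : Layout p} (h : L.Agree v v')
    (hx : ∀ i, v (.wit blk i) = v' (.wit blk i)) :
    Same v v' (ins.compile k blk L).2 ∧ (ins.compile k blk L).1.Agree v v' := by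
  have ha : ∀ i, (auxWire blk L i).eval v = (auxWire blk L i).eval v' := fun i => hx _
  cases ins with
  | const c => exact ⟨by simp [Instr.compile, Expr.eval, hx], h.pushDec ha _⟩
  | add i j =>
    refine ⟨?_, h.pushDec ha _⟩
    change Same v v' (floatAdd w k (L.dec w i) (L.dec w j) (auxWire blk L))
    simp only [floatAdd, permutationCheck, same_append, same_cons, same_nil, and_true]
    refine ⟨⟨⟨⟨⟨?_, same_compare (ha _) (ha _) fun i => ha _⟩, ?_⟩,
      same_exponentialCheck (ha _) (ha _) fun i => ha _⟩,
      same_rounding (by simp [ha]) (by simp [ha]) fun i => ha _⟩,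
      same_normalized (ha _) fun i => ha _⟩ <;>
    simp [isBit, ha, h.dec]
  | mul i j =>
    refine ⟨?_, h.pushDec ha _⟩
    change Same v v' (floatMul w (L.dec w i) (L.dec w j) (auxWire blk L))
    simp only [floatMul, same_append, same_cons, same_nil, and_true]
    refine ⟨⟨?_, same_rounding (by simp [h.dec]) (by simp [mid, ha]) fun i => ha _⟩,
      same_normalized (ha _) fun i => ha _⟩
    simp [chooseTheta, ha, h.dec]
  | div i j =>
    refine ⟨?_, h.pushDec ha _⟩
    change Same v v' (floatDiv w (L.dec w i) (L.dec w j) (auxWire blk L))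
    simp only [floatDiv, same_append, same_cons, same_nil, and_true]
    refine ⟨⟨?_, same_rounding (by simp [mid, ha, h.dec]) (by simp [ha, h.dec]) fun i => ha _⟩,
      same_normalized (ha _) fun i => ha _⟩
    simp [chooseTheta, ha, h.dec]
  | sel b i j =>
    refine ⟨?_, h.pushDec ha _⟩
    change Same v v' (select (L.bit b) (L.dec w i) (L.dec w j) (auxWire blk L))
    simp [select, ha, h.dec, h.bit]
  | count l =>
    refine ⟨?_, h.pushDec ha _⟩
    change Same v v' (ofNat w (Expr.sum (l.map fun i => L.bit i)) (auxWire blk L))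
    have hsum := (same_map (v := v) (v' := v') (l := l) fun i _ => h.bit i).eval_sum
    simp only [ofNat, same_append, same_cons, same_nil, and_true]
    refine ⟨⟨?_, same_exponentialCheck (ha _) (ha _) fun i => ha _⟩,
      same_normalized (ha _) fun i => ha _⟩
    simp [ha, hsum]
  | eq i j =>
    refine ⟨?_, h.pushBit (ha _) _⟩
    change Same v v' (equal (L.dec w i) (L.dec w j) (auxWire blk L))
    simp [equal, isZero, ha, h.dec]
  | le i j =>
    refine ⟨?_, h.pushBit (ha _) _⟩
    change Same v v' (lessEq w k (L.dec w i) (L.dec w j) (auxWire blk L))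
    exact same_bitDecompose (by simp [h.dec]) ha
  | not b =>
    refine ⟨?_, h.pushBit (ha _) _⟩
    change Same v v' [auxWire blk L 0 - (num p 1 - L.bit b)]
    simp [ha, h.bit]

theorem same_compile (code : List (Instr w E)) {L : Layout p} (h : L.Agree v v')
    (hx : ∀ i, v (.wit blk i) = v' (.wit blk i)) :
    Same v v' (compile k blk code L).2 ∧ (compile k blk code L).1.Agree v v' := by
  induction code generalizing L with
  | nil => exact ⟨same_nil, h⟩
  | cons ins code ih =>
    obtain ⟨h1, h2⟩ := ins.same_compile (k := k) h hx
    obtain ⟨h3, h4⟩ := ih h2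
    exact ⟨same_append.2 ⟨h1, h3⟩, h4⟩

end

/-! ### Auxiliary values do not depend on the commitments. -/

namespace TIAlg

variable {p w E m n h : ℕ}

/-- The constraints of the algorithm read only the answers, the truth, the qualities, the prior
factors and their own auxiliary block. -/
theorem holds_constraints_congr (f : TIAlg w E m n h) {v v' : Wire → ZMod p}
    {V : Fin m → FVec p w E n} {Vs : FVec p w E n} {Q : FVec p w E m} {η : FVec p w E h}
    (hv : CarriesInput v V Vs Q η) (hv' : CarriesInput v' V Vs Q η)
    (hx : ∀ i, v (.wit (3 * (m + 1)) i) = v' (.wit (3 * (m + 1)) i)) :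
    Holds v (f.constraints p) ↔ Holds v' (f.constraints p) := by
  have hL : (layout p m n h).Agree v v' := by
    refine ⟨fun A hA => ?_, fun b hb => by simp [layout] at hb⟩
    rcases List.mem_append.1 hA with hA | hA
    · obtain ⟨j, hj, hA⟩ := List.mem_flatMap.1 hA
      obtain ⟨i, -, rfl⟩ := List.mem_map.1 hA
      have hj' := List.mem_range.1 hj
      exact ⟨(hv.answer ⟨j, hj'⟩ _).trans (hv'.answer ⟨j, hj'⟩ _).symm,
        (hv.answer ⟨j, hj'⟩ _).trans (hv'.answer ⟨j, hj'⟩ _).symm⟩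
    · obtain ⟨i, -, rfl⟩ := List.mem_map.1 hA
      exact ⟨(hv.prior _).trans (hv'.prior _).symm, (hv.prior _).trans (hv'.prior _).symm⟩
  obtain ⟨h1, h2⟩ := same_compile (k := f.width) f.code hL hx
  refine Same.holds_iff ?_
  simp only [constraints, same_append]
  refine ⟨⟨h1, fun g hg => ?_⟩, fun g hg => ?_⟩
  · obtain ⟨_, hl, hg⟩ := List.mem_flatten.1 hg
    obtain ⟨i, rfl⟩ := List.mem_ofFn.1 hl
    have := h2.dec w (f.truth i)
    simp only [List.mem_cons, List.not_mem_nil, or_false] at hg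
    rcases hg with rfl | rfl
    · exact congrArg₂ (fun s t : ZMod p => s - t) ((hv.truth _).trans (hv'.truth _).symm) this.1
    · exact congrArg₂ (fun s t : ZMod p => s - t) ((hv.truth _).trans (hv'.truth _).symm) this.2
  · obtain ⟨_, hl, hg⟩ := List.mem_flatten.1 hg
    obtain ⟨i, rfl⟩ := List.mem_ofFn.1 hl
    have := h2.dec w (f.qual i)
    simp only [List.mem_cons, List.not_mem_nil, or_false] at hg
    rcases hg with rfl | rfl
    · exact congrArg₂ (fun s t : ZMod p => s - t) ((hv.qual _).trans (hv'.qual _).symm) this.1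
    · exact congrArg₂ (fun s t : ZMod p => s - t) ((hv.qual _).trans (hv'.qual _).symm) this.2

theorem carriesInput_witness (c : Party p m) (V : Fin m → FVec p w E n) (Vs : FVec p w E n)
    (Q : FVec p w E m) (η : FVec p w E h) (r a : Party p m) (b : List (ZMod p)) :
    CarriesInput (assign (publicInput c Q η) (witness V Vs r a b)) V Vs Q η :=
  carriesInput_of_parts c fun _ hj => getD_witness_message hj

theorem assign_witness_alg (x : Blocks (ZMod p)) (V : Fin m → FVec p w E n) (Vs : FVec p w E n)
    (r a : Party p m) (b : List (ZMod p)) (i : ℕ) :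
    assign x (witness V Vs r a b) (.wit (3 * (m + 1)) i) = b.getD i 0 := by
  rw [assign, getD_witness_alg]

variable [Fact p.Prime]

/-- `exists_aux` shows that the choice in `algAux` succeeds, but the list chosen may differ from the
one constructed there. Hence its validity for actual commitments is transported from the blank ones
by `holds_constraints_congr`. -/
theorem algAux_spec (f : TIAlg w E m n h) (hL : Large p w f.width f.magnitude)
    {V : Fin m → FVec p w E n} {Vs : FVec p w E n} {Q : FVec p w E m}
    {η : FVec p w E h} (hr : f.Runs V η Vs Q) :
    (f.algAux η V Vs Q).length = (f.compiled p).1.next ∧ ∀ c r a,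
      Holds (assign (publicInput c Q η) (witness V Vs r a (f.algAux η V Vs Q)))
        (f.constraints p) := by
  have H : ∃ b : List (ZMod p), b.length = (f.compiled p).1.next ∧ ∀ g ∈ f.constraints p,
      g.eval (assign (publicInput ((fun _ => [], []) : Party p m) Q η)
        (witness V Vs ((fun _ => [], []) : Party p m) ((fun _ => [], []) : Party p m) b)) = 0 := by
    obtain ⟨b, hb, h⟩ := f.exists_aux hL hr
    exact ⟨b, hb, h _ (carriesInput_witness _ _ _ _ _ _ _ _) (assign_witness_alg _ _ _ _ _ _)⟩
  have e : f.algAux η V Vs Q = H.choose := dif_pos H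
  rw [e]
  refine ⟨H.choose_spec.1, fun c r a => ?_⟩
  refine (f.holds_constraints_congr (carriesInput_witness _ _ _ _ _ _ _ _)
    (carriesInput_witness _ _ _ _ _ _ _ _) fun i => ?_).1 H.choose_spec.2
  rw [assign_witness_alg, assign_witness_alg]

end TIAlg

/-! ### The circuit -/

theorem Expr.eval_rename {F ι κ : Type} [CommRing F] (g : Expr F ι) (r : ι → κ) (v : κ → F) :
    (g.rename r).eval v = g.eval fun i => v (r i) := by
  induction g with
  | const c => rfl
  | wire i => rfl
  | add a b iha ihb => exact congrArg₂ _ iha ihb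
  | sub a b iha ihb => exact congrArg₂ _ iha ihb
  | mul a b iha ihb => exact congrArg₂ _ iha ihb

namespace TIAlg

variable {p w E m n h : ℕ}

theorem holds_openConstraints {K : CommitScheme (ZMod p)} {κ j : ℕ} {x y : Blocks (ZMod p)} :
    Holds (assign x y) (openConstraints m n K κ j) ↔
      ∀ g ∈ K.gates κ (2 * n), g.eval (comAssign (x.getD j []) (y.getD j [])
        (y.getD (m + 1 + j) []) (y.getD (2 * (m + 1) + j) [])) = 0 := by
  simp only [Holds, openConstraints, List.forall_mem_map, Expr.eval_rename]
  refine forall₂_congr fun g _ => ?_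
  have e : (fun i : ComWire => assign x y (match i with
      | .com i => .pub j i
      | .msg i => .wit j i
      | .rnd i => .wit (m + 1 + j) i
      | .aux i => .wit (2 * (m + 1) + j) i)) =
      comAssign (x.getD j []) (y.getD j []) (y.getD (m + 1 + j) [])
        (y.getD (2 * (m + 1) + j) []) := by
    funext i
    cases i <;> rfl
  exact iff_of_eq (congrArg (g.eval · = 0) e)

theorem holds_flatMap {F ι α : Type} [CommRing F] {v : ι → F} {l : List α}
    {f : α → List (Expr F ι)} : Holds v (l.flatMap f) ↔ ∀ a ∈ l, Holds v (f a) := by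
  simp only [Holds, List.mem_flatMap]
  exact ⟨fun H a ha g hg => H g ⟨a, ha, hg⟩, fun H g ⟨a, ha, hg⟩ => H a ha g hg⟩

theorem getD_length (y : Blocks (ZMod p)) (j : ℕ) :
    (y.getD j []).length = (y.map List.length).getD j 0 := by
  rw [List.getD_eq_getElem?_getD, List.getD_eq_getElem?_getD, List.getElem?_map]
  cases y[j]? <;> rfl

theorem getD_replicate {α : Type} {k j : ℕ} (hj : j < k) (a d : α) (l : List α) :
    (List.replicate k a ++ l).getD j d = a := by
  rw [getD_append_left (by simpa using hj), List.getD_eq_getElem _ _ (by simpa using hj),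
    List.getElem_replicate]

theorem map_length_parts {c : Party p m} {k : ℕ} (h : ∀ j < m + 1, ((parts c).getD j []).length = k) :
    (parts c).map List.length = List.replicate (m + 1) k := by
  rw [List.eq_replicate_iff]
  refine ⟨by simp [length_parts], fun b hb => ?_⟩
  obtain ⟨l, hl, rfl⟩ := List.mem_map.1 hb
  obtain ⟨j, hj, rfl⟩ := List.mem_iff_getElem.1 hl
  rw [← h j (by rwa [length_parts] at hj), List.getD_eq_getElem _ _ hj]

theorem length_messages (V : Fin m → FVec p w E n) (Vs : FVec p w E n) {j : ℕ} (hj : j < m + 1) :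
    ((parts (messages V Vs)).getD j []).length = 2 * n := by
  rcases Nat.lt_succ_iff_lt_or_eq.1 hj with hj | rfl
  · exact (congrArg _ (getD_parts _ ⟨j, hj⟩)).trans (FVec.length_toField _)
  · exact (congrArg _ (getD_parts_last _)).trans (FVec.length_toField _)

/-- The party-wise commitments. -/
def comParty (K : CommitScheme (ZMod p)) (κ : ℕ) (msg r : Party p m) : Party p m :=
  (fun j => K.com κ (msg.1 j) (r.1 j), K.com κ msg.2 r.2)

/-- The party-wise auxiliary values. -/
def auxParty (K : CommitScheme (ZMod p)) (κ : ℕ) (msg r : Party p m) : Party p m :=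
  (fun j => K.aux κ (msg.1 j) (r.1 j), K.aux κ msg.2 r.2)

theorem getD_comParty (K : CommitScheme (ZMod p)) (κ : ℕ) (msg r : Party p m) {j : ℕ}
    (hj : j < m + 1) : (parts (comParty K κ msg r)).getD j [] =
      K.com κ ((parts msg).getD j []) ((parts r).getD j []) := by
  rcases Nat.lt_succ_iff_lt_or_eq.1 hj with hj | rfl
  · have := fun c : Party p m => getD_parts c ⟨j, hj⟩
    dsimp only at this
    rw [this, this, this]
    rfl
  · rw [getD_parts_last, getD_parts_last, getD_parts_last]
    rfl

theorem getD_auxParty (K : CommitScheme (ZMod p)) (κ : ℕ) (msg r : Party p m) {j : ℕ}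
    (hj : j < m + 1) : (parts (auxParty K κ msg r)).getD j [] =
      K.aux κ ((parts msg).getD j []) ((parts r).getD j []) := by
  rcases Nat.lt_succ_iff_lt_or_eq.1 hj with hj | rfl
  · have := fun c : Party p m => getD_parts c ⟨j, hj⟩
    dsimp only at this
    rw [this, this, this]
    rfl
  · rw [getD_parts_last, getD_parts_last, getD_parts_last]
    rfl

variable [Fact p.Prime]

/-- The two groups of constraints are independent: those of the algorithm hold by `algAux_spec`, and
the openings by completeness of the commitment circuits, which requires randomness of the right
length. -/
theorem sat_of_runs (f : TIAlg w E m n h) (hL : Large p w f.width f.magnitude)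
    {K : CommitScheme (ZMod p)} (hK : K.IsSecure) (κ : ℕ)
    {V : Fin m → FVec p w E n} {Vs : FVec p w E n} {Q : FVec p w E m}
    {η : FVec p w E h} (hr : f.Runs V η Vs Q) (r : Party p m)
    (hlen : ∀ j < m + 1, ((parts r).getD j []).length = K.rndLen κ (2 * n)) :
    (f.circuit K κ).Sat (publicInput (comParty K κ (messages V Vs) r) Q η)
      (witness V Vs r (auxParty K κ (messages V Vs) r) (f.algAux η V Vs Q)) := by
  have hmsg : ∀ j < m + 1, ((parts (messages V Vs)).getD j []).length = 2 * n :=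
    fun j hj => length_messages V Vs hj
  have hlen' : ∀ j < m + 1, ((parts r).getD j []).length =
      K.rndLen κ ((parts (messages V Vs)).getD j []).length := fun j hj => by
    rw [hmsg j hj, hlen j hj]
  obtain ⟨hb, hholds⟩ := f.algAux_spec hL hr
  refine ⟨?_, ?_, holds_append.2 ⟨hholds _ _ _, holds_flatMap.2 fun j hj => ?_⟩⟩
  · rw [publicInput_eq, List.map_append, map_length_parts (k := K.comLen κ (2 * n))]
    · simp [circuit, FVec.length_toField]
    · intro j hj
      rw [getD_comParty _ _ _ _ hj, hK.com_length _ _ _ (hlen' j hj), hmsg j hj]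
  · rw [witness_eq, List.map_append, List.map_append, List.map_append, map_length_parts hmsg,
      map_length_parts hlen, map_length_parts (k := K.auxLen κ (2 * n))]
    · simp [circuit, hb]
    · intro j hj
      rw [getD_auxParty _ _ _ _ hj, (hK.gates_complete _ _ _ (hlen' j hj)).1, hmsg j hj]
  · have hj := List.mem_range.1 hj
    rw [holds_openConstraints, getD_witness_message hj, getD_witness_rnd hj, getD_witness_aux hj,
      publicInput_eq, getD_append_left (by rwa [length_parts]), getD_comParty _ _ _ _ hj,
      getD_auxParty _ _ _ _ hj]
    have := (hK.gates_complete κ _ _ (hlen' j hj)).2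
    rwa [hmsg j hj] at this

/-- A satisfied circuit has openings of all commitments in its witness; if these are the
openings to given answers and a given truth, then the result is valid. -/
theorem of_sat (f : TIAlg w E m n h) (hL : Large p w f.width f.magnitude)
    {K : CommitScheme (ZMod p)} (hK : K.IsSecure) (κ : ℕ) {V : Fin m → FVec p w E n}
    {Vs : FVec p w E n} {Q : FVec p w E m} {η : FVec p w E h} {c : Party p m}
    {y : Blocks (ZMod p)} (hs : (f.circuit K κ).Sat (publicInput c Q η) y) :
    (∀ j < m + 1, (y.getD j []).length = 2 * n ∧
      (parts c).getD j [] = K.com κ (y.getD j []) (y.getD (m + 1 + j) [])) ∧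
    ((∀ j < m + 1, y.getD j [] = (parts (messages V Vs)).getD j []) → f.Valid V η Vs Q) := by
  obtain ⟨hx, hy, hc⟩ := hs
  obtain ⟨hc, hopen⟩ := holds_append.1 hc
  refine ⟨fun j hj => ?_, fun H => f.valid_of_holds hL (carriesInput_of_parts c H) hc⟩
  have h0 : (y.getD j []).length = 2 * n := by
    rw [getD_length, hy]
    simp only [circuit, List.append_assoc]
    exact getD_replicate hj _ _ _
  have h1 : (y.getD (m + 1 + j) []).length = K.rndLen κ (2 * n) := by
    rw [getD_length, hy]
    simp only [circuit, List.append_assoc]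
    rw [getD_append_add (by simp)]
    exact getD_replicate hj _ _ _
  have h2 : (y.getD (2 * (m + 1) + j) []).length = K.auxLen κ (2 * n) := by
    rw [getD_length, hy]
    simp only [circuit, List.append_assoc]
    rw [two_mul (m + 1), add_assoc, getD_append_add (by simp), getD_append_add (by simp)]
    exact getD_replicate hj _ _ _
  have h3 : ((publicInput c Q η).getD j []).length = K.comLen κ (2 * n) := by
    rw [getD_length, hx]
    exact getD_replicate hj _ _ _
  have h4 := holds_openConstraints.1 (holds_flatMap.1 hopen j (List.mem_range.2 hj))
  have h5 : (publicInput c Q η).getD j [] = (parts c).getD j [] := by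
    rw [publicInput_eq, getD_append_left (by rwa [length_parts])]
  refine ⟨h0, ?_⟩
  rw [← h5]
  rw [← h0] at h1 h2 h3 h4
  exact hK.gates_sound κ _ _ _ _ h1 h3 h2 h4

end TIAlg

/-! ### Injective encodings -/

theorem enc_bool_injective : Function.Injective (Enc.enc : Bool → Data) := by
  intro a b h
  cases a <;> cases b <;> first | rfl | (exact absurd h (by intro h; cases h))

section

variable {α β : Type} [Enc α] [Enc β]

theorem enc_list_injective (hα : Function.Injective (Enc.enc : α → Data)) :
    Function.Injective (Enc.enc : List α → Data) := by
  intro l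
  induction l with
  | nil =>
    intro l' h
    cases l' with
    | nil => rfl
    | cons b l' => cases h
  | cons a l ih =>
    intro l' h
    cases l' with
    | nil => cases h
    | cons b l' =>
      obtain ⟨h1, h2⟩ := Data.node.inj h
      rw [hα h1, ih h2]

theorem enc_prod_injective (hα : Function.Injective (Enc.enc : α → Data))
    (hβ : Function.Injective (Enc.enc : β → Data)) :
    Function.Injective (Enc.enc : α × β → Data) := by
  rintro ⟨a, b⟩ ⟨a', b'⟩ h
  have h1 : Enc.enc a = Enc.enc a' := (Data.node.inj h).1
  have h2 : Enc.enc b = Enc.enc b' := (Data.node.inj h).2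
  rw [hα h1, hβ h2]

theorem enc_pi_injective (hα : Function.Injective (Enc.enc : α → Data)) {n : ℕ} :
    Function.Injective (Enc.enc : (Fin n → α) → Data) :=
  fun _ _ h => List.ofFn_injective (enc_list_injective hα h)

end

theorem enc_zmod_injective {p : ℕ} [NeZero p] : Function.Injective (Enc.enc : ZMod p → Data) := by
  intro a b h
  have := enc_list_injective enc_bool_injective h
  -- Binary digits determine the representative.
  refine ZMod.val_injective p (Nat.digits.injective 2 ?_)
  rw [Nat.digits_two_eq_bits, Nat.digits_two_eq_bits, this]

/-- Together with injective encodings, this makes every function of finitely many floats computable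
by a table. -/
instance {w E : ℕ} : Finite (Flt w E) := by
  refine Finite.of_injective (β := Fin (2 ^ w) × Set.Icc (-(E : ℤ)) E)
    (fun x => (⟨x.val.s, x.normal.2⟩, ⟨x.val.e, abs_le.1 x.range⟩)) ?_
  rintro ⟨⟨s, e⟩, h1, h2⟩ ⟨⟨s', e'⟩, h1', h2'⟩ h
  obtain rfl : s = s' := congrArg (fun x => x.1.val) h
  obtain rfl : e = e' := congrArg (fun x => x.2.val) h
  rfl

instance {p w E n : ℕ} : Finite (FVec p w E n) := inferInstanceAs (Finite (Fin n → Flt w E))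

/-- Vectors are encoded through their residues, so injectivity needs room in the field: exponents
range over `[-E, E]`, whence `2 * E < p`. -/
theorem enc_fVec_injective {p w E n : ℕ} [NeZero p] (hw : 2 ^ w < p) (hE : 2 * E < p) :
    Function.Injective (Enc.enc : FVec p w E n → Data) := by
  intro u v h
  have h' : u.toField = v.toField := enc_list_injective enc_zmod_injective h
  funext i
  have h1 := (u.getD_toField i).1
  have h2 := (u.getD_toField i).2
  rw [h', (v.getD_toField i).1] at h1
  rw [h', (v.getD_toField i).2] at h2
  have : (v i).val = (u i).val := by
    refine dec_eq_of_cast (v i).normal (u i).normal hw ?_ h1 h2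
    have e1 := abs_le.1 (u i).range
    have e2 := abs_le.1 (v i).range
    rw [abs_lt]
    zify at hE
    constructor <;> linarith
  cases hu : u i
  cases hv : v i
  rw [hu, hv] at this
  simp only at this
  subst this
  rfl

/-! ### Deterministic algorithms -/

namespace IsPPT

variable {α β γ : Type} [Enc α] [Enc β] [Enc γ]

theorem pure_bind {f : α → β} {B : α → β → PMF γ} (hf : IsPPT fun a => PMF.pure (f a))
    (hB : IsPPT fun x : α × β => B x.1 x.2) : IsPPT fun a => B a (f a) := by
  simpa only [PMF.pure_bind] using bind hf hB

theorem pure_of_enc {f : α → β} {g : α → γ} (hf : IsPPT fun a => PMF.pure (f a))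
    (h : ∀ a, Enc.enc (g a) = Enc.enc (f a)) : IsPPT fun a => PMF.pure (g a) := by
  obtain ⟨P, q, hP⟩ := isPPT_iff.1 hf
  refine isPPT_iff.2 ⟨P, q, fun a => ?_⟩
  have := hP a
  rw [PMF.pure_map] at this ⊢
  rwa [h]

theorem pure_prod {f : α → β} {g : α → γ} (hf : IsPPT fun a => PMF.pure (f a))
    (hg : IsPPT fun a => PMF.pure (g a)) : IsPPT fun a => PMF.pure (f a, g a) :=
  pure_bind (B := fun a b => PMF.pure (b, g a)) hf
    (pure_bind (B := fun (x : α × β) c => PMF.pure (x.2, c)) (hg.comp IsPoly.id.fst)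
      (pure (IsPoly.id.fst.snd.prod IsPoly.id.snd)))

theorem pure_pi {n : ℕ} {f : Fin n → α → β} (hf : ∀ i, IsPPT fun a => PMF.pure (f i a)) :
    IsPPT fun a => PMF.pure fun i => f i a := by
  induction n with
  | zero => exact pure_of_enc (pure (IsPoly.nil (α := α) (β := β))) fun _ => rfl
  | succ n ih =>
    refine pure_of_enc (pure_prod (hf 0) (ih fun i => hf i.succ)) fun a => ?_
    change encList (List.ofFn _) = _
    rw [List.ofFn_succ]
    rfl

end IsPPT

theorem IsPoly.finCons {α β : Type} [Enc α] [Enc β] {n : ℕ} {f : α → β} {g : α → Fin n → β}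
    (hf : IsPoly f) (hg : IsPoly g) :
    IsPoly fun a => (Fin.cons (f a) (g a) : Fin (n + 1) → β) := by
  refine (hf.prod hg).of_enc fun a => ?_
  change encList (List.ofFn _) = _
  rw [List.ofFn_succ]
  rfl

theorem IsPoly.of_finite {α β : Type} [Enc α] [Enc β] [Finite α]
    (h : Function.Injective (Enc.enc : α → Data)) (f : α → β) : IsPoly f := by
  obtain ⟨k, hk, hkf⟩ := PolyMap.exists_table (Enc.enc : α → Data) (fun a => Enc.enc (f a))
    fun i j hij => by rw [h hij]
  exact ⟨k, hk, fun a => (hkf a).symm⟩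

/-! ### The algorithms of the protocol -/

namespace TIAlg

variable {p w E m n h : ℕ}

section poly

variable {α : Type} [Enc α]

theorem isPoly_toField {f : α → FVec p w E n} (hf : IsPoly f) : IsPoly fun a => (f a).toField :=
  hf.of_enc fun _ => rfl

theorem isPoly_messages {V : α → Fin m → FVec p w E n} {Vs : α → FVec p w E n} (hV : IsPoly V)
    (hVs : IsPoly Vs) : IsPoly fun a => messages (V a) (Vs a) :=
  (IsPoly.pi fun j => isPoly_toField (hV.apply j)).prod (isPoly_toField hVs)

theorem isPoly_parts_append {c : α → Party p m} {l : α → Blocks (ZMod p)} (hc : IsPoly c)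
    (hl : IsPoly l) : IsPoly fun a => parts (c a) ++ l a := by
  have := IsPoly.append (fun j => hc.fst.apply j) (hc.snd.cons hl)
  simpa only [parts, List.append_assoc, List.singleton_append] using this

theorem isPoly_publicInput {c : α → Party p m} {Q : α → FVec p w E m} {η : α → FVec p w E h}
    (hc : IsPoly c) (hQ : IsPoly Q) (hη : IsPoly η) :
    IsPoly fun a => publicInput (c a) (Q a) (η a) := by
  simp only [publicInput_eq]
  exact isPoly_parts_append hc ((isPoly_toField hQ).cons ((isPoly_toField hη).cons .nil))

theorem isPoly_witness {V : α → Fin m → FVec p w E n} {Vs : α → FVec p w E n}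
    {r a : α → Party p m} {b : α → List (ZMod p)} (hV : IsPoly V) (hVs : IsPoly Vs)
    (hr : IsPoly r) (ha : IsPoly a) (hb : IsPoly b) :
    IsPoly fun x => witness (V x) (Vs x) (r x) (a x) (b x) := by
  simp only [witness_eq]
  exact isPoly_parts_append (isPoly_messages hV hVs) (isPoly_parts_append hr
    (isPoly_parts_append ha (hb.cons .nil)))

end poly

/-- A list of blocks as one block for each party. -/
def ofParts (m : ℕ) (x : Blocks (ZMod p)) : Party p m := (fun j => x.getD j [], x.getD m [])

theorem ofParts_publicInput (c : Party p m) (Q : FVec p w E m) (η : FVec p w E h) :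
    ofParts m (publicInput c Q η) = c := by
  rw [publicInput_eq]
  refine Prod.ext (funext fun j => ?_) ?_
  · exact (getD_append_left (by rw [length_parts]; omega) _).trans (getD_parts c j)
  · exact (getD_append_left (by rw [length_parts]; omega) _).trans (getD_parts_last c)

theorem isPoly_ofParts {α : Type} [Enc α] {x : α → Blocks (ZMod p)} (hx : IsPoly x) :
    IsPoly fun a => ofParts m (x a) :=
  (IsPoly.pi fun j : Fin m => hx.getD_nil j).prod (hx.getD_nil m)

theorem isPPT_party {F : ℕ → List (ZMod p) → List (ZMod p) → List (ZMod p)}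
    (hF : IsPPT fun i : ℕ × List (ZMod p) × List (ZMod p) => PMF.pure (F i.1 i.2.1 i.2.2)) :
    IsPPT fun i : ℕ × Party p m × Party p m =>
      PMF.pure ((fun j => F i.1 (i.2.1.1 j) (i.2.2.1 j), F i.1 i.2.1.2 i.2.2.2) : Party p m) :=
  IsPPT.pure_prod
    (IsPPT.pure_pi fun j => hF.comp (g := fun i : ℕ × Party p m × Party p m =>
      (i.1, i.2.1.1 j, i.2.2.1 j))
      (IsPoly.id.fst.prod ((IsPoly.id.snd.fst.fst.apply j).prod (IsPoly.id.snd.snd.fst.apply j))))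
    (hF.comp (g := fun i : ℕ × Party p m × Party p m => (i.1, i.2.1.2, i.2.2.2))
      (IsPoly.id.fst.prod (IsPoly.id.snd.fst.snd.prod IsPoly.id.snd.snd.snd)))

/-- The randomness of all commitments. -/
def rndParty (K : CommitScheme (ZMod p)) (κ m ℓ : ℕ) : PMF (Party p m) :=
  (samples (K.rnd κ ℓ) m).bind fun r => (K.rnd κ ℓ).bind fun rs => PMF.pure (r, rs)

variable {K : CommitScheme (ZMod p)} {Z : ZKP (ZMod p)} {η : FVec p w E h} {f : TIAlg w E m n h}

theorem isPPT_rndParty (hK : K.IsSecure) (ℓ : ℕ) : IsPPT fun κ => rndParty K κ m ℓ := by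
  have h0 : IsPPT fun κ => K.rnd κ ℓ :=
    hK.ppt_rnd.comp (g := fun κ : ℕ => (κ, ℓ)) (IsPoly.id.prod (IsPoly.const _))
  exact (h0.samples m).bind ((h0.comp IsPoly.id.fst).bind
    (IsPPT.pure (IsPoly.id.fst.snd.prod IsPoly.id.snd)))

theorem mem_support_samples {α : Type} {d : PMF α} {k : ℕ} {v : Fin k → α}
    (hv : v ∈ (samples d k).support) (i : Fin k) : v i ∈ d.support := by
  induction k with
  | zero => exact i.elim0
  | succ k ih =>
    obtain ⟨a, ha, hv⟩ := (PMF.mem_support_bind_iff _ _ _).1 hv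
    obtain ⟨u, hu, hv⟩ := (PMF.mem_support_bind_iff _ _ _).1 hv
    rw [PMF.mem_support_pure_iff] at hv
    subst hv
    refine Fin.cases ?_ (fun j => ?_) i
    · exact ha
    · exact ih hu j

theorem length_rndParty (hK : K.IsSecure) {κ ℓ : ℕ} {r : Party p m}
    (hr : r ∈ (rndParty K κ m ℓ).support) {j : ℕ} (hj : j < m + 1) :
    ((parts r).getD j []).length = K.rndLen κ ℓ := by
  obtain ⟨v, hv, hr⟩ := (PMF.mem_support_bind_iff _ _ _).1 hr
  obtain ⟨s, hs, hr⟩ := (PMF.mem_support_bind_iff _ _ _).1 hr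
  rw [PMF.mem_support_pure_iff] at hr
  subst hr
  rcases Nat.lt_succ_iff_lt_or_eq.1 hj with hj | rfl
  · exact (congrArg _ (getD_parts _ ⟨j, hj⟩)).trans
      (hK.rnd_length _ _ _ (mem_support_samples hv _))
  · exact (congrArg _ (getD_parts_last _)).trans (hK.rnd_length _ _ _ hs)

variable [Fact p.Prime]

theorem commit_protocol (i : ℕ × (Fin m → FVec p w E n) × FVec p w E n) :
    (f.protocol η K Z).commit i = (rndParty K i.1 m (2 * n)).map fun r =>
      (comParty K i.1 (messages i.2.1 i.2.2) r, r) := by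
  simp only [rndParty, PMF.map_bind, PMF.pure_map]
  rfl

/-- The honest execution, followed by any use of its result. -/
theorem real_bind {β : Type} (κ : ℕ) (V : Fin m → FVec p w E n) (Vs : FVec p w E n)
    (Q : FVec p w E m) (D : Params p w E h × Party p m × Data → PMF β) :
    ((f.protocol η K Z).real κ V Vs Q).bind D =
      (rndParty K κ m (2 * n)).bind fun r => (Z.setup κ).bind fun pp =>
        (Z.prove κ (f.circuit K κ) pp (publicInput (comParty K κ (messages V Vs) r) Q η)
          (witness V Vs r (auxParty K κ (messages V Vs) r) (f.algAux η V Vs Q))).bind fun π =>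
            D ((pp, η), comParty K κ (messages V Vs) r, π) := by
  -- The randomness of the commitments is drawn before the setup. Once it is fixed, so are statement
  -- and witness, as the properties of the proof system require.
  rw [PMF.bind_comm, Scheme.real, commit_protocol]
  simp only [PMF.bind_bind, PMF.bind_map, Function.comp_def, PMF.pure_bind, protocol]
  rfl

theorem isPPT_setup (hZ : Z.IsZKAoK (f.circuit K)) : IsPPT (f.protocol η K Z).setup :=
  hZ.ppt_setup.bind (IsPPT.pure (IsPoly.id.snd.prod (IsPoly.const _)))

theorem isPPT_commit (hK : K.IsSecure) : IsPPT (f.protocol η K Z).commit := by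
  have h1 : IsPPT fun x : (ℕ × (Fin m → FVec p w E n) × FVec p w E n) × Party p m =>
      PMF.pure (comParty K x.1.1 (messages x.1.2.1 x.1.2.2) x.2) :=
    (isPPT_party hK.ppt_com).comp
      (g := fun x : (ℕ × (Fin m → FVec p w E n) × FVec p w E n) × Party p m =>
        (x.1.1, messages x.1.2.1 x.1.2.2, x.2))
      (IsPoly.id.fst.fst.prod ((isPoly_messages IsPoly.id.fst.snd.fst IsPoly.id.fst.snd.snd).prod
        IsPoly.id.snd))
  have h2 := IsPPT.bind ((isPPT_rndParty (m := m) hK (2 * n)).comp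
      (g := fun i : ℕ × (Fin m → FVec p w E n) × FVec p w E n => i.1) IsPoly.id.fst)
    (B := fun i r => PMF.pure (comParty K i.1 (messages i.2.1 i.2.2) r, r))
    (h1.pure_prod (IsPPT.pure IsPoly.id.snd))
  have e : (f.protocol η K Z).commit = fun i => (rndParty K i.1 m (2 * n)).bind fun r =>
      PMF.pure (comParty K i.1 (messages i.2.1 i.2.2) r, r) := funext commit_protocol
  rw [e]
  exact h2

/-- `algAux` is defined by choice, but its arguments form a finite set that does not involve the
security parameter. Only the auxiliary values of the openings need an algorithm, which the
commitment scheme provides. -/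
theorem isPPT_aux (hK : K.IsSecure) (hw : 2 ^ w < p) (hE : 2 * E < p) :
    IsPPT fun i => PMF.pure ((f.protocol η K Z).aux i) := by
  have hinj : ∀ k, Function.Injective (Enc.enc : FVec p w E k → Data) := fun k =>
    enc_fVec_injective hw hE
  have h1 := IsPoly.of_finite (enc_prod_injective (hinj _) (enc_prod_injective
    (enc_pi_injective (hinj _)) (enc_prod_injective (hinj _) (hinj _))))
    fun x : FVec p w E h × (Fin m → FVec p w E n) × FVec p w E n × FVec p w E m =>
      f.algAux x.1 x.2.1 x.2.2.1 x.2.2.2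
  let ι := ℕ × Params p w E h × (Fin m → FVec p w E n) × FVec p w E n × FVec p w E m × Party p m
  have h2 : IsPoly fun i : ι => f.algAux i.2.1.2 i.2.2.1 i.2.2.2.1 i.2.2.2.2.1 :=
    h1.comp (f := fun i : ι => (i.2.1.2, i.2.2.1, i.2.2.2.1, i.2.2.2.2.1))
      (IsPoly.id.snd.fst.snd.prod (IsPoly.id.snd.snd.fst.prod
        (IsPoly.id.snd.snd.snd.fst.prod IsPoly.id.snd.snd.snd.snd.fst)))
  have h3 : IsPPT fun i : ι =>
      PMF.pure (auxParty K i.1 (messages i.2.2.1 i.2.2.2.1) i.2.2.2.2.2) :=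
    (isPPT_party hK.ppt_aux).comp
      (g := fun i : ι => (i.1, messages i.2.2.1 i.2.2.2.1, i.2.2.2.2.2))
      (IsPoly.id.fst.prod ((isPoly_messages IsPoly.id.snd.snd.fst IsPoly.id.snd.snd.snd.fst).prod
        IsPoly.id.snd.snd.snd.snd.snd))
  exact h3.pure_prod (IsPPT.pure h2)

theorem isPPT_prove (hZ : Z.IsZKAoK (f.circuit K)) : IsPPT (f.protocol η K Z).prove := by
  let ι := ℕ × Params p w E h × Party p m × (Fin m → FVec p w E n) × FVec p w E n ×
    FVec p w E m × Party p m × Party p m × List (ZMod p)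
  exact hZ.ppt_prove.comp (g := fun i : ι => (i.1, i.2.1.1,
    publicInput i.2.2.1 i.2.2.2.2.2.1 i.2.1.2,
    witness i.2.2.2.1 i.2.2.2.2.1 i.2.2.2.2.2.2.1 i.2.2.2.2.2.2.2.1 i.2.2.2.2.2.2.2.2))
    (IsPoly.id.fst.prod (IsPoly.id.snd.fst.fst.prod
      ((isPoly_publicInput IsPoly.id.snd.snd.fst IsPoly.id.snd.snd.snd.snd.snd.fst
        IsPoly.id.snd.fst.snd).prod
      (isPoly_witness IsPoly.id.snd.snd.snd.fst IsPoly.id.snd.snd.snd.snd.fst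
        IsPoly.id.snd.snd.snd.snd.snd.snd.fst IsPoly.id.snd.snd.snd.snd.snd.snd.snd.fst
        IsPoly.id.snd.snd.snd.snd.snd.snd.snd.snd))))

theorem isPPT_verify (hZ : Z.IsZKAoK (f.circuit K)) : IsPPT (f.protocol η K Z).verify := by
  let ι := ℕ × Params p w E h × Party p m × FVec p w E m × Data
  exact hZ.ppt_verify.comp (g := fun i : ι => (i.1, i.2.1.1,
    publicInput i.2.2.1 i.2.2.2.1 i.2.1.2, i.2.2.2.2))
    (IsPoly.id.fst.prod (IsPoly.id.snd.fst.fst.prod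
      ((isPoly_publicInput IsPoly.id.snd.snd.fst IsPoly.id.snd.snd.snd.fst
        IsPoly.id.snd.fst.snd).prod IsPoly.id.snd.snd.snd.snd)))

theorem complete_protocol (hL : Large p w f.width f.magnitude) (hK : K.IsSecure)
    (hZ : Z.IsZKAoK (f.circuit K)) (κ : ℕ) {V : Fin m → FVec p w E n} {Vs : FVec p w E n}
    {Q : FVec p w E m} (hr : f.Runs V η Vs Q) :
    (((f.protocol η K Z).real κ V Vs Q).bind fun t =>
      (f.protocol η K Z).verify (κ, t.1, t.2.1, Q, t.2.2)) = PMF.pure true := by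
  rw [real_bind]
  -- For each randomness in the support the statement is satisfied, and acceptance is certain.
  refine (bind_congr_support _ (g := fun _ => PMF.pure true) fun r hr' => ?_).trans
    (PMF.bind_const _ _)
  exact hZ.complete κ _ _ (f.sat_of_runs hL hK κ hr r fun j hj => length_rndParty hK hr' hj)

end TIAlg

/-! ### Computational indistinguishability -/

/-- No efficient distinguisher tells samples of the two families apart. -/
def Indist {α : Type} [Enc α] (A B : ℕ → PMF α) : Prop :=
  ∀ D : ℕ × α → PMF Bool, IsPPT D → Negligible fun κ =>
    |prob ((A κ).bind fun a => D (κ, a)) {true} - prob ((B κ).bind fun b => D (κ, b)) {true}|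

namespace Indist

variable {α β : Type} [Enc α] [Enc β] {A B C : ℕ → PMF α}

theorem refl (A : ℕ → PMF α) : Indist A A := fun D _ => by
  simpa using Negligible.zero

theorem trans (h : Indist A B) (h' : Indist B C) : Indist A C := fun D hD =>
  ((h D hD).add (h' D hD)).mono fun κ => by
    rw [abs_abs]
    exact abs_sub_le _ _ _

theorem map (h : Indist A B) {g : ℕ → α → β} (hg : IsPoly fun x : ℕ × α => g x.1 x.2) :
    Indist (fun κ => (A κ).map (g κ)) fun κ => (B κ).map (g κ) := fun D hD => by
  simpa only [PMF.bind_map, Function.comp_def] using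
    h (fun x => D (x.1, g x.1 x.2)) (hD.comp (IsPoly.id.fst.prod hg))

/-- A hybrid with the first component already replaced. In each half the distinguisher samples the
unchanged component by itself, which is why `A'` and `B` have to be efficient. -/
theorem prod {A' B' : ℕ → PMF β} (h : Indist A B) (h' : Indist A' B') (hA' : IsPPT A')
    (hB : IsPPT B) :
    Indist (fun κ => (A κ).bind fun a => (A' κ).bind fun b => PMF.pure (a, b))
      fun κ => (B κ).bind fun a => (B' κ).bind fun b => PMF.pure (a, b) := by
  refine trans (B := fun κ => (B κ).bind fun a => (A' κ).bind fun b => PMF.pure (a, b))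
    (fun D hD => ?_) fun D hD => ?_
  · simpa only [PMF.bind_bind, PMF.pure_bind] using
      h (fun x => (A' x.1).bind fun b => D (x.1, x.2, b))
        ((hA'.comp IsPoly.id.fst).bind (B := fun (x : ℕ × α) b => D (x.1, x.2, b))
          (hD.comp (IsPoly.id.fst.fst.prod (IsPoly.id.fst.snd.prod IsPoly.id.snd))))
  · have := h' (fun x => (B x.1).bind fun a => D (x.1, a, x.2))
        ((hB.comp IsPoly.id.fst).bind (B := fun (x : ℕ × β) a => D (x.1, a, x.2))
          (hD.comp (IsPoly.id.fst.fst.prod (IsPoly.id.snd.prod IsPoly.id.fst.snd))))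
    simp only [PMF.bind_bind, PMF.pure_bind]
    simpa only [PMF.bind_comm (B _) (A' _), PMF.bind_comm (B _) (B' _)] using this

end Indist

/-! ### Hiding of several commitments -/

section commitments

variable {p : ℕ} {K : CommitScheme (ZMod p)}

theorem isPPT_samples_com [NeZero p] (hK : K.IsSecure) (ℓ : ℕ) {k : ℕ}
    (msg : Fin k → List (ZMod p)) :
    IsPPT fun κ => (samples (K.rnd κ ℓ) k).map fun r j => K.com κ (msg j) (r j) := by
  have h0 : IsPPT fun κ => K.rnd κ ℓ :=
    hK.ppt_rnd.comp (g := fun κ : ℕ => (κ, ℓ)) (IsPoly.id.prod (IsPoly.const _))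
  refine (h0.samples k).bind
    (B := fun κ r => PMF.pure fun j => K.com κ (msg j) (r j)) (IsPPT.pure_pi fun j => ?_)
  exact hK.ppt_com.comp (g := fun x : ℕ × (Fin k → List (ZMod p)) => (x.1, msg j, x.2 j))
    (IsPoly.id.fst.prod ((IsPoly.const _).prod (IsPoly.id.snd.apply j)))

theorem isPPT_com [NeZero p] (hK : K.IsSecure) (ℓ : ℕ) (msg : List (ZMod p)) :
    IsPPT fun κ => (K.rnd κ ℓ).map (K.com κ msg) := by
  have h0 : IsPPT fun κ => K.rnd κ ℓ :=
    hK.ppt_rnd.comp (g := fun κ : ℕ => (κ, ℓ)) (IsPoly.id.prod (IsPoly.const _))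
  exact h0.bind (B := fun κ r => PMF.pure (K.com κ msg r))
    (hK.ppt_com.comp (g := fun x : ℕ × List (ZMod p) => (x.1, msg, x.2))
      (IsPoly.id.fst.prod ((IsPoly.const _).prod IsPoly.id.snd)))

theorem indist_com (hK : K.IsSecure) {ℓ : ℕ} {msg₀ msg₁ : List (ZMod p)}
    (h₀ : msg₀.length = ℓ) (h₁ : msg₁.length = ℓ) :
    Indist (fun κ => (K.rnd κ ℓ).map (K.com κ msg₀)) fun κ => (K.rnd κ ℓ).map (K.com κ msg₁) := by
  intro D hD
  have := hK.isHiding msg₀ msg₁ (h₀.trans h₁.symm) D hD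
  simpa only [h₀, h₁, PMF.bind_map, Function.comp_def] using this

/-- Messages are replaced one at a time. Their number does not grow with the security parameter, so
finitely many negligible terms are added. -/
theorem indist_samples_com [NeZero p] (hK : K.IsSecure) {ℓ k : ℕ}
    {msg₀ msg₁ : Fin k → List (ZMod p)}
    (h₀ : ∀ j, (msg₀ j).length = ℓ) (h₁ : ∀ j, (msg₁ j).length = ℓ) :
    Indist (fun κ => (samples (K.rnd κ ℓ) k).map fun r j => K.com κ (msg₀ j) (r j))
      fun κ => (samples (K.rnd κ ℓ) k).map fun r j => K.com κ (msg₁ j) (r j) := by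
  induction k with
  | zero =>
    rw [Subsingleton.elim msg₀ msg₁]
    exact Indist.refl _
  | succ k ih =>
    have e (κ : ℕ) (msg : Fin (k + 1) → List (ZMod p)) :
        ((samples (K.rnd κ ℓ) (k + 1)).map fun r j => K.com κ (msg j) (r j)) =
        ((((K.rnd κ ℓ).map (K.com κ (msg 0))).bind fun a =>
          ((samples (K.rnd κ ℓ) k).map fun r j => K.com κ (msg j.succ) (r j)).bind fun v =>
            PMF.pure (a, v)).map fun x => (Fin.cons x.1 x.2 : Fin (k + 1) → List (ZMod p))) := by
      simp only [samples, PMF.map_bind, PMF.pure_map, PMF.bind_map, Function.comp_def]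
      refine congrArg _ (funext fun a => congrArg _ (funext fun v => congrArg _ (funext fun j => ?_)))
      refine Fin.cases rfl (fun j => rfl) j
    simp only [e]
    exact Indist.map (g := fun _ x => (Fin.cons x.1 x.2 : Fin (k + 1) → List (ZMod p)))
      ((indist_com hK (h₀ 0) (h₁ 0)).prod (ih (fun j => h₀ j.succ) fun j => h₁ j.succ)
        (isPPT_samples_com hK ℓ _) (isPPT_com hK ℓ _)) (IsPoly.id.snd.fst.finCons IsPoly.id.snd.snd)

end commitments

/-! ### Zero knowledge of the protocol. -/

namespace TIAlg

variable {p w E m n h : ℕ} {K : CommitScheme (ZMod p)}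

theorem map_comParty (κ ℓ : ℕ) (msg : Party p m) :
    (rndParty K κ m ℓ).map (comParty K κ msg) =
      ((samples (K.rnd κ ℓ) m).map fun r j => K.com κ (msg.1 j) (r j)).bind fun a =>
        ((K.rnd κ ℓ).map (K.com κ msg.2)).bind fun b => PMF.pure (a, b) := by
  simp only [rndParty, PMF.map_bind, PMF.pure_map, PMF.bind_map, Function.comp_def]
  rfl

variable [Fact p.Prime]

theorem isPPT_map_comParty (hK : K.IsSecure) (ℓ : ℕ) (msg : Party p m) :
    IsPPT fun κ => (rndParty K κ m ℓ).map (comParty K κ msg) := by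
  simp only [map_comParty]
  exact (isPPT_samples_com hK ℓ msg.1).bind
    (B := fun κ a => ((K.rnd κ ℓ).map (K.com κ msg.2)).bind fun b => PMF.pure (a, b))
    (((isPPT_com hK ℓ msg.2).comp IsPoly.id.fst).bind
      (IsPPT.pure (IsPoly.id.fst.snd.prod IsPoly.id.snd)))

theorem indist_comParty (hK : K.IsSecure) {ℓ : ℕ} {msg₀ msg₁ : Party p m}
    (h₀ : (∀ j, (msg₀.1 j).length = ℓ) ∧ msg₀.2.length = ℓ)
    (h₁ : (∀ j, (msg₁.1 j).length = ℓ) ∧ msg₁.2.length = ℓ) :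
    Indist (fun κ => (rndParty K κ m ℓ).map (comParty K κ msg₀))
      fun κ => (rndParty K κ m ℓ).map (comParty K κ msg₁) := by
  simp only [map_comParty]
  exact (indist_samples_com hK h₀.1 h₁.1).prod (indist_com hK h₀.2 h₁.2)
    (isPPT_com hK ℓ _) (isPPT_samples_com hK ℓ _)

variable {Z : ZKP (ZMod p)} {η : FVec p w E h} {f : TIAlg w E m n h}

/-- The simulator commits to zero vectors under simulated parameters and simulates the proof. The
intermediate game has the real commitments but a simulated proof: the proof system bounds the step
from the real game to it, and hiding bounds the step from it to the simulation. -/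
theorem zk_protocol (hL : Large p w f.width f.magnitude) (hK : K.IsSecure)
    (hZ : Z.IsZKAoK (f.circuit K)) :
    ∃ (S₁ : ℕ → PMF (Params p w E h × Party p m × Data))
      (S₂ : ℕ × Params p w E h × Party p m × Data × FVec p w E m → PMF Data),
    IsPPT S₁ ∧ IsPPT S₂ ∧
    ∀ V Vs Q, f.Runs V η Vs Q →
      ∀ D : ℕ × Params p w E h × Party p m × FVec p w E m × Data → PMF Bool, IsPPT D →
        Negligible fun κ =>
          |prob (((f.protocol η K Z).real κ V Vs Q).bind fun t =>
              D (κ, t.1, t.2.1, Q, t.2.2)) {true} -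
            prob ((S₁ κ).bind fun s => (S₂ (κ, s.1, s.2.1, s.2.2, Q)).bind fun π =>
              D (κ, s.1, s.2.1, Q, π)) {true}| := by
  obtain ⟨T₁, T₂, hT₁, hT₂, hT⟩ := hZ.zk
  let zero : List (ZMod p) := List.replicate (2 * n) 0
  let com (κ : ℕ) (msg : Party p m) := (rndParty K κ m (2 * n)).map (comParty K κ msg)
  refine ⟨fun κ => (T₁ κ).bind fun s => (com κ (fun _ => zero, zero)).bind fun c =>
      PMF.pure ((s.1, η), c, s.2),
    fun i => T₂ (i.1, i.2.1.1, i.2.2.2.1, publicInput i.2.2.1 i.2.2.2.2 i.2.1.2), ?_, ?_, ?_⟩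
  · exact hT₁.bind (B := fun κ s => (com κ (fun _ => zero, zero)).bind fun c =>
        PMF.pure (((s.1, η) : Params p w E h), c, s.2))
      (((isPPT_map_comParty hK (2 * n) _).comp IsPoly.id.fst).bind
        (IsPPT.pure ((IsPoly.id.fst.snd.fst.prod (IsPoly.const _)).prod
          (IsPoly.id.snd.prod IsPoly.id.fst.snd.snd))))
  · let ι := ℕ × Params p w E h × Party p m × Data × FVec p w E m
    exact hT₂.comp (g := fun i : ι => (i.1, i.2.1.1, i.2.2.2.1,
        publicInput i.2.2.1 i.2.2.2.2 i.2.1.2))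
      (IsPoly.id.fst.prod (IsPoly.id.snd.fst.fst.prod (IsPoly.id.snd.snd.snd.fst.prod
        (isPoly_publicInput IsPoly.id.snd.snd.fst IsPoly.id.snd.snd.snd.snd IsPoly.id.snd.fst.snd))))
  · intro V Vs Q hr D hD
    -- The simulated game for given commitments, regarded as a distinguisher of commitments.
    let F (κ : ℕ) (c : Party p m) : PMF Bool := (T₁ κ).bind fun s =>
      (T₂ (κ, s.1, s.2, publicInput c Q η)).bind fun π => D (κ, (s.1, η), c, Q, π)
    -- The distinguisher against the proof system reads the commitments off the public input; `Q`
    -- and `η` are fixed and built into it.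
    obtain ⟨ν, hν, hνle⟩ := hT (fun i => D (i.1, (i.2.1, η), ofParts m i.2.2.1, Q, i.2.2.2))
      (hD.comp (g := fun i : ℕ × Data × Blocks (ZMod p) × Data =>
          (i.1, ((i.2.1, η) : Params p w E h), ofParts m i.2.2.1, Q, i.2.2.2))
        (IsPoly.id.fst.prod ((IsPoly.id.snd.fst.prod (IsPoly.const _)).prod
          ((isPoly_ofParts IsPoly.id.snd.snd.fst).prod
            ((IsPoly.const _).prod IsPoly.id.snd.snd.snd)))))
    have h1 : IsPPT fun y : (ℕ × Party p m) × Data × Data =>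
        T₂ (y.1.1, y.2.1, y.2.2, publicInput y.1.2 Q η) :=
      hT₂.comp (IsPoly.id.fst.fst.prod (IsPoly.id.snd.fst.prod (IsPoly.id.snd.snd.prod
        (isPoly_publicInput IsPoly.id.fst.snd (IsPoly.const _) (IsPoly.const _)))))
    have h2 : IsPPT fun z : ((ℕ × Party p m) × Data × Data) × Data =>
        D (z.1.1.1, (z.1.2.1, η), z.1.1.2, Q, z.2) :=
      hD.comp (IsPoly.id.fst.fst.fst.prod ((IsPoly.id.fst.snd.fst.prod (IsPoly.const _)).prod
        (IsPoly.id.fst.fst.snd.prod ((IsPoly.const _).prod IsPoly.id.snd))))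
    have h3 := h1.bind (B := fun y π => D (y.1.1, (y.2.1, η), y.1.2, Q, π)) h2
    have h4 : IsPPT fun x : (ℕ × Party p m) × Data × Data =>
        (T₂ (x.1.1, x.2.1, x.2.2, publicInput x.1.2 Q η)).bind fun π =>
          D (x.1.1, (x.2.1, η), x.1.2, Q, π) := h3
    have h5 := hT₁.comp (g := fun x : ℕ × Party p m => x.1) IsPoly.id.fst
    have hF : IsPPT fun x : ℕ × Party p m => F x.1 x.2 := h5.bind h4
    have hhide := indist_comParty (ℓ := 2 * n) hK (msg₀ := messages V Vs)
      (msg₁ := (fun _ => zero, zero))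
      ⟨fun j => FVec.length_toField _, FVec.length_toField _⟩
      ⟨fun j => List.length_replicate, List.length_replicate⟩ (fun x => F x.1 x.2) hF
    refine (hν.add hhide).mono fun κ => ?_
    rw [abs_abs, real_bind]
    have hsim : ((T₁ κ).bind fun s => (com κ (fun _ => zero, zero)).bind fun c =>
          PMF.pure (((s.1, η) : Params p w E h), c, s.2)).bind (fun s =>
        (T₂ (κ, s.1.1, s.2.2, publicInput s.2.1 Q s.1.2)).bind fun π =>
          D (κ, s.1, s.2.1, Q, π)) = (com κ (fun _ => zero, zero)).bind (F κ) := by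
      simp only [PMF.bind_bind, PMF.pure_bind]
      exact PMF.bind_comm _ _ _
    rw [hsim]
    -- The intermediate game: real commitments, simulated proof.
    refine (abs_sub_le _ (prob ((com κ (messages V Vs)).bind (F κ)) {true}) _).trans
      (add_le_add ?_ le_rfl)
    simp only [com, PMF.bind_map]
    -- The bound `ν κ` is uniform in statement and witness, so it survives averaging over the
    -- randomness of the commitments.
    refine abs_prob_bind_sub_le _ fun r hr' => ?_
    have := hνle κ _ _ (f.sat_of_runs hL hK κ hr r fun j hj => length_rndParty hK hr' hj)
    simp only [ofParts_publicInput] at this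
    exact this

/-! ### Soundness -/

open Classical in
/-- The openings in the encoding of a forgery: messages and randomness. -/
def openings (w E m n : ℕ) (p : ℕ) (d : Data) : Blocks (ZMod p) × Blocks (ZMod p) :=
  if H : ∃ o : Forgery p w E m n, Enc.enc o = d then
    (parts (messages H.choose.V H.choose.Vs), parts H.choose.rnd) else ([], [])

/-- The encoding of a forgery determines its messages and randomness, so the choice in `openings` is
harmless. -/
theorem openings_enc (hw : 2 ^ w < p) (hE : 2 * E < p) (o : Forgery p w E m n) :
    openings w E m n p (Enc.enc o) = (parts (messages o.V o.Vs), parts o.rnd) := by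
  have H : ∃ o' : Forgery p w E m n, (Enc.enc o' : Data) = Enc.enc o := ⟨o, rfl⟩
  have hv : ∀ k, Function.Injective (Enc.enc : FVec p w E k → Data) := fun k =>
    enc_fVec_injective hw hE
  have hl := enc_list_injective (enc_zmod_injective (p := p))
  have hc := enc_prod_injective (enc_pi_injective (n := m) hl) hl
  have hd : Function.Injective (Enc.enc : Data → Data) := fun _ _ h => h
  have := enc_prod_injective hc (enc_prod_injective (enc_pi_injective (n := m) (hv n))
    (enc_prod_injective (hv n) (enc_prod_injective hc (enc_prod_injective (hv m) hd))))
    H.choose_spec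
  simp only [Prod.mk.injEq] at this
  rw [openings, dif_pos H, this.2.1, this.2.2.1, this.2.2.2.1]

/-- The two openings of the `j`-th commitment that come from a forgery and from the witness that
an extractor finds. -/
def openingPair (w E m n : ℕ) {p : ℕ} (j : ℕ)
    (o : (Blocks (ZMod p) × Data × Data) × Blocks (ZMod p)) :
    (List (ZMod p) × List (ZMod p)) × (List (ZMod p) × List (ZMod p)) :=
  (((openings w E m n p o.1.2.2).1.getD j [], (openings w E m n p o.1.2.2).2.getD j []),
    (o.2.getD j [], o.2.getD (m + 1 + j) []))

/-- `openings` is not computed as it is defined. On encodings of forgeries, however, it amounts to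
taking subtrees and rearranging them, and nothing else lies in the support. -/
theorem isPPT_openingPair (hw : 2 ^ w < p) (hE : 2 * E < p) {α : Type} [Enc α]
    {X : α → PMF ((Blocks (ZMod p) × Data × Data) × Blocks (ZMod p))} (hX : IsPPT X)
    (h : ∀ a, ∀ o ∈ (X a).support, ∃ F : Forgery p w E m n, o.1.2.2 = Enc.enc F) (j : ℕ) :
    IsPPT fun a => (X a).map (openingPair w E m n j) := by
  let ι := Party p m × (Fin m → FVec p w E n) × FVec p w E n × Party p m × FVec p w E m × Data
  obtain ⟨k, hk, hkf⟩ : IsPoly fun x : ι × Blocks (ZMod p) =>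
      (((parts (messages x.1.2.1 x.1.2.2.1)).getD j [], (parts x.1.2.2.2.1).getD j []),
        (x.2.getD j [], x.2.getD (m + 1 + j) [])) := by
    have h1 : IsPoly fun x : ι × Blocks (ZMod p) => parts (messages x.1.2.1 x.1.2.2.1) := by
      simpa only [List.append_nil] using
        isPoly_parts_append (isPoly_messages IsPoly.id.fst.snd.fst IsPoly.id.fst.snd.snd.fst) .nil
    have h2 : IsPoly fun x : ι × Blocks (ZMod p) => parts x.1.2.2.2.1 := by
      simpa only [List.append_nil] using isPoly_parts_append IsPoly.id.fst.snd.snd.snd.fst .nil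
    exact ((h1.getD_nil j).prod (h2.getD_nil j)).prod
      ((IsPoly.id.snd.getD_nil j).prod (IsPoly.id.snd.getD_nil (m + 1 + j)))
  -- The projections take the prover's state, which encodes the forgery, and the extracted witness
  -- out of ((statement, proof, state), witness).
  refine hX.map_of_support (hk.comp (.node (.right (.right (.left .id))) (.right .id)))
    fun a o ho => ?_
  obtain ⟨F, hF⟩ := h a o ho
  have e := hkf ((F.com, F.V, F.Vs, F.rnd, F.Q, F.π), o.2)
  obtain ⟨⟨x, π, d⟩, y⟩ := o
  obtain rfl : d = Enc.enc F := hF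
  rw [openingPair, openings_enc hw hE]
  exact e

/-- A successful forgery falls under one of `m + 2` negligible events: extraction from an accepted
proof fails, or one of the `m + 1` commitments has two openings to different messages. -/
theorem sound_protocol (hL : Large p w f.width f.magnitude) (hw : 2 ^ w < p) (hE : 2 * E < p)
    (hK : K.IsSecure) (hZ : Z.IsZKAoK (f.circuit K))
    {A : ℕ × Params p w E h → PMF (Forgery p w E m n)} (hA : IsPPT A) :
    Negligible fun κ => prob
      (((f.protocol η K Z).setup κ).bind fun pp => (A (κ, pp)).bind fun o =>
        ((f.protocol η K Z).verify (κ, pp, o.com, o.Q, o.π)).bind fun b => PMF.pure (o, b))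
      {r | r.2 = true ∧ r.1.com = (f.protocol η K Z).comAll κ r.1.V r.1.Vs r.1.rnd ∧
        ¬ f.Valid r.1.V η r.1.Vs r.1.Q} := by
  -- The whole forgery is passed on as the state of the prover, so that its openings are still
  -- available next to the extracted witness.
  let g (o : Forgery p w E m n) : Blocks (ZMod p) × Data × Data :=
    (publicInput o.com o.Q η, o.π, Enc.enc o)
  have hg : IsPoly g := by
    let ι := Party p m × (Fin m → FVec p w E n) × FVec p w E n × Party p m × FVec p w E m × Data
    obtain ⟨k, hk, hkf⟩ : IsPoly fun x : ι => (publicInput x.1 x.2.2.2.2.1 η, x.2.2.2.2.2,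
        (Enc.enc x : Data)) :=
      (isPoly_publicInput IsPoly.id.fst IsPoly.id.snd.snd.snd.snd.fst (IsPoly.const _)).prod
        (IsPoly.id.snd.snd.snd.snd.snd.prod (IsPoly.id.of_enc fun _ => rfl))
    exact ⟨k, hk, fun o => hkf (o.com, o.V, o.Vs, o.rnd, o.Q, o.π)⟩
  obtain ⟨X, hX, hXA, hneg⟩ := hZ.sound (fun i => (A (i.1, i.2, η)).map g)
    ((hA.comp (g := fun i : ℕ × Data => (i.1, ((i.2, η) : Params p w E h)))
      (IsPoly.id.fst.prod (IsPoly.id.snd.prod (IsPoly.const _)))).map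
      (g := fun _ => g) (hg.comp IsPoly.id.snd))
  have hsupp : ∀ i, ∀ o ∈ (X i).support, ∃ F : Forgery p w E m n, o.1 = g F := by
    intro i o ho
    have : o.1 ∈ ((X i).map Prod.fst).support := (PMF.mem_support_map_iff _ _ _).2 ⟨o, ho, rfl⟩
    rw [hXA] at this
    obtain ⟨F, _, hF⟩ := (PMF.mem_support_map_iff _ _ _).1 this
    exact ⟨F, hF.symm⟩
  -- The adversary against binding of the `j`-th commitment: it runs the extractor and outputs the
  -- opening of the forgery and that of the witness.
  let B (j κ : ℕ) := (Z.setup κ).bind fun pp => (X (κ, pp)).map (openingPair w E m n j)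
  have hB (j : ℕ) := hK.isBinding (B j) (hZ.ppt_setup.bind
    (isPPT_openingPair hw hE hX (fun i o ho => (hsupp i o ho).imp fun F hF => by rw [hF]) j))
  refine (hneg.add (Negligible.sum (Finset.range (m + 1)) fun j _ => hB j)).mono fun κ => ?_
  rw [abs_of_nonneg (prob_nonneg _ _)]
  set d := (Z.setup κ).bind fun pp => (X (κ, pp)).bind fun o =>
    (Z.verify κ (f.circuit K κ) pp o.1.1 o.1.2.1).bind fun b => PMF.pure (o, b) with hd
  -- Success is expressed through the prover's output and the verdict alone, which are present in
  -- the games with and without extraction.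
  let bad : Set ((Blocks (ZMod p) × Data × Data) × Bool) :=
    {r | r.2 = true ∧ ∃ F : Forgery p w E m n, r.1 = g F ∧
      F.com = comParty K κ (messages F.V F.Vs) F.rnd ∧ ¬ f.Valid F.V η F.Vs F.Q}
  -- The extractor reproduces the law of the prover's output, so statement, proof, state and verdict
  -- are distributed alike in both games.
  have e : (((f.protocol η K Z).setup κ).bind fun pp => (A (κ, pp)).bind fun o =>
      ((f.protocol η K Z).verify (κ, pp, o.com, o.Q, o.π)).bind fun b => PMF.pure (o, b)).map
        (fun r => (g r.1, r.2)) = d.map fun r => (r.1.1, r.2) := by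
    have e1 : d.map (fun r => (r.1.1, r.2)) = (Z.setup κ).bind fun pp =>
        ((X (κ, pp)).map Prod.fst).bind fun a =>
          (Z.verify κ (f.circuit K κ) pp a.1 a.2.1).bind fun b => PMF.pure (a, b) := by
      simp only [hd, PMF.map_bind, PMF.pure_map, PMF.bind_map, Function.comp_def]
    rw [e1]
    simp only [hXA, protocol, PMF.bind_bind, PMF.pure_bind, PMF.map_bind, PMF.pure_map,
      PMF.bind_map, Function.comp_def]
    rfl
  calc _ ≤ prob _ ((fun r : Forgery p w E m n × Bool => (g r.1, r.2)) ⁻¹' bad) :=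
        prob_mono _ fun r _ hr => ⟨hr.1, r.1, rfl, hr.2.1, hr.2.2⟩
    _ = prob d ((fun r => (r.1.1, r.2)) ⁻¹' bad) := by rw [← prob_map, e, prob_map]
    _ ≤ prob d ({r | r.2 = true ∧ ¬ (f.circuit K κ).Sat r.1.1.1 r.1.2} ∪
          {r | ∃ j ∈ Finset.range (m + 1), r ∈ (fun r : _ × Bool => openingPair w E m n j r.1) ⁻¹'
            {o | o.1.1 ≠ o.2.1 ∧ o.1.1.length = o.2.1.length ∧
              K.com κ o.1.1 o.1.2 = K.com κ o.2.1 o.2.2}}) := by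
        refine prob_mono _ fun r _ hr => ?_
        obtain ⟨hb, F, hF, hcom, hval⟩ := hr
        by_cases hs : (f.circuit K κ).Sat r.1.1.1 r.1.2
        · right
          have hF' : r.1.1 = g F := hF
          rw [hF'] at hs
          obtain ⟨h1, h2⟩ := f.of_sat hL hK κ (V := F.V) (Vs := F.Vs) hs
          -- If all messages in the witness were those of the forgery, the result would be valid; so
          -- they differ for some `j`, while both open the same commitment.
          have : ¬ ∀ j < m + 1, r.1.2.getD j [] = (parts (messages F.V F.Vs)).getD j [] :=
            fun H => hval (h2 H)
          push Not at this
          obtain ⟨j, hj, hne⟩ := this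
          refine ⟨j, Finset.mem_range.2 hj, ?_⟩
          have hp : openingPair w E m n j r.1 =
              (((parts (messages F.V F.Vs)).getD j [], (parts F.rnd).getD j []),
                (r.1.2.getD j [], r.1.2.getD (m + 1 + j) [])) := by
            rw [openingPair, hF', openings_enc hw hE]
          rw [Set.mem_preimage, hp]
          refine ⟨hne.symm, ?_, ?_⟩
          · exact (length_messages _ _ hj).trans (h1 j hj).1.symm
          · rw [← getD_comParty K κ _ _ hj, ← hcom]
            exact (h1 j hj).2
        · exact Or.inl ⟨hb, hs⟩
    _ ≤ _ := by
        refine (prob_union_le _ _ _).trans (add_le_add le_rfl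
          ((prob_iUnion_le _ _ _).trans (Finset.sum_le_sum fun j _ => le_of_eq ?_)))
        rw [← prob_map]
        congr 1
        -- The pair of openings ignores the verdict, so verification can be dropped from the game.
        simp only [hd, B, PMF.map_bind, PMF.pure_map, PMF.bind_const]
        rfl

theorem isZkTI_protocol (hL : Large p w f.width f.magnitude) (hK : K.IsSecure)
    (hZ : Z.IsZKAoK (f.circuit K)) : IsZkTI f η (f.protocol η K Z) := by
  have hw : 2 ^ w < p :=
    (Nat.pow_le_pow_right (by norm_num) (by omega)).trans_lt hL.size
  have hE : 2 * E < p :=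
    (Nat.mul_le_mul_left 2 f.le_magnitude).trans_lt (hL.width.trans hL.two_pow_lt)
  exact {
    ppt_setup := isPPT_setup hZ
    ppt_commit := isPPT_commit hK
    ppt_aux := isPPT_aux hK hw hE
    ppt_prove := isPPT_prove hZ
    ppt_verify := isPPT_verify hZ
    prior := fun κ pp hpp => by
      obtain ⟨a, _, ha⟩ := (PMF.mem_support_bind_iff _ _ _).1 hpp
      rw [PMF.mem_support_pure_iff] at ha
      rw [ha]
    complete := fun κ V Vs Q hr => complete_protocol hL hK hZ κ hr
    sound := fun A hA => sound_protocol hL hw hE hK hZ hA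
    zk := zk_protocol hL hK hZ }

end TIAlg

end ZkTI

end

theorem theorem1 (p : ℕ) [Fact p.Prime] (w E : ℕ) (hw : 1 ≤ w) (hp : 2 ^ (3 * w + 1) < p)
    (K : ZkTI.CommitScheme (ZMod p)) (hK : K.IsSecure) (Z : ZkTI.ZKP (ZMod p)) :
    (∀ (m n h : ℕ) (f : ZkTI.TIAlg w E m n h) (η : ZkTI.FVec p w E h),
      2 ^ (w + f.width + 1) < p → Z.IsZKAoK (f.circuit K) →
        ZkTI.IsZkTI f η (f.protocol η K Z)) ∧
    (∀ (m n : ℕ) (dist : List (ℕ × ℕ) → StateM (ZkTI.Draft w E) ℕ) (η : ZkTI.FVec p w E m),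
      2 ^ (w + (ZkTI.crh w E m n dist).width + 1) < p →
      Z.IsZKAoK ((ZkTI.crh w E m n dist).circuit K) →
        ZkTI.IsZkTI (ZkTI.crh w E m n dist) η ((ZkTI.crh w E m n dist).protocol η K Z)) ∧
    (∀ (m n l : ℕ) (c : Fin l → ZkTI.Flt w E) (η : ZkTI.FVec p w E (m + m)),
      2 ^ (w + (ZkTI.zenCrowd w E m n l c).width + 1) < p →
      Z.IsZKAoK ((ZkTI.zenCrowd w E m n l c).circuit K) →
        ZkTI.IsZkTI (ZkTI.zenCrowd w E m n l c) η
          ((ZkTI.zenCrowd w E m n l c).protocol η K Z)) := by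
  have key : ∀ (m n h : ℕ) (f : ZkTI.TIAlg w E m n h) (η : ZkTI.FVec p w E h),
      2 ^ (w + f.width + 1) < p → Z.IsZKAoK (f.circuit K) →
        ZkTI.IsZkTI f η (f.protocol η K Z) := fun m n h f η hk hZ =>
    ZkTI.TIAlg.isZkTI_protocol (f.large hw hp hk) hK hZ
  -- CRH, for any code emitted by `dist`, and ZenCrowd are straight-line programs; no other property
  -- of them matters.
  exact ⟨key, fun m n dist η => key m n m _ η, fun m n l c η => key m n (m + m) _ η⟩
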